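/- Let $\mathfrak{A}$ be a structure with finite domain $A$ (possibly empty) and finite relational signature $\tau$. Suppose that $\mathfrak{A}$ has a Maltsev polymorphism, i.e. there is an operation $f\colon A^3\to A$ such that $f(y,x,x)=f(x,x,y)=y$ for all $x,y\in A$, and such that for every relation symbol $R\in\tau$ of arity $k$ and all $r,s,t\in R^{\mathfrak{A}}$ the tuple $(f(r_1,s_1,t_1),\dots,f(r_k,s_k,t_k))$ again lies in $R^{\mathfrak{A}}$. Then $\mathrm{CSP}(\mathfrak{A})$ can be solved in polynomial time: there is a (multi-stack) Turing machine which, given any primitive positive $\tau$-sentence $\phi=\exists x_0,\dots,x_{n-1}\,(\psi_1\wedge\dots\wedge\psi_m)$, where each $\psi_j$ is of the form $R(x_{i_1},\dots,x_{i_k})$ with $R\in\tau$, or $x_i=x_j$, or $\top$, or $\bot$, decides whether $\phi$ is true in $\mathfrak{A}$, in a number of steps bounded by a polynomial (depending only on $\mathfrak{A}$) in the length of $\phi$, written as a word over a finite alphabet with variable indices in binary. -/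

import Mathlib

universe u w

namespace FiniteCSP

/-- An operation `f : A ^ k → A` is a polymorphism of the relational structure `A` if it preserves
every relation of `A`: applying `f` componentwise to `k` tuples of the relation gives a tuple of the
relation. -/
def IsPolymorphism (L : FirstOrder.Language.{u, 0}) {A : Type w} [L.Structure A] {k : ℕ}
    (f : (Fin k → A) → A) : Prop :=
  ∀ (n : ℕ) (R : L.Relations n) (t : Fin k → Fin n → A),
    (∀ j, FirstOrder.Language.Structure.RelMap R (t j)) →
      FirstOrder.Language.Structure.RelMap R (fun i => f (fun j => t j i))

/-- A Maltsev operation: `f (y, x, x) = f (x, x, y) = y` for all `x` and `y`. -/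
def IsMaltsev {A : Type w} (f : (Fin 3 → A) → A) : Prop :=
  ∀ x y : A, f ![y, x, x] = y ∧ f ![x, x, y] = y

/-- Atomic formulas over a relational signature, with variables from `V`: `R(v₁, …, v_k)`,
`x = y`, `⊤` and `⊥`. -/
inductive Atom (L : FirstOrder.Language.{u, 0}) (V : Type) : Type
  | rel {k : ℕ} (R : L.Relations k) (v : Fin k → V) : Atom L V
  | eq (x y : V) : Atom L V
  | top : Atom L V
  | bot : Atom L V

/-- Truth of an atomic formula in the structure `A` under an assignment `s` of its variables. -/
def Atom.Holds {L : FirstOrder.Language.{u, 0}} {V : Type} (A : Type w) [L.Structure A] (s : V → A) :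
    Atom L V → Prop
  | .rel R v => FirstOrder.Language.Structure.RelMap R (fun i => s (v i))
  | .eq x y => s x = s y
  | .top => True
  | .bot => False

/-- A primitive positive sentence `∃ x₀ … x_{n-1} (ψ₁ ∧ … ∧ ψ_m)` with atomic `ψ_j`. -/
structure PPSentence (L : FirstOrder.Language.{u, 0}) : Type where
  /-- the number of (existentially quantified) variables -/
  numVars : ℕ
  /-- the conjuncts -/
  atoms : List (Atom L (Fin numVars))

/-- `φ.Holds A`: the sentence `φ` is true in `A`, i.e. some assignment of its variables
satisfies all conjuncts. -/
def PPSentence.Holds {L : FirstOrder.Language.{u, 0}} (φ : PPSentence L) (A : Type w) [L.Structure A] :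
    Prop :=
  ∃ s : Fin φ.numVars → A, ∀ ψ ∈ φ.atoms, ψ.Holds A s

/-- The alphabet in which sentences are written. It is finite if the signature is. -/
inductive Letter (L : FirstOrder.Language.{u, 0}) : Type
  | ex : Letter L
  | var : Letter L
  | bit (b : Bool) : Letter L
  | rel {k : ℕ} (R : L.Relations k) : Letter L
  | eq : Letter L
  | top : Letter L
  | bot : Letter L

/-- The variable `x_i` is written as `var` followed by the binary digits of `i`. -/
def encodeVar (L : FirstOrder.Language.{u, 0}) (i : ℕ) : List (Letter L) :=
  .var :: (Computability.encodeNat i).map .bit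

/-- An atomic formula is written as its head symbol followed by its variables. -/
def Atom.encode {L : FirstOrder.Language.{u, 0}} {n : ℕ} : Atom L (Fin n) → List (Letter L)
  | .rel R v => .rel R :: (List.ofFn v).flatMap (fun i => encodeVar L i.val)
  | .eq x y => .eq :: (encodeVar L x.val ++ encodeVar L y.val)
  | .top => [.top]
  | .bot => [.bot]

/-- A sentence is written as its quantifier prefix `∃ x₀ ∃ x₁ … ∃ x_{n-1}`, followed by its
conjuncts. -/
def PPSentence.encode {L : FirstOrder.Language.{u, 0}} (φ : PPSentence L) : List (Letter L) :=
  (List.range φ.numVars).flatMap (fun i => .ex :: encodeVar L i) ++ φ.atoms.flatMap Atom.encode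

open Classical in
/-- `CSP(A)` is solvable in polynomial time: some Turing machine, given any primitive positive
sentence `φ` (as a word), outputs whether `φ` is true in `A`, within a number of steps that is
bounded by a polynomial in the length of the word. -/
def CSPInPolyTime (L : FirstOrder.Language.{u, 0}) (A : Type w) [L.Structure A] : Prop :=
  Nonempty (Turing.TM2ComputableInPolyTime (PPSentence.encode (L := L)) Computability.encodeBool
    (fun φ => decide (φ.Holds A)))

end FiniteCSP

/-! The algorithm is that of Bulatov and Dalmau. A relation `R` of arity `N` closed under a Maltsev
operation `f` is stored by a compact representation: for every coordinate `i` and values `a`, `b`, a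
pair of elements of `R` that agree above `i` and take the values `a`, `b` at `i`, whenever such a
pair exists. This takes polynomial space although `R` may be exponentially large.

Starting from the full relation, the constraints are imposed one at a time, and the table is
recomputed after each. Two facts make this possible. First, from the table and some `t ∈ R`, one
obtains polynomially many generators of the fiber of all elements of `R` that agree with `t` above
`m`: going down through the coordinates, a stored pair `(u, u')` is transported to the pair `(s,
f(s, u, u'))` in the fiber, and the Maltsev identities correct one coordinate at a time
(`FiberInv.step`, `FiberInv.gen_iff`). Second, a constraint sees boundedly many coordinates. The
values at these and at one further coordinate form a key from a set of constant size, so one tuple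
per key of the generated algebra can be computed by terms fixed in advance (`IsTab.close`). To find
a new witness for `(a, b)` at `i`, search `R` for a tuple `t` with value `a` that satisfies the
constraint, then search the fiber of `t` above `i` for one with value `b`. If the latter fails there
is no witness at all, since `f(t, u, u')` would lie in that fiber for any witness `(u, u')`
(`trans_stepAt`).

Coordinates are positions in the input word, and a variable is represented by its last occurrence.
The remaining positions are unconstrained, so the word is satisfiable exactly when the sentence
holds (`solutions_nonempty_iff`, `holds_iff_exists_sat`).

For the time bound, the algorithm is written with loops over `[0, N)`, a finite memory and an `N ×
N` array of cells from a finite set, where `N` is the input length plus one. The nesting of loops is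
fixed, so such programs run in polynomial time on a multi-stack machine (`steps_compile`,
`ArrayProg.nonempty_polyTime`). An empty domain is treated by a separate scan of the word
(`holds_iff_good`). -/

namespace StackProg

/-! ### Structured stack programs and their execution by Turing machines. -/

open Turing Function

/-- Structured programs operating on a family of stacks `Γ` with a finite memory `σ`. -/
inductive Cmd {K : Type} (Γ : K → Type) (σ : Type) : Type
  | push (k : K) (f : σ → Γ k)
  | pop (k : K) (f : σ → Option (Γ k) → σ)
  | load (f : σ → σ)
  | seq (P Q : Cmd Γ σ)
  | ite (b : σ → Bool) (P Q : Cmd Γ σ)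
  | loop (b : σ → Bool) (P : Cmd Γ σ)

namespace Cmd

variable {K : Type} {Γ : K → Type} {σ : Type}

/-- The labels of the machine that executes a program. -/
def Lab : Cmd Γ σ → Type
  | push _ _ => Unit
  | pop _ _ => Unit
  | load _ => Unit
  | seq P Q => Lab P ⊕ Lab Q
  | ite _ P Q => Option (Lab P ⊕ Lab Q)
  | loop _ P => Option (Lab P)

theorem finite_lab : ∀ P : Cmd Γ σ, Finite P.Lab
  | push _ _ => inferInstanceAs (Finite Unit)
  | pop _ _ => inferInstanceAs (Finite Unit)
  | load _ => inferInstanceAs (Finite Unit)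
  | seq P Q => by
      have := finite_lab P
      have := finite_lab Q
      exact inferInstanceAs (Finite (Lab P ⊕ Lab Q))
  | ite _ P Q => by
      have := finite_lab P
      have := finite_lab Q
      exact inferInstanceAs (Finite (Option (Lab P ⊕ Lab Q)))
  | loop _ P => by
      have := finite_lab P
      exact inferInstanceAs (Finite (Option (Lab P)))

/-- The label at which execution starts. -/
def entry : (P : Cmd Γ σ) → P.Lab
  | push _ _ => ()
  | pop _ _ => ()
  | load _ => ()
  | seq P _ => Sum.inl (entry P)
  | ite _ _ _ => none
  | loop _ _ => none

/-- The machine code of a program whose labels are embedded into `Λ` by `e` and which continues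
at the label `x` when it is finished. -/
def code {Λ : Type} : (P : Cmd Γ σ) → (e : P.Lab → Λ) → (x : Λ) → P.Lab → TM2.Stmt Γ Λ σ
  | push k f, _, x, _ => .push k f (.goto fun _ => x)
  | pop k f, _, x, _ => .pop k f (.goto fun _ => x)
  | load f, _, x, _ => .load f (.goto fun _ => x)
  | seq P Q, e, _, Sum.inl l => code P (fun l => e (Sum.inl l)) (e (Sum.inr (entry Q))) l
  | seq _ Q, e, x, Sum.inr l => code Q (fun l => e (Sum.inr l)) x l
  | ite b P Q, e, _, none => .branch b (.goto fun _ => e (some (Sum.inl (entry P))))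
      (.goto fun _ => e (some (Sum.inr (entry Q))))
  | ite _ P _, e, x, some (Sum.inl l) => code P (fun l => e (some (Sum.inl l))) x l
  | ite _ _ Q, e, x, some (Sum.inr l) => code Q (fun l => e (some (Sum.inr l))) x l
  | loop b P, e, x, none => .branch b (.goto fun _ => e (some (entry P))) (.goto fun _ => x)
  | loop _ P, e, _, some l => code P (fun l => e (some l)) (e none) l

variable [DecidableEq K]

/-- Timed big-step semantics: `Run P v S v' S' t` says that `P` leads from memory `v` and
stacks `S` to memory `v'` and stacks `S'` in `t` steps. -/
inductive Run : Cmd Γ σ → σ → (∀ k, List (Γ k)) → σ → (∀ k, List (Γ k)) → ℕ → Prop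
  | push (k f v S) : Run (push k f) v S v (update S k (f v :: S k)) 1
  | pop (k f v S) : Run (pop k f) v S (f v (S k).head?) (update S k (S k).tail) 1
  | load (f v S) : Run (load f) v S (f v) S 1
  | seq {P Q v S v₁ S₁ v₂ S₂ t₁ t₂} : Run P v S v₁ S₁ t₁ → Run Q v₁ S₁ v₂ S₂ t₂ →
      Run (seq P Q) v S v₂ S₂ (t₁ + t₂)
  | ite_true {b P Q v S v₁ S₁ t} : b v = true → Run P v S v₁ S₁ t →
      Run (ite b P Q) v S v₁ S₁ (1 + t)
  | ite_false {b P Q v S v₁ S₁ t} : b v = false → Run Q v S v₁ S₁ t →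
      Run (ite b P Q) v S v₁ S₁ (1 + t)
  | loop_true {b P v S v₁ S₁ v₂ S₂ t₁ t₂} : b v = true → Run P v S v₁ S₁ t₁ →
      Run (loop b P) v₁ S₁ v₂ S₂ t₂ → Run (loop b P) v S v₂ S₂ (1 + (t₁ + t₂))
  | loop_false {b P v S} : b v = false → Run (loop b P) v S v S 1

theorem iterate_step_succ {Λ : Type} (M : Λ → TM2.Stmt Γ Λ σ) (l : Λ) (v : σ)
    (S : ∀ k, List (Γ k)) (t : ℕ) :
    (flip bind (TM2.step M))^[1 + t] (some ⟨some l, v, S⟩) =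
      (flip bind (TM2.step M))^[t] (some (TM2.stepAux (M l) v S)) := by
  rw [add_comm, Function.iterate_succ_apply]
  rfl

/-- Quantifying over the ambient machine `M`, the embedding `e` of labels and the exit `x` inside
the induction allows a subprogram to be run in place: its exit is the entry of its successor or, in
a loop, the test. -/
theorem Run.iterate_step {P : Cmd Γ σ} {v S v' S' t} (h : Run P v S v' S' t) :
    ∀ {Λ : Type} (M : Λ → TM2.Stmt Γ Λ σ) (e : P.Lab → Λ) (x : Λ),
      (∀ l, M (e l) = code P e x l) →
      (flip bind (TM2.step M))^[t] (some ⟨some (e P.entry), v, S⟩) = some ⟨some x, v', S'⟩ := by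
  induction h with
  | push k f v S =>
    intro Λ M e x h
    rw [iterate_step_succ M _ _ _ 0, h]
    rfl
  | pop k f v S =>
    intro Λ M e x h
    rw [iterate_step_succ M _ _ _ 0, h]
    rfl
  | load f v S =>
    intro Λ M e x h
    rw [iterate_step_succ M _ _ _ 0, h]
    rfl
  | @seq P Q v S v₁ S₁ v₂ S₂ t₁ t₂ _ _ ih₁ ih₂ =>
    intro Λ M e x h
    rw [add_comm, Function.iterate_add_apply]
    have h₁ := ih₁ M (fun l => e (Sum.inl l)) (e (Sum.inr (entry Q))) fun l => h (Sum.inl l)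
    have h₂ := ih₂ M (fun l => e (Sum.inr l)) x fun l => h (Sum.inr l)
    exact (congrArg _ h₁).trans h₂
  | @ite_true b P Q v S v₁ S₁ t hb _ ih =>
    intro Λ M e x h
    rw [iterate_step_succ, h]
    have := ih M (fun l => e (some (Sum.inl l))) x fun l => h (some (Sum.inl l))
    simpa only [entry, code, TM2.stepAux, hb, cond_true] using this
  | @ite_false b P Q v S v₁ S₁ t hb _ ih =>
    intro Λ M e x h
    rw [iterate_step_succ, h]
    have := ih M (fun l => e (some (Sum.inr l))) x fun l => h (some (Sum.inr l))
    simpa only [entry, code, TM2.stepAux, hb, cond_false] using this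
  | @loop_true b P v S v₁ S₁ v₂ S₂ t₁ t₂ hb _ _ ih₁ ih₂ =>
    intro Λ M e x h
    rw [iterate_step_succ, h, add_comm, Function.iterate_add_apply]
    have h₁ := ih₁ M (fun l => e (some l)) (e none) fun l => h (some l)
    have h₂ := ih₂ M e x h
    simp only [entry, code, TM2.stepAux, hb, cond_true] at h₁ h₂ ⊢
    rw [h₁, h₂]
  | @loop_false b P v S hb =>
    intro Λ M e x h
    rw [iterate_step_succ M _ _ _ 0, h]
    simp only [entry, code, TM2.stepAux, hb, cond_false]
    rfl

/-- The machine that executes a program and halts. -/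
def machine (P : Cmd Γ σ) : Option P.Lab → TM2.Stmt Γ (Option P.Lab) σ
  | none => .halt
  | some l => code P some none l

/-- The additional step executes `halt` at the label `none`. -/
theorem Run.iterate_machine {P : Cmd Γ σ} {v S v' S' t} (h : Run P v S v' S' t) :
    (flip bind (TM2.step P.machine))^[t + 1] (some ⟨some (some P.entry), v, S⟩) =
      some ⟨none, v', S'⟩ := by
  rw [add_comm, Function.iterate_add_apply, h.iterate_step P.machine some none fun _ => rfl]
  rfl

end Cmd

end StackProg

/-! ### Loop programs on a square array and their simulation in polynomial time. -/

namespace ArrayProg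

open Turing Function StackProg

/-- Iteration of a step function over the indices below `n`, in descending order. -/
def descend {S : Type} : ℕ → (ℕ → S → S) → S → S
  | 0, _, s => s
  | n + 1, F, s => descend n F (F n s)

theorem descend_induction {S : Type} {F : ℕ → S → S} (I : ℕ → S → Prop) {n : ℕ} {s : S}
    (h0 : I n s) (step : ∀ m < n, ∀ s, I (m + 1) s → I m (F m s)) : I 0 (descend n F s) := by
  induction n generalizing s with
  | zero => exact h0
  | succ n ih => exact ih (step n (by omega) s h0) fun m hm => step m (by omega)

/-- Programs with loops over `[0, N)`, operating on a finite memory `σ` and a two-dimensional array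
of cells which is addressed by the loop variables. -/
inductive Prog (Var σ Cell : Type) : Type
  | load (f : σ → σ)
  | upd (x y : Var) (g : σ → Cell → σ × Cell)
  | seq (P Q : Prog Var σ Cell)
  | ite (b : σ → Bool) (P Q : Prog Var σ Cell)
  | loop (x : Var) (P : Prog Var σ Cell)

variable {Var σ Cell Γ : Type} [DecidableEq Var]

/-- The effect of an array program with loop bound `N`. -/
def Prog.eval (N : ℕ) : Prog Var σ Cell → (Var → ℕ) → σ × (ℕ → ℕ → Cell) → σ × (ℕ → ℕ → Cell)
  | .load f, _, s => (f s.1, s.2)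
  | .upd x y g, e, s => ((g s.1 (s.2 (e x) (e y))).1,
      fun i j => if i = e x ∧ j = e y then (g s.1 (s.2 (e x) (e y))).2 else s.2 i j)
  | .seq P Q, e, s => Q.eval N e (P.eval N e s)
  | .ite b P Q, e, s => if b s.1 then P.eval N e s else Q.eval N e s
  | .loop x P, e, s => descend N (fun i s => P.eval N (update e x i) s) s

/-- No loop variable is bound again within its loop, and all loop variables are in `A`. -/
def Prog.WF : Finset Var → Prog Var σ Cell → Prop
  | _, .load _ => True
  | _, .upd _ _ _ => True
  | A, .seq P Q => P.WF A ∧ Q.WF A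
  | A, .ite _ P Q => P.WF A ∧ Q.WF A
  | A, .loop x P => x ∈ A ∧ P.WF (A.erase x)

/-- Names of the unary counters of the simulating machine. -/
inductive Cnt (Var : Type) : Type
  | pos (x : Var)
  | neg (x : Var)
  | ra
  | rb
  | tmp
  deriving DecidableEq

/-- Names of the stacks of the simulating machine. -/
inductive Stk (Var : Type) : Type
  | inp
  | out
  | cnt (u : Cnt Var)
  | left
  | right
  deriving DecidableEq

instance [Finite Var] : Finite (Cnt Var) :=
  Finite.of_injective (β := (Var ⊕ Var) ⊕ Fin 3)
    (fun | .pos x => .inl (.inl x) | .neg x => .inl (.inr x) | .ra => .inr 0 | .rb => .inr 1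
         | .tmp => .inr 2)
    (by intro a b; cases a <;> cases b <;> simp)

instance [Finite Var] : Finite (Stk Var) :=
  Finite.of_injective (β := Cnt Var ⊕ Fin 4)
    (fun | .cnt u => .inl u | .inp => .inr 0 | .out => .inr 1 | .left => .inr 2 | .right => .inr 3)
    (by intro a b; cases a <;> cases b <;> simp)

/-- The stack alphabets of the simulating machine. -/
abbrev Alph (Var Γ Cell : Type) : Stk Var → Type
  | .inp => Γ
  | .out => Bool
  | .cnt _ => Unit
  | .left => Cell
  | .right => Cell

/-- A readable form of the stack contents. -/
@[ext] structure Conf (Var Γ Cell : Type) where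
  inp : List Γ
  out : List Bool
  cnt : Cnt Var → ℕ
  left : List Cell
  right : List Cell

/-- The stack contents described by a configuration. -/
def Conf.stk (s : Conf Var Γ Cell) : ∀ k, List (Alph Var Γ Cell k)
  | .inp => s.inp
  | .out => s.out
  | .cnt u => List.replicate (s.cnt u) ()
  | .left => s.left
  | .right => s.right

/-- The finite memory of the simulating machine. -/
abbrev Mem (σ Cell : Type) : Type := σ × Bool × Cell

/-- Stack programs of the simulating machine. -/
abbrev SCmd (Var σ Cell Γ : Type) : Type := Cmd (Alph Var Γ Cell) (Mem σ Cell)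

namespace Conf

variable (s : Conf Var Γ Cell)

theorem update_inp (l : List Γ) : update s.stk .inp l = ({s with inp := l} : Conf _ _ _).stk := by
  funext k; cases k <;> simp [update, stk]

theorem update_out (l : List Bool) :
    update s.stk .out l = ({s with out := l} : Conf _ _ _).stk := by
  funext k; cases k <;> simp [update, stk]

theorem update_left (l : List Cell) :
    update s.stk .left l = ({s with left := l} : Conf _ _ _).stk := by
  funext k; cases k <;> simp [update, stk]

theorem update_right (l : List Cell) :
    update s.stk .right l = ({s with right := l} : Conf _ _ _).stk := by
  funext k; cases k <;> simp [update, stk]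

theorem update_cnt (u : Cnt Var) (n : ℕ) :
    update s.stk (.cnt u) (List.replicate n () : List Unit) =
      ({s with cnt := update s.cnt u n} : Conf _ _ _).stk := by
  funext k
  cases k with
  | cnt w =>
    by_cases h : w = u
    · subst h; rw [update_self]; simp only [stk, update_self]
    · simp [stk, update, h]
  | _ => simp [update, stk]

end Conf

/-- `Steps P T v s v' s'`: the stack program `P` leads from memory `v` and stacks `s` to memory `v'`
and stacks `s'` in at most `T` steps, whatever the scratch memory is. -/
def Steps (P : SCmd Var σ Cell Γ) (T : ℕ) (v : σ) (s : Conf Var Γ Cell) (v' : σ)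
    (s' : Conf Var Γ Cell) : Prop :=
  ∀ b c, ∃ b' c' t, t ≤ T ∧ Cmd.Run P (v, b, c) s.stk (v', b', c') s'.stk t

namespace Steps

variable {P Q : SCmd Var σ Cell Γ} {T T₁ T₂ : ℕ} {v v₁ v₂ : σ} {s s₁ s₂ : Conf Var Γ Cell}

theorem mono (h : Steps P T₁ v s v₁ s₁) (hT : T₁ ≤ T₂) : Steps P T₂ v s v₁ s₁ := fun b c =>
  let ⟨b', c', t, ht, hr⟩ := h b c
  ⟨b', c', t, ht.trans hT, hr⟩

theorem seq (h₁ : Steps P T₁ v s v₁ s₁) (h₂ : Steps Q T₂ v₁ s₁ v₂ s₂) :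
    Steps (.seq P Q) (T₁ + T₂) v s v₂ s₂ := fun b c =>
  let ⟨b', c', t, ht, hr⟩ := h₁ b c
  let ⟨b'', c'', t', ht', hr'⟩ := h₂ b' c'
  ⟨b'', c'', t + t', by omega, .seq hr hr'⟩

theorem load (f : σ → σ) : Steps (.load fun m => (f m.1, m.2) : SCmd Var σ Cell Γ) 1 v s (f v) s :=
  fun b c => ⟨b, c, 1, le_rfl, .load _ _ _⟩

theorem ite_true {b : σ → Bool} (hb : b v = true) (h : Steps P T v s v₁ s₁) :
    Steps (.ite (fun m => b m.1) P Q) (1 + T) v s v₁ s₁ := fun x c =>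
  let ⟨b', c', t, ht, hr⟩ := h x c
  ⟨b', c', 1 + t, by omega, .ite_true hb hr⟩

theorem ite_false {b : σ → Bool} (hb : b v = false) (h : Steps Q T v s v₁ s₁) :
    Steps (.ite (fun m => b m.1) P Q) (1 + T) v s v₁ s₁ := fun x c =>
  let ⟨b', c', t, ht, hr⟩ := h x c
  ⟨b', c', 1 + t, by omega, .ite_false hb hr⟩

end Steps

/-- Push a unit on a counter. -/
def inc (u : Cnt Var) : SCmd Var σ Cell Γ := .push (.cnt u) fun _ => ()

theorem steps_inc (u : Cnt Var) (v : σ) (s : Conf Var Γ Cell) :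
    Steps (inc u) 1 v s v {s with cnt := update s.cnt u (s.cnt u + 1)} := fun b c => by
  refine ⟨b, c, 1, le_rfl, ?_⟩
  rw [← s.update_cnt]
  exact .push (Γ := Alph Var Γ Cell) (.cnt u) _ _ _

/-- Pop from a stack repeatedly until it is empty, running `P` after each successful pop. -/
def drain (k : Stk Var) (f : Alph Var Γ Cell k → Cell → Cell) (P : SCmd Var σ Cell Γ) :
    SCmd Var σ Cell Γ :=
  let p : SCmd Var σ Cell Γ := .pop k fun m o =>
    (m.1, o.isSome, match o with | some g => f g m.2.2 | none => m.2.2)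
  .seq p (.loop (fun m => m.2.1) (.seq P p))

/-- A loop rule with an invariant indexed by what is left on the stack. Each element costs a test, a
run of `P` and a pop, hence `T + 2`; the first pop and the last test give the constant `2`. -/
theorem run_drain {k : Stk Var} {f : Alph Var Γ Cell k → Cell → Cell} {P : SCmd Var σ Cell Γ}
    {T : ℕ} (I : List (Alph Var Γ Cell k) → σ → (∀ k, List (Alph Var Γ Cell k)) → Prop)
    (hk : ∀ l v S, I l v S → S k = l)
    (step : ∀ g l v S c, I (g :: l) v S → ∃ v' b' c' S' t, t ≤ T ∧
      Cmd.Run P (v, true, f g c) (update S k l) (v', b', c') S' t ∧ I l v' S')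
    {l v S} (b c) (h : I l v S) :
    ∃ v' c' S' t, t ≤ l.length * (T + 2) + 2 ∧
      Cmd.Run (drain k f P) (v, b, c) S (v', false, c') S' t ∧ I [] v' S' := by
  -- With the opening pop split off from the loop, the pop that ends one pass is the opening pop in
  -- the induction hypothesis.
  suffices H : ∀ (l : List (Alph Var Γ Cell k)) v S b c, I l v S → ∃ v' c' S' t₁ t₂,
      t₁ + t₂ ≤ l.length * (T + 2) + 2 ∧ ∃ v₁ S₁,
      Cmd.Run (.pop k fun m o =>
        (m.1, o.isSome, match o with | some g => f g m.2.2 | none => m.2.2) :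
          SCmd Var σ Cell Γ) (v, b, c) S v₁ S₁ t₁ ∧
      Cmd.Run (.loop (fun m => m.2.1) (.seq P (.pop k fun m o =>
        (m.1, o.isSome, match o with | some g => f g m.2.2 | none => m.2.2))) :
          SCmd Var σ Cell Γ) v₁ S₁ (v', false, c') S' t₂ ∧ I [] v' S' by
    obtain ⟨v', c', S', t₁, t₂, ht, v₁, S₁, h₁, h₂, h₃⟩ := H l v S b c h
    exact ⟨v', c', S', t₁ + t₂, ht, .seq h₁ h₂, h₃⟩
  intro l
  induction l with
  | nil =>
    intro v S b c h
    have hS := hk _ _ _ h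
    refine ⟨v, c, S, 1, 1, by simp, _, _, .pop _ _ _ _, ?_, h⟩
    have : update S k (S k).tail = S := by
      conv_rhs => rw [← update_eq_self k S]
      rw [hS]; rfl
    rw [this, hS]
    exact .loop_false rfl
  | cons g l ih =>
    intro v S b c h
    have hS := hk _ _ _ h
    obtain ⟨v₁, b₁, c₁, S₁, t, ht, hr, hI⟩ := step g l v S c h
    obtain ⟨v', c', S', t₁, t₂, ht', v₂, S₂, h₁, h₂, h₃⟩ := ih v₁ S₁ b₁ c₁ hI
    refine ⟨v', c', S', 1, 1 + ((t + t₁) + t₂), ?_, _, _, .pop _ _ _ _, ?_, h₃⟩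
    · simp only [List.length_cons, add_mul]
      omega
    · rw [hS]
      exact .loop_true rfl (.seq hr h₁) h₂

/-- Empty a counter, running `P` for each unit. -/
def drainCnt (u : Cnt Var) (P : SCmd Var σ Cell Γ) : SCmd Var σ Cell Γ :=
  let p : SCmd Var σ Cell Γ := .pop (.cnt u) fun m o => (m.1, o.isSome, m.2.2)
  .seq p (.loop (fun m => m.2.1) (.seq P p))

theorem steps_drainCnt {u : Cnt Var} {P : SCmd Var σ Cell Γ} {T : ℕ}
    (I : ℕ → σ → Conf Var Γ Cell → Prop) (hI : ∀ n v s, I n v s → s.cnt u = n)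
    (step : ∀ n v s, I (n + 1) v s → ∃ v' s',
      Steps P T v {s with cnt := update s.cnt u n} v' s' ∧ I n v' s')
    {n v s} (h : I n v s) :
    ∃ v' s', Steps (drainCnt u P) (n * (T + 2) + 2) v s v' s' ∧ I 0 v' s' := by
  -- The final memory and stacks are chosen before the scratch values, because in `Steps` they must
  -- not depend on these.
  suffices H : ∀ n v s, I n v s → ∃ v' s', I 0 v' s' ∧ ∀ b c, ∃ b' c' t₁ t₂,
      t₁ + t₂ ≤ n * (T + 2) + 2 ∧ ∃ v₁ S₁,
      Cmd.Run (.pop (.cnt u) fun m o =>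
        (m.1, o.isSome, m.2.2) :
          SCmd Var σ Cell Γ) (v, b, c) s.stk v₁ S₁ t₁ ∧
      Cmd.Run (.loop (fun m => m.2.1) (.seq P (.pop (.cnt u) fun m o =>
        (m.1, o.isSome, m.2.2))) :
          SCmd Var σ Cell Γ) v₁ S₁ (v', b', c') s'.stk t₂ by
    obtain ⟨v', s', h0, H⟩ := H n v s h
    refine ⟨v', s', fun b c => ?_, h0⟩
    obtain ⟨b', c', t₁, t₂, ht, v₁, S₁, h₁, h₂⟩ := H b c
    exact ⟨b', c', t₁ + t₂, ht, .seq h₁ h₂⟩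
  intro n
  induction n with
  | zero =>
    intro v s h
    have hs := hI _ _ _ h
    refine ⟨v, s, h, fun b c => ⟨false, c, 1, 1, by simp, _, _, .pop _ _ _ _, ?_⟩⟩
    have hS : s.stk (.cnt u) = List.replicate 0 () := by simp [Conf.stk, hs]
    have : update s.stk (.cnt u) (s.stk (.cnt u)).tail = s.stk := by
      conv_rhs => rw [← update_eq_self (.cnt u) s.stk]
      rw [hS]; rfl
    rw [this, hS]
    exact .loop_false rfl
  | succ n ih =>
    intro v s h
    have hs := hI _ _ _ h
    obtain ⟨v₁, s₁, hP, h1⟩ := step n v s h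
    obtain ⟨v', s', h0, H⟩ := ih v₁ s₁ h1
    refine ⟨v', s', h0, fun b c => ?_⟩
    obtain ⟨b₁, c₁, t, ht, hr⟩ := hP true c
    obtain ⟨b', c', t₁, t₂, ht', v₂, S₂, h₁, h₂⟩ := H b₁ c₁
    refine ⟨b', c', 1, 1 + ((t + t₁) + t₂), ?_, _, _, .pop _ _ _ _, ?_⟩
    · simp only [add_mul]
      omega
    · have hS : s.stk (.cnt u) = () :: List.replicate n () := by
        simp [Conf.stk, hs, List.replicate_succ]
      rw [hS, List.tail_cons, s.update_cnt]
      exact .loop_true rfl (.seq hr h₁) h₂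

/-- Move the memory head by one cell to the right. -/
def hop : SCmd Var σ Cell Γ :=
  .seq (.pop .right fun m o => (m.1, m.2.1, Option.getD o m.2.2))
    (.push .left fun m => m.2.2)

theorem steps_hop (v : σ) (s : Conf Var Γ Cell) (a : Cell) (l : List Cell)
    (h : s.right = a :: l) :
    Steps hop 2 v s v {s with left := a :: s.left, right := l} := by
  intro b c
  refine ⟨b, a, 1 + 1, le_rfl, .seq (.pop _ _ _ _) ?_⟩
  have h1 : s.stk .right = a :: l := h
  rw [h1]
  have := Cmd.Run.push (Γ := Alph Var Γ Cell) .left (fun m : Mem σ Cell => m.2.2) (v, b, a)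
    ({s with right := l} : Conf _ _ _).stk
  rw [Conf.update_left] at this
  rw [List.tail_cons, s.update_right]
  exact this

/-- Move the memory head to the first cell. -/
def rewind : SCmd Var σ Cell Γ :=
  drain .left (fun a _ => a) (.push .right fun m => m.2.2)

theorem steps_rewind (v : σ) (s : Conf Var Γ Cell) :
    Steps rewind (s.left.length * 3 + 2) v s v
      {s with left := [], right := s.left.reverse ++ s.right} := by
  intro b c
  obtain ⟨v', c', S', t, ht, hr, rfl, hS⟩ := run_drain (T := 1) (v := v) (k := .left)
    (f := fun a _ => a) (P := (.push .right fun m => m.2.2 : SCmd Var σ Cell Γ))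
    (I := fun l v' S => v' = v ∧ ∃ r : List Cell, List.reverse (α := Cell) l ++ r =
      s.left.reverse ++ s.right ∧ S = ({s with left := l, right := r} : Conf Var Γ Cell).stk)
    (by rintro l v S ⟨-, r, -, rfl⟩; rfl)
    (by
      rintro g l v' S c ⟨rfl, r, hr, rfl⟩
      refine ⟨v', true, g, _, 1, le_rfl, .push _ _ _ _, rfl, g :: r, ?_, ?_⟩
      · rw [← hr]; simp
      · rw [Conf.update_left]
        exact Conf.update_right _ _)
    b c ⟨rfl, s.right, rfl, rfl⟩
  obtain ⟨r, hr', rfl⟩ := hS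
  refine ⟨false, c', t, ht, ?_⟩
  have : r = s.left.reverse ++ s.right := by simpa using hr'
  rw [← this]
  exact hr

/-- The configuration of the stacks between two statements of an array program. -/
def conf (Γ : Type) (N : ℕ) (e : Var → ℕ) (mem : List Cell) : Conf Var Γ Cell where
  inp := []
  out := []
  cnt
    | .pos x => e x
    | .neg x => N - e x
    | .ra => N
    | .rb => 0
    | .tmp => 0
  left := []
  right := mem

/-- A loop variable is held as two counters with sum `N`; a pass of the loop moves one unit from
`pos x` to `neg x`. Thus the bound `N` is recovered when the loop ends. -/
theorem conf_cnt_dec {N n : ℕ} {e : Var → ℕ} {mem : List Cell} (x : Var) (hn : n + 1 ≤ N) :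
    update (update (conf Γ N (update e x (n + 1)) mem).cnt (.pos x) n) (.neg x)
      (update (conf Γ N (update e x (n + 1)) mem).cnt (.pos x) n (.neg x) + 1) =
      (conf Γ N (update e x n) mem).cnt := by
  funext w
  cases w with
  | pos y => by_cases hy : y = x <;> simp [hy, update, conf]
  | neg y =>
    by_cases hy : y = x
    · subst hy; simp [conf]; omega
    · simp [hy, update, conf]
  | _ => simp [conf]

theorem conf_cnt_fill {N : ℕ} {e : Var → ℕ} {mem : List Cell} (x : Var) (hx : e x = 0) :
    update (update (conf Γ N e mem).cnt (.neg x) 0) (.pos x)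
      ((conf Γ N e mem).cnt (.pos x) + (conf Γ N e mem).cnt (.neg x)) =
      (conf Γ N (update e x N) mem).cnt := by
  funext w
  cases w with
  | pos y => by_cases hy : y = x <;> simp [hy, update, conf, hx]
  | neg y => by_cases hy : y = x <;> simp [hy, update, conf]
  | _ => simp [conf]

/-- Read and modify the cell under the head. -/
def modify (g : σ → Cell → σ × Cell) : SCmd Var σ Cell Γ :=
  .seq (.pop .right fun m o => ((g m.1 (o.getD m.2.2)).1, m.2.1, (g m.1 (o.getD m.2.2)).2))
    (.push .right fun m => m.2.2)

theorem steps_modify (g : σ → Cell → σ × Cell) (v : σ) (s : Conf Var Γ Cell) (a : Cell)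
    (l : List Cell) (h : s.right = a :: l) :
    Steps (modify g) 2 v s (g v a).1 {s with right := (g v a).2 :: l} := by
  intro b c
  refine ⟨b, (g v a).2, 1 + 1, le_rfl, .seq (.pop _ _ _ _) ?_⟩
  have h1 : s.stk .right = a :: l := h
  rw [h1]
  have := Cmd.Run.push (Γ := Alph Var Γ Cell) .right (fun m : Mem σ Cell => m.2.2)
    ((g v a).1, b, (g v a).2) ({s with right := l} : Conf _ _ _).stk
  rw [Conf.update_right] at this
  rw [List.tail_cons, s.update_right]
  exact this

theorem steps_hop_drop (v : σ) (s : Conf Var Γ Cell) (mem : List Cell) (p : ℕ)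
    (hl : s.left = (mem.take p).reverse) (hr : s.right = mem.drop p) (hp : p < mem.length) :
    Steps hop 2 v s v {s with left := (mem.take (p + 1)).reverse, right := mem.drop (p + 1)} := by
  have := steps_hop (σ := σ) v s mem[p] (mem.drop (p + 1)) (by rw [hr, List.drop_eq_getElem_cons hp])
  rw [List.take_succ_eq_append_getElem hp, List.reverse_append, ← hl]
  exact this

/-- Empty the counter `u` into the counter `u'`, running `P` for each unit. -/
def pour (u u' : Cnt Var) (P : SCmd Var σ Cell Γ) : SCmd Var σ Cell Γ :=
  drainCnt u (.seq (inc u') P)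

/-- Pouring a counter while each unit moves the memory head by `d` cells. -/
theorem steps_pour {u u' : Cnt Var} (huu : u ≠ u') {P : SCmd Var σ Cell Γ} {T d : ℕ} (v : σ)
    (s : Conf Var Γ Cell) (mem : List Cell)
    (hP : ∀ (n p : ℕ), p + d ≤ mem.length → n ≤ s.cnt u →
      let s' (p : ℕ) : Conf Var Γ Cell := {s with
        cnt := update (update s.cnt u n) u' (s.cnt u' + (s.cnt u - n))
        left := (mem.take p).reverse
        right := mem.drop p}
      Steps P T v (s' p) v (s' (p + d)))
    (p : ℕ) (hp : p + s.cnt u * d ≤ mem.length)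
    (hl : s.left = (mem.take p).reverse) (hr : s.right = mem.drop p) :
    Steps (pour u u' P) (s.cnt u * (T + 3) + 2) v s v {s with
      cnt := update (update s.cnt u 0) u' (s.cnt u' + s.cnt u)
      left := (mem.take (p + s.cnt u * d)).reverse
      right := mem.drop (p + s.cnt u * d)} := by
  obtain ⟨v', s', h, rfl, -, rfl⟩ := steps_drainCnt (T := 1 + T) (u := u) (P := .seq (inc u') P)
    (I := fun n v' s' => v' = v ∧ n ≤ s.cnt u ∧ s' = {s with
      cnt := update (update s.cnt u n) u' (s.cnt u' + (s.cnt u - n))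
      left := (mem.take (p + (s.cnt u - n) * d)).reverse
      right := mem.drop (p + (s.cnt u - n) * d)})
    (by rintro n v s ⟨-, -, rfl⟩; simp [huu])
    (by
      rintro n v' s' ⟨rfl, hn, rfl⟩
      refine ⟨v', _, (steps_inc _ _ _).seq ?_, rfl, by omega, rfl⟩
      have hd : (s.cnt u - n) * d = (s.cnt u - (n + 1)) * d + d := by
        rw [← Nat.succ_mul]; congr 1; omega
      have hle : (s.cnt u - n) * d ≤ s.cnt u * d := Nat.mul_le_mul_right _ (by omega)
      have := hP n (p + (s.cnt u - (n + 1)) * d) (by omega) (by omega)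
      rw [hd, ← add_assoc]
      convert this using 2
      funext w
      by_cases h1 : w = u'
      · subst h1
        simp [huu.symm]
        omega
      · by_cases h2 : w = u
        · subst h2; simp [h1]
        · simp [h1, h2])
    (n := s.cnt u) (v := v) (s := s)
    ⟨rfl, le_rfl, by
      ext1 <;> simp [hl, hr]
      ⟩
  have hT : s.cnt u * (1 + T + 2) + 2 ≤ s.cnt u * (T + 3) + 2 := by
    rw [show 1 + T + 2 = T + 3 by ring]
  simpa [pour] using h.mono hT

/-- The stack program that does nothing. -/
def skip : SCmd Var σ Cell Γ := .load fun m => (m.1, m.2)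

theorem steps_skip (v : σ) (s : Conf Var Γ Cell) : Steps skip 1 v s v s := Steps.load (fun v => v)

theorem steps_pour_skip {u u' : Cnt Var} (huu : u ≠ u') (v : σ) (s : Conf Var Γ Cell) :
    Steps (pour u u' skip) (s.cnt u * 4 + 2) v s v {s with
      cnt := update (update s.cnt u 0) u' (s.cnt u' + s.cnt u)} := by
  have := steps_pour (d := 0) (T := 1) huu v s (s.left.reverse ++ s.right) (fun n q hq _ =>
    steps_skip v _) s.left.length (by simp) (by simp) (by simp)
  simpa using this

/-- Run `P` as often as the counter `u` says, with the help of the empty counter `u'`. -/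
def traverse (u u' : Cnt Var) (P : SCmd Var σ Cell Γ) : SCmd Var σ Cell Γ :=
  .seq (pour u u' P) (pour u' u skip)

/-- Reading a unary counter destroys it, so its units are collected in `u'` and poured back. Per
unit this costs `T + 3` for the first pour and `4` for the second. -/
theorem steps_traverse {u u' : Cnt Var} (huu : u ≠ u') {P : SCmd Var σ Cell Γ} {T d : ℕ} (v : σ)
    (s : Conf Var Γ Cell) (hu' : s.cnt u' = 0) (mem : List Cell)
    (hP : ∀ (n m p : ℕ), p + d ≤ mem.length →
      let s' (p : ℕ) : Conf Var Γ Cell := {s with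
        cnt := update (update s.cnt u n) u' m
        left := (mem.take p).reverse
        right := mem.drop p}
      Steps P T v (s' p) v (s' (p + d)))
    (p : ℕ) (hp : p + s.cnt u * d ≤ mem.length)
    (hl : s.left = (mem.take p).reverse) (hr : s.right = mem.drop p) :
    Steps (traverse u u' P) (s.cnt u * (T + 7) + 4) v s v {s with
      left := (mem.take (p + s.cnt u * d)).reverse
      right := mem.drop (p + s.cnt u * d)} := by
  have h := (steps_pour huu v s mem (fun n q hq _ => hP n _ q hq) p hp hl hr).seq
    (steps_pour_skip huu.symm v _)
  have hc : update (update (update (update s.cnt u 0) u' (s.cnt u' + s.cnt u)) u' 0) u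
      (update (update s.cnt u 0) u' (s.cnt u' + s.cnt u) u +
        update (update s.cnt u 0) u' (s.cnt u' + s.cnt u) u') = s.cnt := by
    funext w
    by_cases h1 : w = u
    · subst h1; simp [huu, hu']
    · by_cases h2 : w = u'
      · subst h2; simp [hu', h1]
      · simp [h1, h2]
  dsimp only at h
  rw [hc] at h
  refine h.mono ?_
  simp only [update_self, hu']
  linarith

/-- Move the memory head by one row. -/
def hopRow : SCmd Var σ Cell Γ := traverse .ra .rb hop

theorem steps_hopRow (v : σ) (s : Conf Var Γ Cell) (hb : s.cnt .rb = 0)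
    (mem : List Cell) (p : ℕ) (hp : p + s.cnt .ra ≤ mem.length)
    (hl : s.left = (mem.take p).reverse) (hr : s.right = mem.drop p) :
    Steps hopRow (s.cnt .ra * 9 + 4) v s v {s with
      left := (mem.take (p + s.cnt .ra)).reverse
      right := mem.drop (p + s.cnt .ra)} := by
  have := steps_traverse (u := .ra) (u' := .rb) (T := 2) (d := 1) (by simp) v s hb mem
    (fun n m q hq => steps_hop_drop v _ mem q rfl rfl (by omega)) p (by omega) hl hr
  simpa [hopRow] using this

/-- Move the memory head from the first cell to the cell addressed by `x` and `y`. -/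
def seek (x y : Var) : SCmd Var σ Cell Γ :=
  .seq (traverse (.pos x) .tmp hopRow) (traverse (.pos y) .tmp hop)

/-- The array is stored row by row, so `e x` moves by a row of `N` cells and `e y` single moves lead
to address `e x * N + e y`. The row moves dominate with `9 * N * N` steps. -/
theorem steps_seek (x y : Var) (v : σ) (N : ℕ) (e : Var → ℕ) (mem : List Cell)
    (hmem : N * N ≤ mem.length) (hx : e x < N) (hy : e y < N) :
    Steps (seek x y) (9 * N * N + 20 * N + 8) v (conf Γ N e mem) v {conf Γ N e mem with
      left := (mem.take (e x * N + e y)).reverse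
      right := mem.drop (e x * N + e y)} := by
  have hxN : e x * N + N ≤ N * N := by
    rw [← Nat.succ_mul]
    exact Nat.mul_le_mul_right _ hx
  have h1 := steps_traverse (u := .pos x) (u' := .tmp) (T := N * 9 + 4) (d := N) (by simp) v
    (conf Γ N e mem) rfl mem
    (fun n m q hq => by
      have := steps_hopRow v {conf Γ N e mem with
        cnt := update (update (conf Γ N e mem).cnt (.pos x) n) .tmp m
        left := (mem.take q).reverse
        right := mem.drop q} (by simp [conf]) mem q (by simpa [conf] using hq) rfl rfl
      simpa [conf] using this)
    0 (by simp only [conf]; omega) rfl rfl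
  have h2 := steps_traverse (u := .pos y) (u' := .tmp) (T := 2) (d := 1) (by simp) v
    {conf Γ N e mem with
      left := (mem.take (0 + e x * N)).reverse
      right := mem.drop (0 + e x * N)} rfl mem
    (fun n m q hq => steps_hop_drop v _ mem q rfl rfl (by omega)) (e x * N)
    (by simp only [conf]; omega) (by simp) (by simp)
  have h := (h1.seq h2).mono (T₂ := 9 * N * N + 20 * N + 8) (by
    simp only [conf]
    nlinarith [Nat.mul_le_mul_right (N * 9 + 11) hx.le])
  simpa [conf, seek] using h

/-- The list `mem` contains the part of the array below `N`, row by row. -/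
def Stores (N : ℕ) (M : ℕ → ℕ → Cell) (mem : List Cell) : Prop :=
  N * N ≤ mem.length ∧ ∀ i < N, ∀ j < N, mem[i * N + j]? = some (M i j)

/-- Overwriting one list entry changes one array entry only, because `i * N + j` with `j < N`
determines `i` (divide by `N`) and then `j`. -/
theorem Stores.set {N : ℕ} {M : ℕ → ℕ → Cell} {mem : List Cell} (h : Stores N M mem) {x y : ℕ}
    (hx : x < N) (hy : y < N) (a : Cell) :
    Stores N (fun i j => if i = x ∧ j = y then a else M i j) (mem.set (x * N + y) a) := by
  refine ⟨by simpa using h.1, fun i hi j hj => ?_⟩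
  rw [List.getElem?_set]
  dsimp only
  by_cases hij : i = x ∧ j = y
  · obtain ⟨rfl, rfl⟩ := hij
    have := (List.getElem?_eq_some_iff.1 (h.2 i hi j hj)).1
    simp [this]
  · rw [if_neg hij, if_neg, h.2 i hi j hj]
    intro he
    apply hij
    have h1 : (x * N + y) / N = x := by
      rw [mul_comm, Nat.mul_add_div (by omega), Nat.div_eq_of_lt hy, add_zero]
    have h2 : (i * N + j) / N = i := by
      rw [mul_comm, Nat.mul_add_div (by omega), Nat.div_eq_of_lt hj, add_zero]
    have h3 : i = x := by rw [← h1, ← h2, he]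
    subst h3
    exact ⟨rfl, by omega⟩

/-- Translation of array programs to stack programs. -/
def Prog.compile : Prog Var σ Cell → SCmd Var σ Cell Γ
  | .load f => .load fun m => (f m.1, m.2)
  | .upd x y g => .seq (seek x y) (.seq (modify g) rewind)
  | .seq P Q => .seq P.compile Q.compile
  | .ite b P Q => .ite (fun m => b m.1) P.compile Q.compile
  | .loop x P => .seq (pour (.neg x) (.pos x) skip)
      (drainCnt (.pos x) (.seq (inc (.neg x)) P.compile))

theorem steps_upd (x y : Var) (g : σ → Cell → σ × Cell) (v : σ) {N : ℕ} {e : Var → ℕ}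
    {M : ℕ → ℕ → Cell} {mem : List Cell} (hmem : Stores N M mem) (hx : e x < N) (hy : e y < N) :
    Steps (Prog.upd x y g).compile (12 * N * N + 20 * N + 12) v (conf Γ N e mem)
      (g v (M (e x) (e y))).1
      (conf Γ N e (mem.set (e x * N + e y) (g v (M (e x) (e y))).2)) := by
  obtain ⟨hlt, hget⟩ := List.getElem?_eq_some_iff.1 (hmem.2 _ hx _ hy)
  have h1 := steps_seek (Γ := Γ) x y v N e mem hmem.1 hx hy
  have h2 := steps_modify g v {conf Γ N e mem with
      left := (mem.take (e x * N + e y)).reverse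
      right := mem.drop (e x * N + e y)} _ _ (List.drop_eq_getElem_cons hlt)
  rw [hget] at h2
  have h3 := steps_rewind (g v (M (e x) (e y))).1 {conf Γ N e mem with
      left := (mem.take (e x * N + e y)).reverse
      right := (g v (M (e x) (e y))).2 :: mem.drop (e x * N + e y + 1)}
  have hp : e x * N + e y ≤ N * N := by
    have : e x * N + N ≤ N * N := by
      rw [← Nat.succ_mul]
      exact Nat.mul_le_mul_right _ hx
    omega
  have h := (h1.seq (h2.seq h3)).mono (T₂ := 12 * N * N + 20 * N + 12) (by
    simp only [List.length_reverse, List.length_take]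
    have := min_le_left (e x * N + e y) mem.length
    nlinarith)
  simp only [List.reverse_reverse] at h
  rw [List.set_eq_take_append_cons_drop, if_pos hlt]
  exact h

/-- The polynomial is built along the program: sequences and branches add, a loop multiplies by `N`.
The set `A` holds the variables that may still be bound. They have the value `0`, so `neg x`
contains all `N` units when a loop over `x` starts. -/
theorem steps_compile [Finite Var] (P : Prog Var σ Cell) : ∃ p : Polynomial ℕ,
    ∀ (A : Finset Var) (N : ℕ) (e : Var → ℕ), P.WF A → (∀ x, e x < N) → (∀ x ∈ A, e x = 0) →
    ∀ (v : σ) (M : ℕ → ℕ → Cell) (mem : List Cell), Stores N M mem → ∃ mem',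
      mem'.length = mem.length ∧ Stores N (P.eval N e (v, M)).2 mem' ∧
      Steps P.compile (p.eval N) v (conf Γ N e mem) (P.eval N e (v, M)).1 (conf Γ N e mem') := by
  induction P with
  | load f =>
    refine ⟨1, fun A N e _ _ _ v M mem hmem => ⟨mem, rfl, hmem, ?_⟩⟩
    simpa [Prog.compile, Prog.eval] using Steps.load f
  | upd x y g =>
    refine ⟨12 * .X * .X + 20 * .X + 12, fun A N e _ he _ v M mem hmem =>
      ⟨_, List.length_set, hmem.set (he x) (he y) _, ?_⟩⟩
    simpa [Prog.eval] using steps_upd x y g v hmem (he x) (he y)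
  | seq P Q ihP ihQ =>
    obtain ⟨p, hp⟩ := ihP
    obtain ⟨q, hq⟩ := ihQ
    refine ⟨p + q, fun A N e hwf he h0 v M mem hmem => ?_⟩
    obtain ⟨mem₁, hl₁, hmem₁, h₁⟩ := hp A N e hwf.1 he h0 v M mem hmem
    obtain ⟨mem₂, hl₂, hmem₂, h₂⟩ := hq A N e hwf.2 he h0 _ _ mem₁ hmem₁
    exact ⟨mem₂, hl₂.trans hl₁, hmem₂, by simpa [Prog.eval, Prog.compile] using h₁.seq h₂⟩
  | ite b P Q ihP ihQ =>
    obtain ⟨p, hp⟩ := ihP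
    obtain ⟨q, hq⟩ := ihQ
    refine ⟨1 + (p + q), fun A N e hwf he h0 v M mem hmem => ?_⟩
    cases hb : b v with
    | true =>
      obtain ⟨mem₁, hl₁, hmem₁, h₁⟩ := hp A N e hwf.1 he h0 v M mem hmem
      refine ⟨mem₁, hl₁, by simpa [Prog.eval, hb] using hmem₁, ?_⟩
      have := (Steps.ite_true (Q := Q.compile) hb h₁).mono (T₂ := (1 + (p + q)).eval N)
        (by simp)
      simpa [Prog.eval, Prog.compile, hb] using this
    | false =>
      obtain ⟨mem₁, hl₁, hmem₁, h₁⟩ := hq A N e hwf.2 he h0 v M mem hmem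
      refine ⟨mem₁, hl₁, by simpa [Prog.eval, hb] using hmem₁, ?_⟩
      have := (Steps.ite_false (P := P.compile) hb h₁).mono (T₂ := (1 + (p + q)).eval N)
        (by simp)
      simpa [Prog.eval, Prog.compile, hb] using this
  | loop x P ih =>
    obtain ⟨p, hp⟩ := ih
    refine ⟨(.X * 4 + 2) + (.X * ((1 + p) + 2) + 2), fun A N e hwf he h0 v M mem hmem => ?_⟩
    have hx : e x = 0 := h0 x hwf.1
    have h1 := steps_pour_skip (u := .neg x) (u' := .pos x) (by simp) v (conf Γ N e mem)
    let F := fun i s => P.eval N (update e x i) s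
    -- The invariant says that the `n` remaining passes lead from the current state to the result of
    -- the whole loop; at `n = 0` the current state is that result.
    obtain ⟨v', s', h2, -, M', mem', rfl, hl, hS, hF⟩ := steps_drainCnt (T := 1 + p.eval N)
      (u := .pos x) (P := .seq (inc (.neg x)) P.compile)
      (I := fun n v' s' => n ≤ N ∧ ∃ M' mem', s' = conf Γ N (update e x n) mem' ∧
        mem'.length = mem.length ∧
        Stores N M' mem' ∧ descend n F (v', M') = descend N F (v, M))
      (by rintro n v s ⟨-, M', mem', rfl, -⟩; simp [conf])
      (by
        rintro n v' s' ⟨hn, M', mem', rfl, hl, hS, hF⟩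
        obtain ⟨mem'', hl', hmem'', h⟩ := hp (A.erase x) N (update e x n) hwf.2
          (fun y => by
            by_cases hy : y = x
            · subst hy; simpa using hn
            · simpa [hy] using he y)
          (fun y hy => by
            rw [Finset.mem_erase] at hy
            simpa [hy.1] using h0 y hy.2) v' M' mem' hS
        refine ⟨_, _, (steps_inc _ _ _).seq ?_, by omega, _, mem'', rfl, hl'.trans hl, hmem'', hF⟩
        convert h using 1
        exact Conf.ext rfl rfl (conf_cnt_dec x hn) rfl rfl)
      (n := N) (v := v) (s := conf Γ N (update e x N) mem)
      ⟨le_rfl, M, mem, rfl, rfl, hmem, rfl⟩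
    have hv : v' = (descend N F (v, M)).1 := by rw [← hF]; rfl
    have hM : M' = (descend N F (v, M)).2 := by rw [← hF]; rfl
    refine ⟨mem', hl, hM ▸ hS, ?_⟩
    -- The loop leaves its variable at `0`, its value before the loop, so the counters are again
    -- those of `e`.
    have he0 : update e x 0 = e := by rw [← hx, update_eq_self]
    rw [he0, hv] at h2
    have h3 : Steps (pour (.neg x) (.pos x) skip) (N * 4 + 2) v (conf Γ N e mem) v
        (conf Γ N (update e x N) mem) := by
      convert h1 using 1
      · simp [conf, hx]
      · exact Conf.ext rfl rfl (conf_cnt_fill x hx).symm rfl rfl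
    simpa [Prog.eval, Prog.compile] using h3.seq h2

end ArrayProg

/-! ### Reading the input, setting up the array and cleaning up. -/

namespace ArrayProg

open Turing Function StackProg

variable {Var σ Cell Γ : Type}

/-- The counters that hold the loop bound initially. -/
noncomputable def boundCnts (Var : Type) [Finite Var] : List (Cnt Var) :=
  letI := Fintype.ofFinite Var
  .ra :: .tmp :: (Finset.univ : Finset Var).toList.map .neg

theorem nodup_boundCnts [Finite Var] : (boundCnts Var).Nodup := by
  simp only [boundCnts, List.nodup_cons, List.mem_cons, List.mem_map]
  refine ⟨by simp, by simp, ?_⟩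
  exact (Finset.nodup_toList _).map fun a b h => by simpa using h

theorem mem_boundCnts [Finite Var] (w : Cnt Var) :
    w ∈ boundCnts Var ↔ w = .ra ∨ w = .tmp ∨ ∃ x, w = .neg x := by
  simp [boundCnts, eq_comm]

variable [DecidableEq Var]

/-- Push a unit on each of the given counters. -/
def incAll (us : List (Cnt Var)) : SCmd Var σ Cell Γ :=
  us.foldr (fun u P => .seq (inc u) P) skip

theorem steps_incAll {us : List (Cnt Var)} (hus : us.Nodup) (v : σ) (s : Conf Var Γ Cell) :
    Steps (incAll us) (us.length + 1) v s v
      {s with cnt := fun w => if w ∈ us then s.cnt w + 1 else s.cnt w} := by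
  induction us generalizing s with
  | nil => simpa [incAll] using steps_skip v s
  | cons u us ih =>
    rw [List.nodup_cons] at hus
    have h := (steps_inc u v s).seq (ih hus.2 _)
    refine Steps.mono (T₁ := 1 + (us.length + 1)) ?_ (by simp; omega)
    change Steps (.seq (inc u) (incAll us)) _ _ _ _ _
    convert h using 1
    refine Conf.ext rfl rfl ?_ rfl rfl
    funext w
    by_cases hw : w = u
    · subst hw; simp [hus.1]
    · simp [hw]

/-- Empty each of the given counters. -/
def clearAll (us : List (Cnt Var)) : SCmd Var σ Cell Γ :=
  us.foldr (fun u P => .seq (drainCnt u skip) P) skip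

theorem steps_clear (u : Cnt Var) (v : σ) (s : Conf Var Γ Cell) :
    Steps (drainCnt u skip) (s.cnt u * 3 + 2) v s v {s with cnt := update s.cnt u 0} := by
  obtain ⟨v', s', h, rfl, rfl⟩ := steps_drainCnt (T := 1) (u := u) (P := skip)
    (I := fun n v' s' => v' = v ∧ s' = {s with cnt := update s.cnt u n})
    (by rintro n v s ⟨-, rfl⟩; simp)
    (by
      rintro n v' s' ⟨rfl, rfl⟩
      exact ⟨_, _, steps_skip _ _, rfl, by simp⟩)
    (n := s.cnt u) (v := v) (s := s) ⟨rfl, by simp⟩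
  exact h

theorem steps_clearAll (us : List (Cnt Var)) (v : σ) (s : Conf Var Γ Cell) {N : ℕ}
    (hN : ∀ u, s.cnt u ≤ N) :
    Steps (clearAll us) (us.length * (N * 3 + 2) + 1) v s v
      {s with cnt := fun w => if w ∈ us then 0 else s.cnt w} := by
  induction us generalizing s with
  | nil => simpa [clearAll] using steps_skip v s
  | cons u us ih =>
    have h := (steps_clear u v s).seq (ih {s with cnt := update s.cnt u 0} fun w => by
      by_cases hw : w = u
      · subst hw; simp
      · simpa [hw] using hN w)
    refine Steps.mono (T₁ := s.cnt u * 3 + 2 + (us.length * (N * 3 + 2) + 1)) ?_ ?_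
    · change Steps (.seq (drainCnt u skip) (clearAll us)) _ _ _ _ _
      convert h using 1
      refine Conf.ext rfl rfl ?_ rfl rfl
      funext w
      by_cases hw : w = u
      · subst hw; simp
      · simp [hw]
    · have := hN u
      rw [List.length_cons, add_mul]
      omega

/-- Empty the memory stack. -/
def clearRight : SCmd Var σ Cell Γ := drain .right (fun _ c => c) skip

theorem steps_clearRight (v : σ) (s : Conf Var Γ Cell) :
    Steps clearRight (s.right.length * 3 + 2) v s v {s with right := []} := by
  intro b c
  obtain ⟨v', c', S', t, ht, hr, rfl, rfl⟩ := run_drain (T := 1) (v := v) (k := .right)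
    (f := fun _ c => c) (P := (skip : SCmd Var σ Cell Γ))
    (I := fun l v' S => v' = v ∧ S = ({s with right := l} : Conf Var Γ Cell).stk)
    (by rintro l v S ⟨-, rfl⟩; rfl)
    (by
      rintro g l v' S c ⟨rfl, rfl⟩
      refine ⟨v', true, c, _, 1, le_rfl, .load _ _ _, rfl, ?_⟩
      exact Conf.update_right _ _)
    b c ⟨rfl, rfl⟩
  exact ⟨false, c', t, ht, hr⟩

/-- Read the input onto the stack `left`, and set up the counters. -/
noncomputable def readInput [Finite Var] (cellOf : Γ → Cell) : SCmd Var σ Cell Γ :=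
  .seq (incAll (boundCnts Var)) (drain .inp (fun g _ => cellOf g)
    (.seq (.push .left fun m => m.2.2) (incAll (boundCnts Var))))

/-- The bound counters are incremented once before reading and once per letter, which makes `N` the
length plus one. In particular `N` is positive, even for the empty word. -/
theorem steps_readInput [Finite Var] (cellOf : Γ → Cell) (v : σ) (w : List Γ) :
    Steps (readInput (Var := Var) cellOf)
      ((boundCnts Var).length + 1 + (w.length * ((1 + ((boundCnts Var).length + 1)) + 2) + 2))
      v ⟨w, [], fun _ => 0, [], []⟩ v
      ⟨[], [], fun u => if u ∈ boundCnts Var then w.length + 1 else 0,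
        (w.map cellOf).reverse, []⟩ := by
  intro b c
  obtain ⟨b₁, c₁, t₁, ht₁, h₁⟩ := steps_incAll (σ := σ) (nodup_boundCnts (Var := Var)) v
    (⟨w, [], fun _ => 0, [], []⟩ : Conf Var Γ Cell) b c
  obtain ⟨v', c', S', t, ht, hr, rfl, r, hr', rfl⟩ := run_drain
    (T := 1 + ((boundCnts Var).length + 1)) (v := v) (k := .inp)
    (f := fun g _ => cellOf g) (P := (.seq (.push .left fun m => m.2.2)
      (incAll (boundCnts Var)) : SCmd Var σ Cell Γ))
    (I := fun l v' S => v' = v ∧ ∃ r : List Γ, r ++ l = w ∧ S = (⟨l, [],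
      fun u => if u ∈ boundCnts Var then r.length + 1 else 0,
      (r.map cellOf).reverse, []⟩ : Conf Var Γ Cell).stk)
    (by rintro l v S ⟨-, r, -, rfl⟩; rfl)
    (by
      rintro g l v' S c ⟨rfl, r, hr, rfl⟩
      obtain ⟨b₁, c₁, t₁, ht₁, h₁⟩ := steps_incAll (σ := σ) (nodup_boundCnts (Var := Var)) v'
        (⟨l, [], fun u => if u ∈ boundCnts Var then r.length + 1 else 0,
          cellOf g :: (r.map cellOf).reverse, []⟩ : Conf Var Γ Cell) true (cellOf g)
      refine ⟨v', b₁, c₁, _, 1 + t₁, by omega, .seq (.push _ _ _ _) ?_, rfl, r ++ [g], ?_, rfl⟩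
      · convert h₁ using 1
        · rw [Conf.update_inp]
          exact Conf.update_left _ _
        · congr 1
          refine Conf.ext rfl rfl ?_ (by simp) rfl
          funext u
          by_cases hu : u ∈ boundCnts Var <;> simp [hu]
      · simp [← hr])
    b₁ c₁ ⟨rfl, [], rfl, rfl⟩
  have hw : r = w := by simpa using hr'
  subst hw
  refine ⟨false, c', t₁ + t, by omega, .seq ?_ hr⟩
  convert h₁ using 3
  · simp
  · simp

/-- Fill the memory stack with default cells, and then put the input into the first row. -/
def initMem (d : Cell) : SCmd Var σ Cell Γ :=
  .seq (drainCnt .tmp (.seq (drainCnt .ra (.seq (inc .rb) (.push .right fun _ => d)))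
    (pour .rb .ra skip))) rewind

theorem steps_pushRight (d : Cell) (v : σ) (s : Conf Var Γ Cell) :
    Steps (.push .right fun _ => d) 1 v s v {s with right := d :: s.right} := fun b c => by
  refine ⟨b, c, 1, le_rfl, ?_⟩
  have := Cmd.Run.push (Γ := Alph Var Γ Cell) .right (fun _ : Mem σ Cell => d) (v, b, c) s.stk
  rwa [Conf.update_right] at this

theorem steps_pushRow (d : Cell) (v : σ) (s : Conf Var Γ Cell) (hb : s.cnt .rb = 0) :
    Steps (.seq (drainCnt .ra (.seq (inc .rb) (.push .right fun _ => d))) (pour .rb .ra skip))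
      (s.cnt .ra * 8 + 4) v s v {s with right := List.replicate (s.cnt .ra) d ++ s.right} := by
  obtain ⟨v', s', h, rfl, -, rfl⟩ := steps_drainCnt (T := 2) (u := .ra)
    (P := .seq (inc .rb) (.push .right fun _ => d))
    (I := fun n v' s' => v' = v ∧ n ≤ s.cnt .ra ∧ s' = {s with
      cnt := update (update s.cnt .ra n) .rb (s.cnt .ra - n)
      right := List.replicate (s.cnt .ra - n) d ++ s.right})
    (by rintro n v s ⟨-, -, rfl⟩; simp)
    (by
      rintro n v' s' ⟨rfl, hn, rfl⟩
      refine ⟨v', _, (steps_inc _ _ _).seq (steps_pushRight _ _ _), rfl, by omega, ?_⟩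
      refine Conf.ext rfl rfl ?_ rfl ?_
      · funext u
        by_cases h1 : u = .rb
        · subst h1; simp; omega
        · by_cases h2 : u = .ra
          · subst h2; simp
          · simp [h1, h2]
      · rw [show s.cnt .ra - n = s.cnt .ra - (n + 1) + 1 by omega, List.replicate_succ]
        rfl)
    (n := s.cnt .ra) (v := v) (s := s) ⟨rfl, le_rfl, Conf.ext rfl rfl (by simp [← hb]) rfl (by simp)⟩
  have h := h.seq (steps_pour_skip (u := .rb) (u' := .ra) (by simp) _ _)
  refine Steps.mono (T₁ := s.cnt .ra * 4 + 2 + (s.cnt .ra * 4 + 2)) ?_ (by omega)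
  convert h using 1
  · simp
  · refine Conf.ext rfl rfl ?_ rfl (by simp)
    funext u
    by_cases h1 : u = .rb
    · subst h1; simp [hb]
    · by_cases h2 : u = .ra
      · subst h2; simp
      · simp [h1, h2]

/-- Each unit of `tmp` contributes a row of default cells, and rewinding then puts the input on top
of them. With both counters equal to `N` this gives `N * N` default cells after the input. -/
theorem steps_initMem (d : Cell) (v : σ) (s : Conf Var Γ Cell) (hb : s.cnt .rb = 0)
    (hr : s.right = []) :
    Steps (initMem d)
      (s.cnt .tmp * ((s.cnt .ra * 8 + 4) + 2) + 2 + (s.left.length * 3 + 2)) v s v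
      {s with
        cnt := update s.cnt .tmp 0
        left := []
        right := s.left.reverse ++ List.replicate (s.cnt .tmp * s.cnt .ra) d} := by
  obtain ⟨v', s', h, rfl, -, rfl⟩ := steps_drainCnt (T := s.cnt .ra * 8 + 4) (u := .tmp)
    (P := .seq (drainCnt .ra (.seq (inc .rb) (.push .right fun _ => d))) (pour .rb .ra skip))
    (I := fun n v' s' => v' = v ∧ n ≤ s.cnt .tmp ∧ s' = {s with
      cnt := update s.cnt .tmp n
      right := List.replicate ((s.cnt .tmp - n) * s.cnt .ra) d})
    (by rintro n v s ⟨-, -, rfl⟩; simp)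
    (by
      rintro n v' s' ⟨rfl, hn, rfl⟩
      refine ⟨v', _, ?_, rfl, by omega, rfl⟩
      have h := steps_pushRow (Γ := Γ) d v' {s with
        cnt := update s.cnt .tmp n
        right := List.replicate ((s.cnt .tmp - (n + 1)) * s.cnt .ra) d} (by simpa using hb)
      have hn' : s.cnt .tmp - n = s.cnt .tmp - (n + 1) + 1 := by omega
      simpa [hn', add_mul, add_comm] using h)
    (n := s.cnt .tmp) (v := v) (s := s) ⟨rfl, le_rfl, by simp [← hr]⟩
  have h := h.seq (steps_rewind _ _)
  simpa [initMem] using h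

/-- The initial array: the first row holds the input. -/
def initArr (cellOf : Γ → Cell) (d : Cell) (w : List Γ) (i j : ℕ) : Cell :=
  if i = 0 then (w[j]?.map cellOf).getD d else d

/-- The list is longer than the array needs; since everything after the input is a default cell, the
offset is harmless. -/
theorem stores_initArr (cellOf : Γ → Cell) (d : Cell) (w : List Γ) :
    Stores (w.length + 1) (initArr cellOf d w)
      (w.map cellOf ++ List.replicate ((w.length + 1) * (w.length + 1)) d) := by
  refine ⟨by simp, fun i hi j hj => ?_⟩
  have hij : i * (w.length + 1) + j < (w.length + 1) * (w.length + 1) := by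
    have := Nat.mul_le_mul_right (w.length + 1) hi
    rw [Nat.succ_mul] at this
    omega
  by_cases h : i = 0
  · subst h
    simp only [zero_mul, zero_add, initArr, if_true]
    rcases Nat.lt_or_ge j w.length with h | h
    · rw [List.getElem?_append_left (by simpa using h)]
      simp [h]
    · rw [List.getElem?_append_right (by simpa using h), List.getElem?_replicate, if_pos]
      · simp [h]
      · simp only [zero_mul, zero_add] at hij
        simp only [List.length_map]
        omega
  · have h1 : w.length + 1 ≤ i * (w.length + 1) := Nat.le_mul_of_pos_left _ (by omega)
    rw [List.getElem?_append_right (by simp; omega), List.getElem?_replicate, if_pos]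
    · simp [initArr, h]
    · simp only [List.length_map]
      omega

/-- The stack program that reads the input, executes `P`, and outputs the result. -/
noncomputable def wholeCmd [Finite Var] (cellOf : Γ → Cell) (d : Cell) (v₀ : σ) (out : σ → Bool)
    (P : Prog Var σ Cell) : SCmd Var σ Cell Γ :=
  .seq (readInput cellOf) <| .seq (initMem d) <| .seq P.compile <|
    .seq (clearAll (boundCnts Var)) <| .seq clearRight <|
    .seq (.push .out fun m => out m.1) (.load fun _ => (v₀, false, d))

/-- The program must end with the initial memory and with all stacks but the output empty, as
`haltList` requires; this is why counters and memory are cleared. -/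
theorem steps_wholeCmd [Finite Var] (cellOf : Γ → Cell) (d : Cell) (v₀ : σ) (out : σ → Bool)
    (P : Prog Var σ Cell) {A : Finset Var} (hP : P.WF A) : ∃ p : Polynomial ℕ, ∀ w : List Γ,
    ∃ t ≤ p.eval w.length, Cmd.Run (wholeCmd cellOf d v₀ out P) (v₀, false, d)
      (⟨w, [], fun _ => 0, [], []⟩ : Conf Var Γ Cell).stk (v₀, false, d)
      (⟨[], [out (P.eval (w.length + 1) (fun _ => 0) (v₀, initArr cellOf d w)).1],
        fun _ => 0, [], []⟩ : Conf Var Γ Cell).stk t := by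
  obtain ⟨p, hp⟩ := steps_compile (Γ := Γ) P
  set k := (boundCnts Var).length with hk
  let N : Polynomial ℕ := .X + 1
  let q : Polynomial ℕ := (k + 1 + (.X * ((1 + (k + 1)) + 2) + 2)) +
    ((N * ((N * 8 + 4) + 2) + 2 + (.X * 3 + 2)) + (p.comp N +
      ((k * (N * 3 + 2) + 1) + (((.X + N * N) * 3 + 2) + 2))))
  refine ⟨q, fun w => ?_⟩
  have h1 := steps_readInput (σ := σ) (Var := Var) cellOf v₀ w
  have h2 := steps_initMem (σ := σ) d v₀ (⟨[], [],
    fun u => if u ∈ boundCnts Var then w.length + 1 else 0,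
        (w.map cellOf).reverse, []⟩ : Conf Var Γ Cell) (by simp [mem_boundCnts]) rfl
  -- After reading, `ra`, `tmp` and all `neg x` hold `N`; once `tmp` is used up, these are the
  -- counters of `conf` with all loop variables `0`.
  have hconf : (⟨[], [], update (fun u => if u ∈ boundCnts Var then w.length + 1 else 0) .tmp 0,
      [], w.map cellOf ++ List.replicate ((w.length + 1) * (w.length + 1)) d⟩ : Conf Var Γ Cell) =
      conf Γ (w.length + 1) (fun _ => 0)
        (w.map cellOf ++ List.replicate ((w.length + 1) * (w.length + 1)) d) := by
    refine Conf.ext rfl rfl ?_ rfl rfl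
    funext u
    cases u <;> simp [conf, mem_boundCnts]
  have e1 : (if (.ra : Cnt Var) ∈ boundCnts Var then w.length + 1 else 0) = w.length + 1 := by
    simp [mem_boundCnts]
  have e2 : (if (.tmp : Cnt Var) ∈ boundCnts Var then w.length + 1 else 0) = w.length + 1 := by
    simp [mem_boundCnts]
  simp only [e1, e2, List.reverse_reverse, hconf] at h2
  obtain ⟨mem, hl, -, h3⟩ := hp A (w.length + 1) (fun _ => 0) hP (by simp) (by simp) v₀ _ _
    (stores_initArr cellOf d w)
  set v := (P.eval (w.length + 1) (fun _ => 0) (v₀, initArr cellOf d w)).1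
  have h4 := steps_clearAll (boundCnts Var) v (conf Γ (w.length + 1) (fun _ => 0) mem)
    (N := w.length + 1) (by intro u; cases u <;> simp [conf])
  have e3 : (fun u => if u ∈ boundCnts Var then 0
      else (conf Γ (w.length + 1) (fun _ => 0) mem).cnt u) = fun _ => 0 := by
    funext u
    cases u <;> simp [conf, mem_boundCnts]
  rw [e3] at h4
  have h5 := steps_clearRight v (⟨[], [], fun _ => 0, [], mem⟩ : Conf Var Γ Cell)
  obtain ⟨b₁, c₁, t₁, ht₁, h1⟩ := h1 false d
  obtain ⟨b₂, c₂, t₂, ht₂, h2⟩ := h2 b₁ c₁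
  obtain ⟨b₃, c₃, t₃, ht₃, h3⟩ := h3 b₂ c₂
  obtain ⟨b₄, c₄, t₄, ht₄, h4⟩ := h4 b₃ c₃
  obtain ⟨b₅, c₅, t₅, ht₅, h5⟩ := h5 b₄ c₄
  refine ⟨t₁ + (t₂ + (t₃ + (t₄ + (t₅ + (1 + 1))))), ?_,
    .seq h1 (.seq h2 (.seq h3 (.seq h4 (.seq h5 (.seq ?_ (.load _ (v, b₅, c₅) _))))))⟩
  · simp only [List.length_reverse, List.length_map, List.length_append,
      List.length_replicate] at ht₁ ht₂ hl ht₅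
    rw [hl] at ht₅
    rw [← hk] at ht₁ ht₄
    simp only [q, N, Polynomial.eval_add, Polynomial.eval_mul, Polynomial.eval_X,
      Polynomial.eval_one, Polynomial.eval_comp, Polynomial.eval_natCast, Polynomial.eval_ofNat]
    simp only [Nat.cast_id]
    omega
  · have := Cmd.Run.push (Γ := Alph Var Γ Cell) .out (fun m : Mem σ Cell => out m.1) (v, b₅, c₅)
      (⟨[], [], fun _ => 0, [], []⟩ : Conf Var Γ Cell).stk
    rwa [Conf.update_out] at this

/-- A function that is computed by an array program from the word in the first row of the array can
be computed in polynomial time. -/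
theorem nonempty_polyTime {α : Type} [Finite Var] [Finite σ] [Finite Cell] [Finite Γ]
    (enc : α → List Γ) (F : α → Bool) (cellOf : Γ → Cell) (d : Cell) (v₀ : σ) (out : σ → Bool)
    (P : Prog Var σ Cell) {A : Finset Var} (hP : P.WF A)
    (h : ∀ a, out (P.eval ((enc a).length + 1) (fun _ => 0) (v₀, initArr cellOf d (enc a))).1 =
      F a) :
    Nonempty (TM2ComputableInPolyTime enc Computability.encodeBool F) := by
  obtain ⟨p, hp⟩ := steps_wholeCmd cellOf d v₀ out P hP
  have H (a : α) : ∃ t ≤ p.eval (enc a).length,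
      Cmd.Run (wholeCmd cellOf d v₀ out P) (v₀, false, d)
        (⟨enc a, [], fun _ => 0, [], []⟩ : Conf Var Γ Cell).stk (v₀, false, d)
        (⟨[], [F a], fun _ => 0, [], []⟩ : Conf Var Γ Cell).stk t := by
    rw [← h a]
    exact hp (enc a)
  choose t ht using H
  have := (wholeCmd (Γ := Γ) cellOf d v₀ out P).finite_lab
  let : Fintype (Stk Var) := .ofFinite _
  let : Fintype (Option (wholeCmd (Γ := Γ) cellOf d v₀ out P).Lab) := .ofFinite _
  let : Fintype (Mem σ Cell) := .ofFinite _
  let : Fintype Γ := .ofFinite _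
  let tm : FinTM2 :=
    { K := Stk Var
      k₀ := .inp
      k₁ := .out
      Γ := Alph Var Γ Cell
      Λ := Option (wholeCmd (Γ := Γ) cellOf d v₀ out P).Lab
      main := some (Cmd.entry _)
      σ := Mem σ Cell
      initialState := (v₀, false, d)
      Γk₀Fin := inferInstanceAs (Fintype Γ)
      m := Cmd.machine _ }
  have hinit (w : List Γ) : initList tm w = ⟨some (some (Cmd.entry _)), (v₀, false, d),
      (⟨w, [], fun _ => 0, [], []⟩ : Conf Var Γ Cell).stk⟩ := by
    refine congrArg (TM2.Cfg.mk _ _) (funext fun k => ?_)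
    cases k <;> rfl
  have hhalt (w : List Bool) : haltList tm w = ⟨none, (v₀, false, d),
      (⟨[], w, fun _ => 0, [], []⟩ : Conf Var Γ Cell).stk⟩ := by
    refine congrArg (TM2.Cfg.mk _ _) (funext fun k => ?_)
    cases k <;> rfl
  refine ⟨{
    tm := tm
    inputAlphabet := Equiv.refl Γ
    outputAlphabet := Equiv.refl Bool
    time := p + 1
    outputsFun := fun a => ?_ }⟩
  refine ⟨⟨t a + 1, ?_⟩, ?_⟩
  · have := (ht a).2.iterate_machine
    have e : List.map (Equiv.refl Γ).invFun (enc a) = enc a := List.map_id _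
    refine Eq.trans ?_ (this.trans (congrArg some (hhalt _).symm))
    exact congrArg _ (congrArg some ((congrArg (initList tm) e).trans (hinit _)))
  · simpa using (ht a).1

end ArrayProg

/-! ### Compact representations of relations closed under a Maltsev operation. -/

namespace Maltsev

variable {Y Z E : Type}

/-- Closure of a set under a ternary operation. -/
inductive Gen (op : Y → Y → Y → Y) (S : Set Y) : Y → Prop
  | base {y} : y ∈ S → Gen op S y
  | app {x y z} : Gen op S x → Gen op S y → Gen op S z → Gen op S (op x y z)

/-- Terms in a ternary operation. -/
inductive Term (E : Type) : Type
  | leaf (e : E)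
  | node (a b c : Term E)

namespace Term

/-- The value of a term. -/
def eval (op : Y → Y → Y → Y) (g : E → Y) : Term E → Y
  | leaf e => g e
  | node a b c => op (a.eval op g) (b.eval op g) (c.eval op g)

/-- All variables of the term belong to `D`. -/
def Over (D : Set E) : Term E → Prop
  | leaf e => e ∈ D
  | node a b c => a.Over D ∧ b.Over D ∧ c.Over D

/-- Terms commute with homomorphisms. Applied to the map from tuples to keys, this turns a term that
produces a key into a recipe for a tuple with that key. -/
theorem map_eval {op : Y → Y → Y → Y} {op' : Z → Z → Z → Z} {h : Y → Z} {D : Set E} {g : E → Y}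
    {g' : E → Z} (hop : ∀ x y z, h (op x y z) = op' (h x) (h y) (h z)) (hg : ∀ e ∈ D, h (g e) = g' e)
    {T : Term E} (hT : T.Over D) : h (T.eval op g) = T.eval op' g' := by
  induction T with
  | leaf e => exact hg e hT
  | node a b c iha ihb ihc =>
    simp only [eval, hop, iha hT.1, ihb hT.2.1, ihc hT.2.2]

theorem gen_eval {op : Y → Y → Y → Y} {D : Set E} {g : E → Y} {S : Set Y}
    (hg : ∀ e ∈ D, g e ∈ S) {T : Term E} (hT : T.Over D) : Gen op S (T.eval op g) := by
  induction T with
  | leaf e => exact .base (hg e hT)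
  | node a b c iha ihb ihc => exact .app (iha hT.1) (ihb hT.2.1) (ihc hT.2.2)

theorem exists_of_gen {op : Y → Y → Y → Y} {D : Set Y} {y : Y} (h : Gen op D y) :
    ∃ T : Term Y, T.Over D ∧ T.eval op id = y := by
  induction h with
  | base h => exact ⟨.leaf _, h, rfl⟩
  | app _ _ _ ih₁ ih₂ ih₃ =>
    obtain ⟨a, ha, rfl⟩ := ih₁
    obtain ⟨b, hb, rfl⟩ := ih₂
    obtain ⟨c, hc, rfl⟩ := ih₃
    exact ⟨.node a b c, ⟨ha, hb, hc⟩, rfl⟩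

end Term

theorem Gen.map {op : Y → Y → Y → Y} {op' : Z → Z → Z → Z} {h : Y → Z} {S : Set Y} {S' : Set Z}
    (hop : ∀ x y z, h (op x y z) = op' (h x) (h y) (h z)) (hS : ∀ y ∈ S, h y ∈ S') {y : Y}
    (hy : Gen op S y) : Gen op' S' (h y) := by
  induction hy with
  | base hy => exact .base (hS _ hy)
  | app _ _ _ ih₁ ih₂ ih₃ => rw [hop]; exact .app ih₁ ih₂ ih₃

theorem Gen.mem {op : Y → Y → Y → Y} {S R : Set Y} (hR : ∀ x ∈ R, ∀ y ∈ R, ∀ z ∈ R, op x y z ∈ R)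
    (hS : S ⊆ R) {y : Y} (hy : Gen op S y) : y ∈ R := by
  induction hy with
  | base hy => exact hS hy
  | app _ _ _ ih₁ ih₂ ih₃ => exact hR _ ih₁ _ ih₂ _ ih₃

theorem Gen.mono {op : Y → Y → Y → Y} {S S' : Set Y} (hS : S ⊆ S') {y : Y} (hy : Gen op S y) :
    Gen op S' y :=
  hy.map (op' := op) (h := id) (fun _ _ _ => rfl) hS

variable {Q : Type} (f : Q → Q → Q → Q) {N K : ℕ}

/-- Componentwise application of an operation to tuples. -/
def lift {ι : Type} (x y z : ι → Q) : ι → Q := fun k => f (x k) (y k) (z k)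

/-- A set of tuples that is closed under the operation. -/
def Closed (R : Set (Fin N → Q)) : Prop := ∀ x ∈ R, ∀ y ∈ R, ∀ z ∈ R, lift f x y z ∈ R

/-- `o` is a pair of elements of `R` which agree above `i`, with values `a` and `b` at `i`;
it is `none` only if there is no such pair. -/
def IsWit (R : Set (Fin N → Q)) (i : Fin N) (a b : Q) : Option ((Fin N → Q) × (Fin N → Q)) → Prop
  | some (u, u') => u ∈ R ∧ u' ∈ R ∧ (∀ k > i, u k = u' k) ∧ u i = a ∧ u' i = b
  | none => ¬∃ u ∈ R, ∃ u' ∈ R, (∀ k > i, u k = u' k) ∧ u i = a ∧ u' i = b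

/-- A table of pairs of tuples, as in a compact representation. -/
abbrev Table (Q : Type) (N : ℕ) : Type := Fin N → Q → Q → Option ((Fin N → Q) × (Fin N → Q))

/-- The table `W` is a compact representation of `R`. -/
def Rep (R : Set (Fin N → Q)) (W : Table Q N) : Prop := ∀ i a b, IsWit R i a b (W i a b)

theorem Rep.some_of {R : Set (Fin N → Q)} {W : Table Q N} (h : Rep R W) {i : Fin N}
    {s s' : Fin N → Q} (hs : s ∈ R) (hs' : s' ∈ R) (hss : ∀ k > i, s k = s' k) :
    ∃ u u', W i (s i) (s' i) = some (u, u') ∧ u ∈ R ∧ u' ∈ R ∧ (∀ k > i, u k = u' k) ∧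
      u i = s i ∧ u' i = s' i := by
  have := h i (s i) (s' i)
  cases hW : W i (s i) (s' i) with
  | none =>
    rw [hW] at this
    exact absurd ⟨s, hs, s', hs', hss, rfl, rfl⟩ this
  | some p =>
    rw [hW] at this
    exact ⟨p.1, p.2, rfl, this⟩

theorem Rep.of_some {R : Set (Fin N → Q)} {W : Table Q N} (h : Rep R W) {i : Fin N} {a b : Q}
    {u u' : Fin N → Q} (hW : W i a b = some (u, u')) :
    u ∈ R ∧ u' ∈ R ∧ (∀ k > i, u k = u' k) ∧ u i = a ∧ u' i = b := by
  have := h i a b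
  rwa [hW] at this

/-- The tuples that occur in row `l` of a table. -/
def rowTuples (V : Table Q N) (l : Fin N) : Set (Fin N → Q) :=
  {u | ∃ a b u', V l a b = some (u, u') ∨ V l a b = some (u', u)}

/-- The base tuple together with the tuples that occur in a table. -/
def tuples (t : Fin N → Q) (V : Table Q N) : Set (Fin N → Q) := {u | u = t ∨ ∃ l, u ∈ rowTuples V l}

/-- The elements of `R` that agree with `t` above `m`. -/
def fiber (R : Set (Fin N → Q)) (t : Fin N → Q) (m : ℕ) : Set (Fin N → Q) :=
  {s | s ∈ R ∧ ∀ k : Fin N, m < k → s k = t k}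

/-- The Maltsev identities give `f x x x = x`, so fixing the values of some coordinates is
compatible with `f`. -/
theorem Closed.fiber (hf : ∀ x y, f y x x = y ∧ f x x y = y) {R : Set (Fin N → Q)}
    (hR : Closed f R) (t : Fin N → Q) (m : ℕ) : Closed f (fiber R t m) :=
  fun x hx y hy z hz => ⟨hR x hx.1 y hy.1 z hz.1, fun k hk => by
    simp only [lift, hx.2 k hk, hy.2 k hk, hz.2 k hk, hf]⟩

/-- The data stored in row `j` when tuples `g a` with value `a` at `j` have been found. -/
def extendRow (g : Q → Option (Fin N → Q)) (W : Q → Q → Option ((Fin N → Q) × (Fin N → Q)))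
    (a b : Q) : Option ((Fin N → Q) × (Fin N → Q)) :=
  (g a).bind fun s => (W a b).map fun p => (s, lift f s p.1 p.2)

/-- The invariant of the computation of generators of a fiber: everything above `j` is done. -/
structure FiberInv (R : Set (Fin N → Q)) (t : Fin N → Q) (m j : ℕ) (V : Table Q N) : Prop where
  sound : ∀ u ∈ tuples t V, u ∈ fiber R t m
  complete : ∀ s ∈ fiber R t m, ∃ s', Gen (lift f) (tuples t V) s' ∧ ∀ k : Fin N, j ≤ k → s' k = s k

/-- If `s` is generated with `s j = a` and `(u, u')` is a stored witness for `(a, b)` at `j`, then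
`f(s, u, u')` agrees with `s` above `j`, where `u = u'`, and has the value `f a a b = b` at `j`.
These transported tuples are the new generators. They lie in the fiber because `j ≤ m`, and they
suffice to correct any generated tuple at `j` while keeping its entries above `j`. -/
theorem FiberInv.step (hf : ∀ x y, f y x x = y ∧ f x x y = y) {R : Set (Fin N → Q)}
    (hR : Closed f R) {W : Table Q N} (hW : Rep R W) {t : Fin N → Q} {m : ℕ} {j : Fin N}
    (hj : j ≤ m) {V : Table Q N} (hV : FiberInv f R t m (j + 1) V) (hVj : V j = fun _ _ => none)
    {g : Q → Option (Fin N → Q)}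
    (hg : ∀ a s, g a = some s → Gen (lift f) (tuples t V) s ∧ s j = a)
    (hg' : ∀ s, Gen (lift f) (tuples t V) s → g (s j) ≠ none) :
    FiberInv f R t m j (Function.update V j (extendRow f g (W j))) := by
  set V' := Function.update V j (extendRow f g (W j)) with hV'
  have hsub : tuples t V ⊆ tuples t V' := by
    rintro u (rfl | ⟨l, a, b, u', h⟩)
    · exact .inl rfl
    · refine .inr ⟨l, a, b, u', ?_⟩
      have hl : l ≠ j := by
        rintro rfl
        simp [hVj] at h
      simpa [hV', Function.update_of_ne hl] using h
  have hgen : ∀ s, Gen (lift f) (tuples t V) s → s ∈ fiber R t m := fun s hs =>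
    hs.mem (hR.fiber f hf t m) hV.sound
  have hnew : ∀ s u u' a b, g a = some s → W j a b = some (u, u') →
      lift f s u u' ∈ fiber R t m ∧ (∀ k > j, lift f s u u' k = s k) ∧ lift f s u u' j = b := by
    intro s u u' a b hs hu
    obtain ⟨h1, h2, h3, h4, h5⟩ := hW.of_some hu
    obtain ⟨h6, h7⟩ := hg a s hs
    have h8 : ∀ k > j, lift f s u u' k = s k := fun k hk => by
      simp only [lift, h3 k hk, hf]
    refine ⟨⟨hR _ (hgen s h6).1 _ h1 _ h2, fun k hk => ?_⟩, h8, ?_⟩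
    · rw [h8 k (Fin.lt_def.2 (by omega)), (hgen s h6).2 k hk]
    · simp only [lift, h4, h5, h7, hf]
  constructor
  · rintro u (rfl | ⟨l, a, b, u', h⟩)
    · exact hV.sound _ (.inl rfl)
    · by_cases hl : l = j
      · subst hl
        simp only [hV', Function.update_self, extendRow] at h
        cases hs : g a with
        | none => simp [hs] at h
        | some s =>
          cases hu : W l a b with
          | none => simp [hs, hu] at h
          | some p =>
            obtain ⟨p, p'⟩ := p
            have h1 := hnew s p p' a b hs hu
            simp only [hs, hu, Option.bind_some, Option.map_some, Option.some.injEq,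
              Prod.mk.injEq] at h
            rcases h with ⟨rfl, -⟩ | ⟨-, rfl⟩
            · exact hgen _ (hg a _ hs).1
            · exact h1.1
      · exact hV.sound u (.inr ⟨l, a, b, u', by simpa [hV', Function.update_of_ne hl] using h⟩)
  · intro s hs
    obtain ⟨s', hs', hss⟩ := hV.complete s hs
    obtain ⟨u, u', hu, h1, h2, h3, h4, h5⟩ := hW.some_of (i := j) (hgen s' hs').1 hs.1
      fun k hk => hss k hk
    obtain ⟨r, hr⟩ := Option.ne_none_iff_exists'.1 (hg' s' hs')
    obtain ⟨h6, h7⟩ := hg _ r hr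
    obtain ⟨-, h8, h9⟩ := hnew r u u' _ _ hr hu
    have hmem : Gen (lift f) (tuples t V') (lift f r u u') := by
      refine .base (.inr ⟨j, s' j, s j, r, .inr ?_⟩)
      simp [hV', extendRow, hr, hu]
    -- Here `r` is the chosen tuple with `r j = s' j`, and `q = f(r, u, u')` is a new generator.
    -- Above `j`, `q = r`, so `f(s', r, q) = s' = s`; at `j`, `s' = r`, so `f(s', r, q) = q = s`.
    refine ⟨lift f s' r (lift f r u u'), .app (hs'.mono hsub) (h6.mono hsub) hmem, fun k hk => ?_⟩
    rcases eq_or_lt_of_le hk with hk | hk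
    · obtain rfl : j = k := Fin.ext hk
      simp only [lift] at h9 ⊢
      rw [h9, h7, (hf _ _).2]
    · have := h8 k hk
      simp only [lift] at this ⊢
      rw [this, (hf _ _).1, hss k hk]

theorem FiberInv.gen_iff (hf : ∀ x y, f y x x = y ∧ f x x y = y) {R : Set (Fin N → Q)}
    (hR : Closed f R) {t : Fin N → Q} {m : ℕ} {V : Table Q N} (hV : FiberInv f R t m 0 V)
    (s : Fin N → Q) : Gen (lift f) (tuples t V) s ↔ s ∈ fiber R t m := by
  refine ⟨fun hs => hs.mem (hR.fiber f hf t m) hV.sound, fun hs => ?_⟩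
  obtain ⟨s', h, hs'⟩ := hV.complete s hs
  obtain rfl : s' = s := funext fun k => hs' k (Nat.zero_le _)
  exact h

/-- The values of a tuple at the marked positions; positions may be missing. -/
def proj (a₀ : Q) (scope : Fin K → Option (Fin N)) (s : Fin N → Q) : Fin K → Q :=
  fun κ => (scope κ).elim a₀ s

/-- At a missing position all three arguments are `a₀`, and `f a₀ a₀ a₀ = a₀`. -/
theorem proj_lift (hf : ∀ x y, f y x x = y ∧ f x x y = y) (a₀ : Q) (scope : Fin K → Option (Fin N))
    (x y z : Fin N → Q) :
    proj a₀ scope (lift f x y z) =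
      lift f (proj a₀ scope x) (proj a₀ scope y) (proj a₀ scope z) := by
  funext κ
  simp only [proj, lift]
  cases scope κ with
  | none => exact (hf _ _).1.symm
  | some p => rfl

/-- The part of the tuples that satisfies a constraint. -/
def restrict (a₀ : Q) (scope : Fin K → Option (Fin N)) (C : Set (Fin K → Q))
    (R : Set (Fin N → Q)) : Set (Fin N → Q) := {s | s ∈ R ∧ proj a₀ scope s ∈ C}

theorem Closed.restrict (hf : ∀ x y, f y x x = y ∧ f x x y = y) {a₀ : Q}
    {scope : Fin K → Option (Fin N)} {C : Set (Fin K → Q)} {R : Set (Fin N → Q)}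
    (hR : Closed f R) (hC : ∀ x ∈ C, ∀ y ∈ C, ∀ z ∈ C, lift f x y z ∈ C) :
    Closed f (restrict a₀ scope C R) := fun x hx y hy z hz =>
  ⟨hR x hx.1 y hy.1 z hz.1, by
    rw [proj_lift f hf]
    exact hC _ hx.2 _ hy.2 _ hz.2⟩

/-- Keys of the tables of tuples: the values at the marked positions and at one further one. -/
abbrev Key (Q : Type) (K : ℕ) : Type := (Fin K → Q) × Q

/-- The key of a tuple. -/
def key (a₀ : Q) (scope : Fin K → Option (Fin N)) (j : Fin N) (s : Fin N → Q) : Key Q K :=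
  (proj a₀ scope s, s j)

/-- Componentwise application of an operation to keys. -/
def liftKey (x y z : Key Q K) : Key Q K := (lift f x.1 y.1 z.1, f x.2 y.2 z.2)

theorem key_lift (hf : ∀ x y, f y x x = y ∧ f x x y = y) (a₀ : Q) (scope : Fin K → Option (Fin N))
    (j : Fin N) (x y z : Fin N → Q) :
    key a₀ scope j (lift f x y z) =
      liftKey f (key a₀ scope j x) (key a₀ scope j y) (key a₀ scope j z) := by
  simp only [key, liftKey, proj_lift f hf]
  rfl

open Classical in
/-- A term over `D` with value `e`, if there is one. -/
noncomputable def termFor (D : Set (Key Q K)) (e : Key Q K) : Term (Key Q K) :=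
  if h : Gen (liftKey f) D e then (Term.exists_of_gen h).choose else .leaf e

theorem termFor_spec {D : Set (Key Q K)} {e : Key Q K} (h : Gen (liftKey f) D e) :
    (termFor f D e).Over D ∧ (termFor f D e).eval (liftKey f) id = e := by
  rw [termFor, dif_pos h]
  exact (Term.exists_of_gen h).choose_spec

/-- A table that contains, for each key of an element of `T`, an element of `T` with that key. -/
structure IsTab (T : Set (Fin N → Q)) (κ : (Fin N → Q) → Key Q K) (D : Set (Key Q K))
    (G : Key Q K → Fin N → Q) : Prop where
  sound : ∀ e ∈ D, G e ∈ T ∧ κ (G e) = e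
  complete : ∀ s ∈ T, κ s ∈ D

/-- Closing a table under the operation. -/
theorem IsTab.close {S : Set (Fin N → Q)} {κ : (Fin N → Q) → Key Q K} {D : Set (Key Q K)}
    {G : Key Q K → Fin N → Q} (hκ : ∀ x y z, κ (lift f x y z) = liftKey f (κ x) (κ y) (κ z))
    (h : IsTab S κ D G) :
    IsTab {s | Gen (lift f) S s} κ {e | Gen (liftKey f) D e}
      (fun e k => (termFor f D e).eval f fun e' => G e' k) := by
  have heval : ∀ T : Term (Key Q K), (fun k => T.eval f fun e' => G e' k) = T.eval (lift f) G := by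
    intro T
    induction T with
    | leaf e => rfl
    | node a b c iha ihb ihc => simp only [Term.eval, ← iha, ← ihb, ← ihc]; rfl
  constructor
  · intro e he
    obtain ⟨h1, h2⟩ := termFor_spec f he
    simp only [heval]
    refine ⟨Term.gen_eval (fun e he => (h.sound e he).1) h1, ?_⟩
    rw [Term.map_eval hκ (fun e he => (h.sound e he).2) h1]
    exact h2
  · intro s hs
    exact Gen.map hκ h.complete hs

end Maltsev

/-! ### Layout of the tables in the array, and row operations. -/

namespace Maltsev

open ArrayProg

/-- The loop variables of the program; `z` is never bound and has the value `0`. -/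
inductive Var : Type
  | z | r | i | j | l | k
  deriving DecidableEq

instance : Finite Var :=
  Finite.of_injective (β := Fin 6)
    (fun | .z => 0 | .r => 1 | .i => 2 | .j => 3 | .l => 4 | .k => 5)
    (by intro a b; cases a <;> cases b <;> simp)

variable {Γ Q : Type} {N K : ℕ}

/-- The cells of the array: the fields `inp`, `row`, `sc`, `t`, `G` are used in row `0` and `mark`
on the diagonal. -/
structure Cell (Γ Q : Type) (K : ℕ) : Type where
  inp : Option Γ
  row : Bool
  sc : Fin K → Bool
  mark : Bool
  t : Q
  G : Key Q K → Q
  W : Q → Q → Option (Q × Q)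
  W' : Q → Q → Option (Q × Q)
  V : Q → Q → Option (Q × Q)

instance [Finite Γ] [Finite Q] : Finite (Cell Γ Q K) :=
  Finite.of_injective
    (fun c : Cell Γ Q K => (c.inp, c.row, c.sc, c.mark, c.t, c.G, c.W, c.W', c.V)) fun a b h => by
    cases a; cases b; simpa using h

/-- Names of the tuples that are inserted into a table together. -/
abbrev Sel (Q : Type) : Type := Option (Q × Q × Bool)

/-- The registers of the program. -/
structure Core (Γ Q : Type) (K : ℕ) : Type where
  cur : Option Γ
  found : Bool
  diag : Bool
  act : Bool
  ans : Bool
  C : Set (Fin K → Q)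
  D : Set (Key Q K)
  a : Q
  base : Option Q
  pick : Option (Key Q K)
  kv : Sel Q → Key Q K
  vd : Set (Sel Q)

instance [Finite Γ] [Finite Q] : Finite (Core Γ Q K) :=
  Finite.of_injective
    (fun c : Core Γ Q K => (c.cur, c.found, c.diag, c.act, c.ans, c.C, c.D, c.a, c.base, c.pick,
      c.kv, c.vd)) fun a b h => by
    cases a; cases b; simpa using h

/-- The finite memory of the program: the registers and two scratch cells. -/
abbrev Reg (Γ Q : Type) (K : ℕ) : Type := Core Γ Q K × Cell Γ Q K × Cell Γ Q K

/-- The programs used here. -/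
abbrev Pr (Γ Q : Type) (K : ℕ) : Type := Prog Var (Reg Γ Q K) (Cell Γ Q K)

/-- The contents of the array, in terms of tuples. -/
structure Data (Γ Q : Type) (N K : ℕ) : Type where
  inp : Fin N → Option Γ
  row : Fin N → Bool
  sc : Fin N → Fin K → Bool
  mark : Fin N → Bool
  t : Fin N → Q
  G : Key Q K → Fin N → Q
  W : Table Q N
  W' : Table Q N
  V : Table Q N

/-- The `k`-th entries of the tuples in a row of a table. -/
def Table.slice (W : Table Q N) (i k : Fin N) (a b : Q) : Option (Q × Q) :=
  (W i a b).map fun p => (p.1 k, p.2 k)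

/-- The array `M` contains the data `D`. -/
structure Rel (M : ℕ → ℕ → Cell Γ Q K) (D : Data Γ Q N K) : Prop where
  inp : ∀ k : Fin N, (M 0 k).inp = D.inp k
  row : ∀ k : Fin N, (M 0 k).row = D.row k
  sc : ∀ k : Fin N, (M 0 k).sc = D.sc k
  mark : ∀ k : Fin N, (M k k).mark = D.mark k
  t : ∀ k : Fin N, (M 0 k).t = D.t k
  G : ∀ k : Fin N, (M 0 k).G = fun e => D.G e k
  W : ∀ i k : Fin N, (M i k).W = D.W.slice i k
  W' : ∀ i k : Fin N, (M i k).W' = D.W'.slice i k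
  V : ∀ i k : Fin N, (M i k).V = D.V.slice i k

/-- `P` leads from the registers and data `s` to the registers and data `s'`. -/
def Trans (P : Pr Γ Q K) (e : Var → ℕ) (s s' : Core Γ Q K × Data Γ Q N K) : Prop :=
  ∀ c M, Rel M s.2 → ∃ c' M', P.eval N e ((s.1, c), M) = ((s'.1, c'), M') ∧ Rel M' s'.2

namespace Trans

variable {P P' : Pr Γ Q K} {e : Var → ℕ} {s s₁ s₂ : Core Γ Q K × Data Γ Q N K}

theorem seq (h : Trans P e s s₁) (h' : Trans P' e s₁ s₂) : Trans (.seq P P') e s s₂ :=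
  fun c M hM => by
    obtain ⟨c₁, M₁, h1, hM₁⟩ := h c M hM
    obtain ⟨c₂, M₂, h2, hM₂⟩ := h' c₁ M₁ hM₁
    exact ⟨c₂, M₂, by rw [Prog.eval, h1, h2], hM₂⟩

theorem iteTrue {b : Core Γ Q K → Bool} (hb : b s.1 = true) (h : Trans P e s s₁) :
    Trans (.ite (fun v => b v.1) P P') e s s₁ := fun c M hM => by
  obtain ⟨c₁, M₁, h1, hM₁⟩ := h c M hM
  exact ⟨c₁, M₁, by rw [Prog.eval, if_pos hb, h1], hM₁⟩

theorem iteFalse {b : Core Γ Q K → Bool} (hb : b s.1 = false) (h : Trans P' e s s₁) :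
    Trans (.ite (fun v => b v.1) P P') e s s₁ := fun c M hM => by
  obtain ⟨c₁, M₁, h1, hM₁⟩ := h c M hM
  exact ⟨c₁, M₁, by rw [Prog.eval, if_neg (by simpa using hb), h1], hM₁⟩

/-- The result `s'` is fixed before the scratch cells and the concrete array are given, so the
invariant can speak of registers and tuples alone. -/
theorem loop {x : Var} (I : ℕ → Core Γ Q K × Data Γ Q N K → Prop)
    (step : ∀ m (_ : m < N) s, I (m + 1) s → ∃ s', Trans P (Function.update e x m) s s' ∧ I m s')
    (h : I N s) : ∃ s', Trans (.loop x P) e s s' ∧ I 0 s' := by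
  suffices H : ∀ n ≤ N, ∀ s, I n s → ∃ s', (∀ c M, Rel M s.2 → ∃ c' M',
      descend n (fun i s => P.eval N (Function.update e x i) s) ((s.1, c), M) =
        ((s'.1, c'), M') ∧ Rel M' s'.2) ∧ I 0 s' from H N le_rfl s h
  intro n
  induction n with
  | zero => exact fun _ s h => ⟨s, fun c M hM => ⟨c, M, rfl, hM⟩, h⟩
  | succ n ih =>
    intro hn s h
    obtain ⟨s₁, h1, hI⟩ := step n hn s h
    obtain ⟨s₂, h2, hI'⟩ := ih (by omega) s₁ hI
    refine ⟨s₂, fun c M hM => ?_, hI'⟩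
    obtain ⟨c₁, M₁, h3, hM₁⟩ := h1 c M hM
    obtain ⟨c₂, M₂, h4, hM₂⟩ := h2 c₁ M₁ hM₁
    exact ⟨c₂, M₂, by rw [descend, h3, h4], hM₂⟩

end Trans

/-- Change the registers. -/
def set (F : Core Γ Q K → Core Γ Q K) : Pr Γ Q K := .load fun v => (F v.1, v.2)

theorem trans_set (F : Core Γ Q K → Core Γ Q K) {e : Var → ℕ} (v : Core Γ Q K)
    (D : Data Γ Q N K) : Trans (set F) e (v, D) (F v, D) := fun c M hM => ⟨c, M, rfl, hM⟩

/-- Read the cells in rows `0` and `x` of column `y` and change the registers accordingly. -/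
def readAt (x y : Var) (F : Core Γ Q K → Cell Γ Q K → Cell Γ Q K → Core Γ Q K) : Pr Γ Q K :=
  .seq (.upd .z y fun v c => ((v.1, c, v.2.2), c)) <|
  .seq (.upd x y fun v c => ((v.1, v.2.1, c), c)) <| .load fun v => (F v.1 v.2.1 v.2.2, v.2)

theorem eval_readAt (x y : Var) (F : Core Γ Q K → Cell Γ Q K → Cell Γ Q K → Core Γ Q K)
    {e : Var → ℕ} (hz : e .z = 0) (v : Core Γ Q K) (c M) :
    (readAt x y F).eval N e ((v, c), M) =
      ((F v (M 0 (e y)) (M (e x) (e y)), M 0 (e y), M (e x) (e y)), M) := by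
  have h1 : ∀ (M : ℕ → ℕ → Cell Γ Q K) (n : ℕ),
      (fun i j => if i = n ∧ j = e y then M n (e y) else M i j) = M := by
    intro M n
    funext i j
    split_ifs with h
    · rw [h.1, h.2]
    · rfl
  simp only [readAt, Prog.eval, hz, h1]

theorem trans_readAt (x y : Var) {F : Core Γ Q K → Cell Γ Q K → Cell Γ Q K → Core Γ Q K}
    {e : Var → ℕ} (hz : e .z = 0) {v v' : Core Γ Q K} {D : Data Γ Q N K}
    (h : ∀ M, Rel M D → F v (M 0 (e y)) (M (e x) (e y)) = v') :
    Trans (readAt x y F) e (v, D) (v', D) := fun c M hM =>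
  ⟨_, M, by rw [eval_readAt x y F hz, h M hM], hM⟩

/-- Modify all cells of row `y`, depending on the cells in rows `0` and `x` of the same column. -/
def mapRow (x y : Var) (F : Core Γ Q K → Cell Γ Q K → Cell Γ Q K → Cell Γ Q K → Cell Γ Q K) :
    Pr Γ Q K :=
  .loop .k <| .seq (readAt x .k fun v _ _ => v) (.upd y .k fun v c => (v, F v.1 v.2.1 v.2.2 c))

/-- Column `m` is read before its only change and is not touched by other passes. Hence `F` always
sees the original values, even if row `y` is row `0` or row `x`. -/
theorem trans_mapRow {x y : Var} (hx : x ≠ .k) (hy : y ≠ .k)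
    {F : Core Γ Q K → Cell Γ Q K → Cell Γ Q K → Cell Γ Q K → Cell Γ Q K}
    {e : Var → ℕ} (hz : e .z = 0) {v : Core Γ Q K} {D D' : Data Γ Q N K}
    (h : ∀ M, Rel M D → Rel (fun i j => if i = e y ∧ j < N then
      F v (M 0 j) (M (e x) j) (M i j) else M i j) D') :
    Trans (mapRow x y F) e (v, D) (v, D') := by
  intro c M hM
  have H := descend_induction (n := N) (s := ((v, c), M))
    (F := fun m s => Prog.eval N (.seq (readAt x .k fun v _ _ => v)
      (.upd y .k fun v c => (v, F v.1 v.2.1 v.2.2 c))) (Function.update e .k m) s)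
    (fun m s => s.1.1 = v ∧ s.2 = fun i j => if i = e y ∧ m ≤ j ∧ j < N then
      F v (M 0 j) (M (e x) j) (M i j) else M i j) ⟨rfl, by
        funext i j
        rw [if_neg]
        omega⟩ ?_
  · obtain ⟨h1, h2⟩ := H
    refine ⟨_, _, Prod.ext (Prod.ext h1 rfl) rfl, ?_⟩
    refine (congrArg (fun A => Rel A D') h2).mpr ?_
    simpa using h M hM
  · rintro m hm ⟨⟨v', c'⟩, M'⟩ ⟨h1, h2⟩
    simp only at h1 h2
    subst h1
    have e1 : ∀ i, M' i m = M i m := fun i => by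
      rw [h2]
      simp
    have e2 : Function.update e .k m y = e y := Function.update_of_ne hy _ _
    have e3 : Function.update e .k m x = e x := Function.update_of_ne hx _ _
    have e4 : Function.update e .k m .k = m := Function.update_self _ _ _
    rw [Prog.eval, eval_readAt _ _ _ (by simpa using hz)]
    simp only [Prog.eval, e1, e2, e3, e4, true_and]
    funext i j
    by_cases hij : i = e y ∧ j = m
    · obtain ⟨rfl, rfl⟩ := hij
      simp [hm]
    · rw [if_neg hij, h2]
      simp only
      congr 1
      apply propext
      omega

/-- Change the registers, depending on the cells in rows `0` and `x` of all columns. -/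
def foldRow (x : Var) (F : Core Γ Q K → Cell Γ Q K → Cell Γ Q K → Core Γ Q K) : Pr Γ Q K :=
  .loop .k (readAt x .k F)

theorem trans_foldRow {x : Var} (hx : x ≠ .k)
    {F : Core Γ Q K → Cell Γ Q K → Cell Γ Q K → Core Γ Q K}
    {e : Var → ℕ} (hz : e .z = 0) {v : Core Γ Q K} {D : Data Γ Q N K} (I : ℕ → Core Γ Q K)
    (h0 : I N = v) (step : ∀ (m : Fin N) M, Rel M D → F (I (m + 1)) (M 0 m) (M (e x) m) = I m) :
    Trans (foldRow x F) e (v, D) (I 0, D) := by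
  obtain ⟨s', h, rfl⟩ := Trans.loop (P := readAt x .k F) (x := .k) (e := e) (s := (v, D))
    (fun m s => s = (I m, D)) (by
      rintro m hm s rfl
      refine ⟨_, trans_readAt x .k (by simpa using hz) fun M hM => ?_, rfl⟩
      simpa [Function.update_of_ne hx] using step ⟨m, hm⟩ M hM) (by rw [h0])
  exact h

end Maltsev

/-! ### Inserting the tuples of one row into a table indexed by keys. -/

namespace Maltsev

open ArrayProg

variable {Γ Q : Type} {N K : ℕ}

/-- The entries of the tuples named by `Sel`, in the column of the given cells. -/
def vals (c₁ c₂ : Cell Γ Q K) : Sel Q → Option Q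
  | none => some c₁.t
  | some (a, b, false) => (c₂.V a b).map Prod.fst
  | some (a, b, true) => (c₂.V a b).map Prod.snd

/-- The tuples named by `Sel`, for row `l` of the table `V`. -/
def Data.sel (D : Data Γ Q N K) (l : Fin N) : Sel Q → Option (Fin N → Q)
  | none => some D.t
  | some (a, b, false) => (D.V l a b).map Prod.fst
  | some (a, b, true) => (D.V l a b).map Prod.snd

theorem Rel.vals_eq {M : ℕ → ℕ → Cell Γ Q K} {D : Data Γ Q N K} (h : Rel M D) (l k : Fin N)
    (s : Sel Q) : vals (M 0 k) (M l k) s = (D.sel l s).map fun u => u k := by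
  rcases s with _ | ⟨a, b, _ | _⟩ <;> simp [vals, Data.sel, h.t, h.V, Table.slice] <;> rfl

/-- The base tuple is selected by `none` in every row, so at least one row is needed. -/
theorem mem_tuples_iff (D : Data Γ Q N K) [NeZero N] (u : Fin N → Q) :
    u ∈ tuples D.t D.V ↔ ∃ l s, D.sel l s = some u := by
  constructor
  · rintro (rfl | ⟨l, a, b, u', h | h⟩)
    · exact ⟨0, none, rfl⟩
    · exact ⟨l, some (a, b, false), by simp [Data.sel, h]⟩
    · exact ⟨l, some (a, b, true), by simp [Data.sel, h]⟩
  · rintro ⟨l, _ | ⟨a, b, _ | _⟩, h⟩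
    · exact .inl (by simpa [Data.sel, eq_comm] using h)
    · simp only [Data.sel, Option.map_eq_some_iff] at h
      obtain ⟨⟨p, p'⟩, h, rfl⟩ := h
      exact .inr ⟨l, a, b, p', .inl h⟩
    · simp only [Data.sel, Option.map_eq_some_iff] at h
      obtain ⟨⟨p, p'⟩, h, rfl⟩ := h
      exact .inr ⟨l, a, b, p, .inr h⟩

/-- Only the values in row `0` matter, since `G` is stored there; all other fields are unaffected.
-/
theorem Rel.mapG {M : ℕ → ℕ → Cell Γ Q K} {D : Data Γ Q N K} (hM : Rel M D)
    (F : ℕ → ℕ → Key Q K → Q) (G : Key Q K → Fin N → Q) (h : ∀ k : Fin N, F 0 k = fun y => G y k) :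
    Rel (fun i j => if i = 0 ∧ j < N then {M i j with G := F i j} else M i j) {D with G := G} := by
  constructor
  case G => exact fun k => by simpa using h k
  all_goals
    intros
    simp only [apply_ite Cell.inp, apply_ite Cell.row, apply_ite Cell.sc, apply_ite Cell.mark,
      apply_ite Cell.t, apply_ite Cell.W, apply_ite Cell.W', apply_ite Cell.V, ite_self]
    first
      | exact hM.inp _
      | exact hM.row _
      | exact hM.sc _
      | exact hM.mark _
      | exact hM.t _
      | exact hM.G _
      | exact hM.W _ _
      | exact hM.W' _ _
      | exact hM.V _ _

theorem Rel.mapT {M : ℕ → ℕ → Cell Γ Q K} {D : Data Γ Q N K} (hM : Rel M D)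
    (F : ℕ → ℕ → Q) (t : Fin N → Q) (h : ∀ k : Fin N, F 0 k = t k) :
    Rel (fun i j => if i = 0 ∧ j < N then {M i j with t := F i j} else M i j) {D with t := t} := by
  constructor
  case t => exact fun k => by simpa using h k
  all_goals
    intros
    simp only [apply_ite Cell.inp, apply_ite Cell.row, apply_ite Cell.sc, apply_ite Cell.mark,
      apply_ite Cell.G, apply_ite Cell.W, apply_ite Cell.W', apply_ite Cell.V, ite_self]
    first
      | exact hM.inp _
      | exact hM.row _
      | exact hM.sc _
      | exact hM.mark _
      | exact hM.t _
      | exact hM.G _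
      | exact hM.W _ _
      | exact hM.W' _ _
      | exact hM.V _ _

theorem Rel.mapW {M : ℕ → ℕ → Cell Γ Q K} {D : Data Γ Q N K} (hM : Rel M D) (i₀ : Fin N)
    (F : ℕ → ℕ → Q → Q → Option (Q × Q)) (r : Q → Q → Option ((Fin N → Q) × (Fin N → Q)))
    (h : ∀ k : Fin N, F i₀ k = fun a b => (r a b).map fun p => (p.1 k, p.2 k)) :
    Rel (fun i j => if i = i₀ ∧ j < N then {M i j with W := F i j} else M i j)
      {D with W := Function.update D.W i₀ r} := by
  constructor
  case W =>
    intro i k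
    by_cases hi : i = i₀
    · subst hi
      simp only [k.2, and_self, if_true, h]
      funext a b
      simp [Table.slice]
    · rw [if_neg (by simp [Fin.val_inj, hi]), hM.W]
      funext a b
      simp [Table.slice, Function.update_of_ne hi]
  all_goals
    intros
    simp only [apply_ite Cell.inp, apply_ite Cell.row, apply_ite Cell.sc, apply_ite Cell.mark,
      apply_ite Cell.t, apply_ite Cell.G, apply_ite Cell.W', apply_ite Cell.V, ite_self]
    first
      | exact hM.inp _
      | exact hM.row _
      | exact hM.sc _
      | exact hM.mark _
      | exact hM.t _
      | exact hM.G _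
      | exact hM.W _ _
      | exact hM.W' _ _
      | exact hM.V _ _

theorem Rel.mapW' {M : ℕ → ℕ → Cell Γ Q K} {D : Data Γ Q N K} (hM : Rel M D) (i₀ : Fin N)
    (F : ℕ → ℕ → Q → Q → Option (Q × Q)) (r : Q → Q → Option ((Fin N → Q) × (Fin N → Q)))
    (h : ∀ k : Fin N, F i₀ k = fun a b => (r a b).map fun p => (p.1 k, p.2 k)) :
    Rel (fun i j => if i = i₀ ∧ j < N then {M i j with W' := F i j} else M i j)
      {D with W' := Function.update D.W' i₀ r} := by
  constructor
  case W' =>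
    intro i k
    by_cases hi : i = i₀
    · subst hi
      simp only [k.2, and_self, if_true, h]
      funext a b
      simp [Table.slice]
    · rw [if_neg (by simp [Fin.val_inj, hi]), hM.W']
      funext a b
      simp [Table.slice, Function.update_of_ne hi]
  all_goals
    intros
    simp only [apply_ite Cell.inp, apply_ite Cell.row, apply_ite Cell.sc, apply_ite Cell.mark,
      apply_ite Cell.t, apply_ite Cell.G, apply_ite Cell.W, apply_ite Cell.V, ite_self]
    first
      | exact hM.inp _
      | exact hM.row _
      | exact hM.sc _
      | exact hM.mark _
      | exact hM.t _
      | exact hM.G _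
      | exact hM.W _ _
      | exact hM.W' _ _
      | exact hM.V _ _

theorem Rel.mapV {M : ℕ → ℕ → Cell Γ Q K} {D : Data Γ Q N K} (hM : Rel M D) (i₀ : Fin N)
    (F : ℕ → ℕ → Q → Q → Option (Q × Q)) (r : Q → Q → Option ((Fin N → Q) × (Fin N → Q)))
    (h : ∀ k : Fin N, F i₀ k = fun a b => (r a b).map fun p => (p.1 k, p.2 k)) :
    Rel (fun i j => if i = i₀ ∧ j < N then {M i j with V := F i j} else M i j)
      {D with V := Function.update D.V i₀ r} := by
  constructor
  case V =>
    intro i k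
    by_cases hi : i = i₀
    · subst hi
      simp only [k.2, and_self, if_true, h]
      funext a b
      simp [Table.slice]
    · rw [if_neg (by simp [Fin.val_inj, hi]), hM.V]
      funext a b
      simp [Table.slice, Function.update_of_ne hi]
  all_goals
    intros
    simp only [apply_ite Cell.inp, apply_ite Cell.row, apply_ite Cell.sc, apply_ite Cell.mark,
      apply_ite Cell.t, apply_ite Cell.G, apply_ite Cell.W, apply_ite Cell.W', ite_self]
    first
      | exact hM.inp _
      | exact hM.row _
      | exact hM.sc _
      | exact hM.mark _
      | exact hM.t _
      | exact hM.G _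
      | exact hM.W _ _
      | exact hM.W' _ _

variable (f : Q → Q → Q → Q) (a₀ : Q)

open Classical in
/-- Insert the tuples in row `l` of the table `V` into the table `G`, with the keys for the
coordinate `x`. -/
noncomputable def insertRow (x : Var) : Pr Γ Q K :=
  .seq (set fun v => {v with kv := fun _ => (fun _ => a₀, a₀)}) <|
  .seq (foldRow .l fun v c₁ c₂ => {v with
    kv := fun s => (fun κ => if c₁.sc κ then (vals c₁ c₂ s).getD a₀ else (v.kv s).1 κ,
      (v.kv s).2)}) <|
  .seq (readAt .l x fun v c₁ c₂ => {v with
    kv := fun s => ((v.kv s).1, (vals c₁ c₂ s).getD a₀)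
    vd := {s | (vals c₁ c₂ s).isSome}}) <|
  .seq (mapRow .l .z fun v c₁ c₂ c => {c with
    G := fun e => if h : ∃ s ∈ v.vd, v.kv s = e then (vals c₁ c₂ h.choose).getD a₀ else c.G e}) <|
  set fun v => {v with D := v.D ∪ {e | ∃ s ∈ v.vd, v.kv s = e}}

/-- The marks in `sc` describe the function `scope`. -/
def Scoped (sc : Fin N → Fin K → Bool) (scope : Fin K → Option (Fin N)) : Prop :=
  ∀ k κ, sc k κ = true ↔ scope κ = some k

/-- The keys of the tuples in row `l` of the table `V`. -/
def Data.rowKeys (D : Data Γ Q N K) (scope : Fin K → Option (Fin N)) (l j : Fin N) :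
    Set (Key Q K) :=
  {y | ∃ s u, D.sel l s = some u ∧ key a₀ scope j u = y}

/-- `G'` arises from `G` by inserting the tuples in row `l` of the table `V`. -/
def Inserted (D : Data Γ Q N K) (scope : Fin K → Option (Fin N)) (l j : Fin N)
    (G' : Key Q K → Fin N → Q) : Prop :=
  ∀ y, (∃ s u, D.sel l s = some u ∧ key a₀ scope j u = y ∧ G' y = u) ∨
    (y ∉ D.rowKeys a₀ scope l j ∧ G' y = D.G y)

/-- A key has constantly many entries, so the keys of all tuples selected in row `l` fit into the
registers. One pass over the columns collects the entries at marked positions, and a second pass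
copies the tuples column by column into the slots of their keys. -/
theorem trans_insertRow {x : Var} {e : Var → ℕ} (hz : e .z = 0) {j l : Fin N}
    (hj : e x = j) (hl : e .l = l) {v : Core Γ Q K} {D : Data Γ Q N K}
    {scope : Fin K → Option (Fin N)} (hsc : Scoped D.sc scope) :
    ∃ kv vd G, Trans (insertRow a₀ x) e (v, D)
      ({ v with kv := kv, vd := vd, D := v.D ∪ D.rowKeys a₀ scope l j }, { D with G := G }) ∧
      Inserted a₀ D scope l j G := by
  classical
  let kv : Sel Q → Key Q K := fun s =>
    (fun κ => (scope κ).elim a₀ fun p => ((D.sel l s).map fun u => u p).getD a₀,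
      ((D.sel l s).map fun u => u j).getD a₀)
  let vd : Set (Sel Q) := {s | (D.sel l s).isSome}
  let G : Key Q K → Fin N → Q := fun y k =>
    if h : ∃ s ∈ vd, kv s = y then ((D.sel l h.choose).map fun u => u k).getD a₀ else D.G y k
  have hkv : ∀ s u, D.sel l s = some u → kv s = key a₀ scope j u := by
    intro s u hu
    simp only [kv, hu, Option.map_some, Option.getD_some]
    rfl
  have hvd : ∀ y, (∃ s ∈ vd, kv s = y) ↔ y ∈ D.rowKeys a₀ scope l j := by
    intro y
    constructor
    · rintro ⟨s, hs, rfl⟩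
      obtain ⟨u, hu⟩ := Option.isSome_iff_exists.1 hs
      exact ⟨s, u, hu, (hkv s u hu).symm⟩
    · rintro ⟨s, u, hu, rfl⟩
      exact ⟨s, by simp [vd, hu], hkv s u hu⟩
  -- The keys when the columns from `m` on have been read; positions not yet reached hold `a₀`, and
  -- the second component is filled in later.
  let part : ℕ → Sel Q → Key Q K := fun m s => (fun κ => (scope κ).elim a₀
    fun p => if m ≤ p then ((D.sel l s).map fun u => u p).getD a₀ else a₀, a₀)
  have hN : part N = fun _ => (fun _ => a₀, a₀) := by
    funext s
    refine Prod.ext (funext fun κ => ?_) rfl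
    simp only [part]
    cases scope κ with
    | none => rfl
    | some p => exact if_neg (by simp)
  have hpart : ∀ m : Fin N, part m = fun s => (fun κ => if D.sc m κ then
      ((D.sel l s).map fun u => u m).getD a₀ else (part (m + 1) s).1 κ, (part (m + 1) s).2) := by
    intro m
    funext s
    refine Prod.ext (funext fun κ => ?_) rfl
    simp only [part]
    by_cases h : D.sc m κ = true
    · rw [if_pos h, (hsc m κ).1 h]
      simp
    · rw [if_neg h]
      cases hp : scope κ with
      | none => rfl
      | some p =>
        have hpm : (p : ℕ) ≠ m := fun hpm =>
          h ((hsc m κ).2 (hp.trans (congrArg some (Fin.ext hpm))))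
        have : (m : ℕ) + 1 ≤ p ↔ (m : ℕ) ≤ p := by omega
        simp only [Option.elim_some, this]
  refine ⟨kv, vd, G, ?_, fun y => ?_⟩
  · refine (trans_set _ _ _).seq ?_
    have h1 := trans_foldRow (N := N) (x := .l) (by decide) (e := e) hz (D := D)
      (F := fun v c₁ c₂ => { v with
        kv := fun s => (fun κ => if c₁.sc κ then (vals c₁ c₂ s).getD a₀ else (v.kv s).1 κ,
          (v.kv s).2) })
      (v := { v with kv := fun _ => (fun _ => a₀, a₀) })
      (fun m => { v with kv := part m }) (by rw [hN]) (by
        intro m M hM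
        simp only [hl, hM.vals_eq, hM.sc]
        rw [← hpart m])
    refine h1.seq ?_
    refine (trans_readAt (v' := {v with kv := kv, vd := vd}) .l x hz fun M hM => ?_).seq ?_
    · have h0 : ∀ s, (part 0 s).1 = (kv s).1 := by
        intro s
        funext κ
        simp only [part, kv]
        cases scope κ <;> simp
      simp only [hl, hj, hM.vals_eq, h0, Option.isSome_map]
      rfl
    refine (trans_mapRow (D' := {D with G := G}) (by decide) (by decide) hz fun M hM => ?_).seq ?_
    · rw [hz]
      refine hM.mapG (fun i j y => if h : ∃ s ∈ vd, kv s = y then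
        (vals (M 0 j) (M (e .l) j) h.choose).getD a₀ else (M i j).G y) G fun k => ?_
      simp only [hl, hM.vals_eq, hM.G, G]
    · have := trans_set (N := N) (e := e) (fun v : Core Γ Q K =>
        {v with D := v.D ∪ {y | ∃ s ∈ v.vd, v.kv s = y}}) {v with kv := kv, vd := vd} {D with G := G}
      rwa [show {y | ∃ s ∈ vd, kv s = y} = D.rowKeys a₀ scope l j from Set.ext hvd] at this
  · by_cases h : ∃ s ∈ vd, kv s = y
    · obtain ⟨hs, hy⟩ := h.choose_spec
      obtain ⟨u, hu⟩ := Option.isSome_iff_exists.1 hs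
      refine .inl ⟨_, u, hu, ?_, ?_⟩
      · rw [← hkv _ u hu, hy]
      · funext k
        simp only [G, dif_pos h, hu, Option.map_some, Option.getD_some]
    · refine .inr ⟨fun h' => h ((hvd y).2 h'), ?_⟩
      funext k
      simp only [G, dif_neg h]

end Maltsev

/-! ### Computing representatives by key and generators of a fiber. -/

namespace Maltsev

open ArrayProg

variable {Γ Q : Type} {N K : ℕ} (f : Q → Q → Q → Q) (a₀ : Q)

/-- Build a table of tuples of the generated algebra, with keys for the coordinate `x`. -/
noncomputable def tab (x : Var) : Pr Γ Q K :=
  .seq (set fun v => { v with D := ∅ }) <|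
  .seq (.loop .l (insertRow a₀ x)) <|
  .seq (mapRow .z .z fun v _ _ c => { c with G := fun y => (termFor f v.D y).eval f c.G }) <|
  set fun v => { v with D := {y | Gen (liftKey f) v.D y} }

/-- A new tuple may displace an old one with the same key; this is harmless because one
representative per key suffices. -/
theorem IsTab.insert {T S : Set (Fin N → Q)} {D : Data Γ Q N K} {scope : Fin K → Option (Fin N)}
    {l j : Fin N} {Y : Set (Key Q K)} (h : IsTab T (key a₀ scope j) Y D.G)
    {G' : Key Q K → Fin N → Q} (hG : Inserted a₀ D scope l j G')
    (hS : ∀ u, u ∈ S ↔ u ∈ T ∨ ∃ s, D.sel l s = some u) :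
    IsTab S (key a₀ scope j) (Y ∪ D.rowKeys a₀ scope l j) G' := by
  constructor
  · intro y hy
    rcases hG y with ⟨s, u, h1, h2, h3⟩ | ⟨h1, h2⟩
    · exact ⟨(hS _).2 (.inr ⟨s, h3 ▸ h1⟩), h3 ▸ h2⟩
    · have := h.sound y (hy.resolve_right h1)
      exact ⟨(hS _).2 (.inl (h2 ▸ this.1)), h2 ▸ this.2⟩
  · intro u hu
    rcases (hS u).1 hu with hu | ⟨s, hu⟩
    · exact .inl (h.complete u hu)
    · exact .inr ⟨s, u, hu, rfl⟩

variable {f a₀}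

/-- All generators are inserted, row by row, and then the table is closed under `f`. The terms
needed depend only on the set of keys present, a register, so one pass over the columns evaluates
them. -/
theorem trans_tab [NeZero N] (hf : ∀ x y, f y x x = y ∧ f x x y = y) {x : Var} {e : Var → ℕ}
    (hz : e .z = 0) {j : Fin N} (hj : e x = j) (hx : x ≠ .l) {v : Core Γ Q K} {D : Data Γ Q N K}
    {scope : Fin K → Option (Fin N)} (hsc : Scoped D.sc scope) :
    ∃ kv vd Y G, Trans (tab f a₀ x) e (v, D)
      ({ v with kv := kv, vd := vd, D := Y }, { D with G := G }) ∧
      IsTab {u | Gen (lift f) (tuples D.t D.V) u} (key a₀ scope j) Y G := by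
  obtain ⟨_, hloop, kv, vd, Y, G, rfl, hT⟩ := Trans.loop (P := insertRow a₀ x) (x := .l) (e := e)
    (s := ({ v with D := ∅ }, D)) (fun m s => ∃ kv vd Y G,
      s = ({ v with kv := kv, vd := vd, D := Y }, { D with G := G }) ∧
      IsTab {u | ∃ l : Fin N, m ≤ l ∧ ∃ s, D.sel l s = some u} (key a₀ scope j) Y G) (by
    rintro m hm _ ⟨kv, vd, Y, G, rfl, hT⟩
    obtain ⟨kv', vd', G', h1, h2⟩ := trans_insertRow a₀ (e := Function.update e .l m) (x := x)
      (by simpa using hz) (j := j) (l := ⟨m, hm⟩) (by simpa [Function.update_of_ne hx] using hj)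
      (by simp) (v := { v with kv := kv, vd := vd, D := Y }) (D := { D with G := G }) hsc
    refine ⟨_, h1, kv', vd', _, G', rfl, IsTab.insert a₀ (D := { D with G := G }) hT h2 fun u => ?_⟩
    constructor
    · rintro ⟨l, hl, s, h⟩
      rcases eq_or_lt_of_le hl with hl | hl
      · exact .inr ⟨s, by rwa [show (⟨m, hm⟩ : Fin N) = l from Fin.ext hl]⟩
      · exact .inl ⟨l, hl, s, h⟩
    · rintro (⟨l, hl, h⟩ | ⟨s, h⟩)
      · exact ⟨l, by omega, h⟩
      · exact ⟨⟨m, hm⟩, le_rfl, s, h⟩) ⟨v.kv, v.vd, ∅, D.G, rfl, by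
      constructor
      · simp
      · rintro u ⟨l, hl, -⟩
        exact absurd l.2 (by omega)⟩
  have hS : {u | ∃ l : Fin N, 0 ≤ (l : ℕ) ∧ ∃ s, D.sel l s = some u} = tuples D.t D.V := by
    ext u
    simp [mem_tuples_iff]
  rw [hS] at hT
  refine ⟨kv, vd, _, _, ((trans_set _ _ _).seq <| hloop.seq <|
    (trans_mapRow (v := { v with kv := kv, vd := vd, D := Y }) (D := { D with G := G })
      (D' := { D with G := fun y k => (termFor f Y y).eval f fun y' => G y' k })
      (by decide) (by decide) hz fun M hM => ?_).seq (trans_set _ _ _)),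
    hT.close f (key_lift f hf a₀ scope j)⟩
  rw [hz]
  exact hM.mapG (fun i j y => (termFor f Y y).eval f (M i j).G) _ fun k => by rw [hM.G]

open Classical in
/-- A key in `Y` with the given value and with the remaining entries in `C`. -/
noncomputable def pickFor (C : Set (Fin K → Q)) (Y : Set (Key Q K)) (a : Q) : Option (Key Q K) :=
  if h : ∃ y ∈ Y, y.1 ∈ C ∧ y.2 = a then some h.choose else none

theorem pickFor_some {C : Set (Fin K → Q)} {Y : Set (Key Q K)} {a : Q} {y : Key Q K}
    (h : pickFor C Y a = some y) : y ∈ Y ∧ y.1 ∈ C ∧ y.2 = a := by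
  unfold pickFor at h
  split_ifs at h with h'
  cases h
  exact h'.choose_spec

theorem pickFor_ne_none {C : Set (Fin K → Q)} {Y : Set (Key Q K)} {a : Q} {y : Key Q K}
    (h : y ∈ Y) (hC : y.1 ∈ C) (ha : y.2 = a) : pickFor C Y a ≠ none := by
  simp only [pickFor]
  rw [dif_pos ⟨y, h, hC, ha⟩]
  simp

variable (f a₀)

/-- Clear the table `V`. -/
def clear : Pr Γ Q K := .loop .l (mapRow .z .l fun _ _ _ c => { c with V := fun _ _ => none })

/-- Compute row `j` of the table `V` from the tuples in `G`. -/
noncomputable def extend : Pr Γ Q K :=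
  mapRow .z .j fun v c₁ _ c => { c with
    V := fun a b => (pickFor .univ v.D a).bind fun y =>
      (c.W a b).map fun p => (c₁.G y, f (c₁.G y) p.1 p.2) }

/-- Compute generators of the fiber of the base tuple. -/
noncomputable def gen : Pr Γ Q K :=
  .seq clear <| .loop .j <|
  .seq (readAt .j .j fun v _ c => { v with act := v.act || c.mark }) <|
  .ite (fun v => v.1.act) (.seq (tab f a₀ .j) (extend f)) (set id)

variable {f a₀}

theorem trans_clear {e : Var → ℕ} (hz : e .z = 0) {v : Core Γ Q K} {D : Data Γ Q N K} :
    Trans clear e (v, D) (v, { D with V := fun _ _ _ => none }) := by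
  obtain ⟨_, h, V, rfl, hV⟩ := Trans.loop (x := .l) (e := e) (s := (v, D))
    (P := mapRow .z .l fun _ _ _ c => { c with V := fun _ _ => none })
    (fun m s => ∃ V, s = (v, { D with V := V }) ∧ ∀ l : Fin N, m ≤ l → V l = fun _ _ => none) (by
      rintro m hm _ ⟨V, rfl, hV⟩
      refine ⟨_, trans_mapRow (v := v) (D' := { D with
        V := Function.update V ⟨m, hm⟩ fun _ _ => none }) (by decide) (by decide) (by simpa using hz)
        fun M hM => ?_, _, rfl, fun l hl => ?_⟩
      · rw [Function.update_self]
        exact hM.mapV ⟨m, hm⟩ (fun _ _ _ _ => none) _ fun k => rfl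
      · by_cases h : l = ⟨m, hm⟩
        · rw [h, Function.update_self]
        · rw [Function.update_of_ne h, hV l]
          have : (l : ℕ) ≠ m := fun h' => h (Fin.ext h')
          omega) ⟨D.V, rfl, fun l hl => absurd l.2 (by omega)⟩
  obtain rfl : V = fun _ _ _ => none := funext fun l => hV l (Nat.zero_le _)
  exact h

theorem trans_extend {e : Var → ℕ} (hz : e .z = 0) {j : Fin N} (hj : e .j = j) {v : Core Γ Q K}
    {D : Data Γ Q N K} :
    Trans (extend f) e (v, D) (v, { D with
      V := Function.update D.V j
        (extendRow f (fun a => (pickFor .univ v.D a).map D.G) (D.W j)) }) := by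
  refine trans_mapRow (by decide) (by decide) hz fun M hM => ?_
  rw [hj]
  refine hM.mapV j (fun i k a b => (pickFor .univ v.D a).bind fun y =>
      ((M i k).W a b).map fun p => ((M 0 k).G y, f ((M 0 k).G y) p.1 p.2)) _ fun k => ?_
  funext a b
  simp only [extendRow, hM.W, hM.G, Table.slice]
  cases pickFor .univ v.D a with
  | none => rfl
  | some y => cases D.W j a b <;> rfl

/-- At a coordinate above `m` every element of the fiber equals `t`, so nothing needs correction. -/
theorem FiberInv.skip (hf : ∀ x y, f y x x = y ∧ f x x y = y) {R : Set (Fin N → Q)}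
    (hR : Closed f R) {t : Fin N → Q} {m : ℕ} {j : Fin N} (hj : m < j) {V : Table Q N}
    (hV : FiberInv f R t m (j + 1) V) : FiberInv f R t m j V := by
  refine ⟨hV.sound, fun s hs => ?_⟩
  obtain ⟨s', h1, h2⟩ := hV.complete s hs
  refine ⟨s', h1, fun k hk => ?_⟩
  rcases eq_or_lt_of_le hk with hk | hk
  · obtain rfl : j = k := Fin.ext hk
    rw [hs.2 j hj]
    exact (h1.mem (hR.fiber f hf t m) hV.sound).2 j hj
  · exact h2 k hk

/-- Coordinates are processed downwards. The register `act` is switched on by a mark, or is on from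
the start, and `hm` says that it is on exactly at the coordinates `≤ m`; these are treated by
`FiberInv.step`, the others by `FiberInv.skip`. The invariant also keeps the unprocessed rows of `V`
empty, as `FiberInv.step` requires. -/
theorem trans_gen [NeZero N] (hf : ∀ x y, f y x x = y ∧ f x x y = y) {R : Set (Fin N → Q)}
    (hR : Closed f R) {e : Var → ℕ} (hz : e .z = 0) {v : Core Γ Q K} {D : Data Γ Q N K}
    {scope : Fin K → Option (Fin N)} (hsc : Scoped D.sc scope) (hW : Rep R D.W) (ht : D.t ∈ R)
    {m : ℕ} (hm : ∀ j : Fin N, (v.act = true ∨ ∃ j' ≥ j, D.mark j' = true) ↔ (j : ℕ) ≤ m) :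
    ∃ act kv vd Y G V, Trans (gen f a₀) e (v, D)
      ({ v with act := act, kv := kv, vd := vd, D := Y }, { D with G := G, V := V }) ∧
      FiberInv f R D.t m 0 V := by
  obtain ⟨_, h, act, kv, vd, Y, G, V, rfl, -, hV, -⟩ := Trans.loop (N := N)
    (x := .j) (e := e) (s := (v, { D with V := fun _ _ _ => none }))
    (P := .seq (readAt .j .j fun v _ c => { v with act := v.act || c.mark }) <|
      .ite (fun v => v.1.act) (.seq (tab f a₀ .j) (extend f)) (set id))
    (fun n s => ∃ act kv vd Y G V,
      s = ({ v with act := act, kv := kv, vd := vd, D := Y }, { D with G := G, V := V }) ∧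
      (act = true ↔ v.act = true ∨ ∃ j' : Fin N, n ≤ j' ∧ D.mark j' = true) ∧
      FiberInv f R D.t m n V ∧ ∀ l : Fin N, l < n → V l = fun _ _ => none) (by
    rintro n hn _ ⟨act, kv, vd, Y, G, V, rfl, hact, hV, hnone⟩
    have hz' : Function.update e .j n .z = 0 := by simpa using hz
    have hread := trans_readAt (N := N) (e := Function.update e .j n) .j .j
      (F := fun v _ c => { v with act := v.act || c.mark })
      (v := { v with act := act, kv := kv, vd := vd, D := Y }) (D := { D with G := G, V := V })
      (v' := { v with act := act || D.mark ⟨n, hn⟩, kv := kv, vd := vd, D := Y })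
      hz' (fun M hM => by rw [Function.update_self, hM.mark ⟨n, hn⟩])
    have hact' : (act || D.mark ⟨n, hn⟩) = true ↔
        v.act = true ∨ ∃ j' : Fin N, n ≤ j' ∧ D.mark j' = true := by
      rw [Bool.or_eq_true, hact, or_assoc]
      refine or_congr_right ⟨?_, ?_⟩
      · rintro (⟨j', h1, h2⟩ | h)
        · exact ⟨j', by omega, h2⟩
        · exact ⟨_, le_rfl, h⟩
      · rintro ⟨j', h1, h2⟩
        rcases eq_or_lt_of_le h1 with h | h
        · exact .inr (by rwa [show (⟨n, hn⟩ : Fin N) = j' from Fin.ext h])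
        · exact .inl ⟨j', h, h2⟩
    have hm' := hm ⟨n, hn⟩
    by_cases hb : (act || D.mark ⟨n, hn⟩) = true
    · have hnm : n ≤ m := hm'.1 (hact'.1 hb)
      obtain ⟨kv', vd', Y', G', htab, hT⟩ := trans_tab (a₀ := a₀) hf (x := .j) hz'
        (j := ⟨n, hn⟩) (by simp) (by decide)
        (v := { v with act := act || D.mark ⟨n, hn⟩, kv := kv, vd := vd, D := Y })
        (D := { D with G := G, V := V }) hsc
      refine ⟨_, hread.seq (.iteTrue hb (htab.seq (trans_extend hz' (j := ⟨n, hn⟩) (by simp)))),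
        _, kv', vd', Y', G', _, rfl, hact', ?_, fun l hl => ?_⟩
      · refine hV.step f hf hR hW hnm (hnone ⟨n, hn⟩ (Nat.lt_succ_self n)) ?_ ?_
        · intro a s h
          obtain ⟨y, hy, rfl⟩ := Option.map_eq_some_iff.1 h
          obtain ⟨h1, -, h2⟩ := pickFor_some hy
          obtain ⟨h3, h4⟩ := hT.sound y h1
          exact ⟨h3, (congrArg Prod.snd h4).trans h2⟩
        · intro s hs
          have := pickFor_ne_none (C := .univ) (hT.complete s hs) trivial rfl
          simpa [key] using this
      · rw [Function.update_of_ne (show l ≠ ⟨n, hn⟩ from fun h => by subst h; exact lt_irrefl _ hl)]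
        exact hnone l (by omega)
    · refine ⟨_, hread.seq (.iteFalse (by simpa using hb) (trans_set _ _ _)),
        _, kv, vd, Y, G, V, rfl, hact', ?_, fun l hl => hnone l (by omega)⟩
      refine hV.skip (j := ⟨n, hn⟩) hf hR ?_
      exact not_le.1 fun h => hb (hact'.2 (hm'.2 h)))
    ⟨v.act, v.kv, v.vd, v.D, D.G, _, rfl, by
      refine (or_iff_left ?_).symm
      rintro ⟨j', h, -⟩
      exact absurd j'.2 (by omega), by
      constructor
      · rintro u (rfl | ⟨l, a, b, u', h⟩)
        · exact ⟨ht, fun _ _ => rfl⟩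
        · simp at h
      · exact fun s _ => ⟨D.t, .base (.inl rfl), fun k hk => absurd k.2 (by omega)⟩,
      fun _ _ => rfl⟩
  exact ⟨act, kv, vd, Y, G, V, (trans_clear hz).seq h, hV⟩

end Maltsev

/-! ### Computing the witnesses after a constraint has been imposed. -/

namespace Maltsev

open ArrayProg

variable {Γ Q : Type} {N K : ℕ}

/-- Set the mark on the diagonal. -/
def mark (x : Var) (b : Bool) : Pr Γ Q K := .upd x x fun v c => (v, { c with mark := b })

theorem trans_mark {x : Var} {e : Var → ℕ} {i : Fin N} (hi : e x = i) {b : Bool}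
    {v : Core Γ Q K} {D : Data Γ Q N K} :
    Trans (mark x b) e (v, D) (v, { D with mark := Function.update D.mark i b }) := by
  intro c M hM
  refine ⟨c, _, rfl, ?_⟩
  have h : (fun i' j' => if i' = e x ∧ j' = e x then { M (e x) (e x) with mark := b } else M i' j') =
      fun i' j' => { M i' j' with mark := if i' = i ∧ j' = i then b else (M i' j').mark } := by
    funext i' j'
    rw [hi]
    split_ifs with h
    · rw [h.1, h.2]
    · rfl
  refine (congrArg (fun M => Rel M _) h).mpr ?_
  constructor
  case mark =>
    intro k
    by_cases hk : k = i
    · subst hk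
      simp
    · simp [Fin.val_inj, hk, hM.mark]
  all_goals
    intros
    first
      | exact hM.inp _
      | exact hM.row _
      | exact hM.sc _
      | exact hM.t _
      | exact hM.G _
      | exact hM.W _ _
      | exact hM.W' _ _
      | exact hM.V _ _

/-- The registers which are not used for temporary values are the same. -/
structure Core.Same (v v' : Core Γ Q K) : Prop where
  cur : v'.cur = v.cur
  found : v'.found = v.found
  diag : v'.diag = v.diag
  ans : v'.ans = v.ans
  C : v'.C = v.C

theorem Core.Same.trans {v v' v'' : Core Γ Q K} (h : v.Same v') (h' : v'.Same v'') : v.Same v'' :=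
  ⟨h'.cur.trans h.cur, h'.found.trans h.found, h'.diag.trans h.diag, h'.ans.trans h.ans,
    h'.C.trans h.C⟩

open Classical in
/-- An element `b` with a witness for the pair `(b, b)`, if there is one. -/
noncomputable def baseOf (W : Q → Q → Option (Q × Q)) : Option Q :=
  if h : ∃ b, (W b b).isSome then some h.choose else none

theorem baseOf_some {W : Q → Q → Option (Q × Q)} {b : Q} (h : baseOf W = some b) :
    (W b b).isSome := by
  unfold baseOf at h
  split_ifs at h with h'
  cases h
  exact h'.choose_spec

theorem baseOf_eq_none_iff {W : Q → Q → Option (Q × Q)} :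
    baseOf W = none ↔ ¬∃ b, (W b b).isSome := by
  simp [baseOf]

/-- An element `s` of `R` makes `(s, s)` a witness pair in row `0` for the value `s 0`, so the
diagonal of that row detects whether `R` is empty. -/
theorem Rep.empty_of_baseOf [NeZero N] {R : Set (Fin N → Q)} {W : Table Q N} (h : Rep R W)
    {k : Fin N} (hW : baseOf (W.slice 0 k) = none) (s : Fin N → Q) : s ∉ R := fun hs =>
  baseOf_eq_none_iff.1 hW ⟨s 0, by
    obtain ⟨u, u', hu, -⟩ := h.some_of (i := 0) hs hs fun _ _ => rfl
    simp [Table.slice, hu]⟩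

variable (f : Q → Q → Q → Q) (a₀ : Q)

open Classical in
/-- Store `w b` as the witness for the pair `(a, b)` in row `i` of the table `W'`. -/
noncomputable def storeRow (w : Core Γ Q K → Cell Γ Q K → Q → Option (Q × Q)) : Pr Γ Q K :=
  mapRow .z .i fun v c₁ _ c => { c with W' := fun a b => if a = v.a then w v c₁ b else c.W' a b }

/-- Compute the witnesses for the pairs `(a, b)` in row `i` for the restricted relation. -/
noncomputable def stepAt (a : Q) : Pr Γ Q K :=
  .seq (readAt .z .z fun v c _ => { v with a := a, base := baseOf c.W }) <|
  .ite (fun v => v.1.base.isSome)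
    (.seq (mapRow .z .z fun v _ _ c => { c with
        t := ((v.base.bind fun b => c.W b b).map Prod.fst).getD a₀ }) <|
      .seq (set fun v => { v with act := true }) <|
      .seq (gen f a₀) <| .seq (tab f a₀ .i) <|
      .seq (set fun v => { v with pick := pickFor v.C v.D a }) <|
      .ite (fun v => v.1.pick.isSome)
        (.seq (mapRow .z .z fun v _ _ c => { c with t := (v.pick.map c.G).getD a₀ }) <|
          .seq (mark .i true) <| .seq (set fun v => { v with act := false }) <|
          .seq (gen f a₀) <| .seq (mark .i false) <| .seq (tab f a₀ .i) <|
          storeRow fun v c₁ b => (pickFor v.C v.D b).map fun y => (c₁.t, c₁.G y))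
        (storeRow fun _ _ _ => none))
    (storeRow fun _ _ _ => none)

variable {f a₀}

open Classical in
theorem trans_storeRow {w : Core Γ Q K → Cell Γ Q K → Q → Option (Q × Q)} {e : Var → ℕ}
    (hz : e .z = 0) {i : Fin N} (hi : e .i = i) {v : Core Γ Q K} {D : Data Γ Q N K}
    {p : Q → Option ((Fin N → Q) × (Fin N → Q))}
    (hp : ∀ M, Rel M D → ∀ k : Fin N, ∀ b, w v (M 0 k) b = (p b).map fun p => (p.1 k, p.2 k)) :
    Trans (storeRow w) e (v, D) (v, { D with
      W' := Function.update D.W' i fun a b => if a = v.a then p b else D.W' i a b }) := by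
  refine trans_mapRow (by decide) (by decide) hz fun M hM => ?_
  rw [hi]
  refine hM.mapW' i (fun i k a b => if a = v.a then w v (M 0 k) b else (M i k).W' a b) _
    fun k => ?_
  funext a b
  simp only [hM.W', hp M hM, Table.slice]
  split_ifs <;> rfl

/-- A fixed `t` in the restricted relation with `t i = a` serves for every `b`: one only has to look
for a second tuple that satisfies the constraint in the fiber of `t` above `i`. Both searches range
over keys, which show the constrained coordinates and coordinate `i`. -/
theorem trans_stepAt [NeZero N] (hf : ∀ x y, f y x x = y ∧ f x x y = y) {R : Set (Fin N → Q)}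
    (hR : Closed f R) {e : Var → ℕ} (hz : e .z = 0) {i : Fin N} (hi : e .i = i) {v : Core Γ Q K}
    (hC : ∀ x ∈ v.C, ∀ y ∈ v.C, ∀ z ∈ v.C, lift f x y z ∈ v.C) {D : Data Γ Q N K}
    {scope : Fin K → Option (Fin N)} (hsc : Scoped D.sc scope) (hW : Rep R D.W)
    (hmark : D.mark = fun _ => false) (a : Q) :
    ∃ v' t G V r, Trans (stepAt f a₀ a) e (v, D)
      (v', { D with t := t, G := G, V := V, W' := Function.update D.W' i r }) ∧ v.Same v' ∧
      (∀ b, IsWit (restrict a₀ scope v.C R) i a b (r a b)) ∧ ∀ a' ≠ a, r a' = D.W' i a' := by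
  classical
  have hread := trans_readAt (N := N) (e := e) .z .z
    (F := fun v c _ => { v with a := a, base := baseOf c.W }) (v := v) (D := D)
    (v' := { v with a := a, base := baseOf (D.W.slice 0 0) }) hz fun M hM => by
      rw [hz]
      exact congrArg (fun W => { v with a := a, base := baseOf W }) (hM.W 0 0)
  cases hb : baseOf (D.W.slice 0 0) with
  | none =>
    rw [hb] at hread
    refine ⟨_, D.t, D.G, D.V, _, hread.seq (.iteFalse (b := fun v => v.base.isSome) rfl
      (trans_storeRow hz hi (p := fun _ => none) fun M hM k b => rfl)),
      ?_, fun b => ?_, fun a' ha' => ?_⟩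
    · exact ⟨rfl, rfl, rfl, rfl, rfl⟩
    · simp only [if_true]
      rintro ⟨u, hu, -⟩
      exact hW.empty_of_baseOf hb u hu.1
    · simp [ha']
  | some b₀ =>
    rw [hb] at hread
    obtain ⟨p, hp⟩ := Option.isSome_iff_exists.1 (baseOf_some hb)
    simp only [Table.slice, Option.map_eq_some_iff] at hp
    obtain ⟨⟨u₀, u₁⟩, hu, -⟩ := hp
    have hu₀ : u₀ ∈ R := (hW.of_some hu).1
    have ht₁ := trans_mapRow (N := N) (e := e) (x := .z) (y := .z)
      (F := fun v _ _ c => { c with t := ((v.base.bind fun b => c.W b b).map Prod.fst).getD a₀ })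
      (v := { v with a := a, base := some b₀ }) (D := D) (D' := { D with t := u₀ })
      (by decide) (by decide) hz fun M hM => by
        rw [hz]
        refine hM.mapT (fun i j => (((some b₀).bind fun b => (M i j).W b b).map Prod.fst).getD a₀) _
          fun k => ?_
        rw [show M 0 k = M ((0 : Fin N) : ℕ) k from rfl, hM.W]
        simp [Table.slice, hu]
    -- With `m = N` no coordinate is fixed, so the fiber of `u₀` is all of `R`; accordingly `act` is
    -- on from the start.
    obtain ⟨act₁, kv₁, vd₁, Y₁, G₁, V₁, hgen₁, hinv₁⟩ := trans_gen (a₀ := a₀) hf hR (e := e) hz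
      (v := { v with a := a, base := some b₀, act := true }) (D := { D with t := u₀ }) hsc hW hu₀
      (m := N) fun j => by simp [j.2.le]
    obtain ⟨kv₂, vd₂, Y₂, G₂, htab₂, hT₂⟩ := trans_tab (a₀ := a₀) hf (x := .i) hz hi (by decide)
      (v := { v with a := a, base := some b₀, act := act₁, kv := kv₁, vd := vd₁, D := Y₁ })
      (D := { D with t := u₀, G := G₁, V := V₁ }) hsc
    have hfib : {u | Gen (lift f) (tuples u₀ V₁) u} = R := by
      ext u
      rw [Set.mem_ofPred_eq, hinv₁.gen_iff f hf hR]
      exact ⟨fun h => h.1, fun h => ⟨h, fun k hk => absurd k.2 (by omega)⟩⟩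
    simp only [hfib] at hT₂
    cases hy : pickFor v.C Y₂ a with
    | none =>
      refine ⟨_, _, _, _, _, hread.seq (.iteTrue (b := fun v => v.base.isSome) rfl
        (ht₁.seq <| (trans_set _ _ _).seq <|
        hgen₁.seq <| htab₂.seq <| (trans_set _ _ _).seq <|
        .iteFalse (b := fun v => v.pick.isSome) (by simp only [hy]; rfl)
        (trans_storeRow hz hi (p := fun _ => none) fun M hM k b => rfl))),
        ?_, fun b => ?_, fun a' ha' => ?_⟩
      · exact ⟨rfl, rfl, rfl, rfl, rfl⟩
      · simp only [if_true]
        rintro ⟨u, hu, -, -, -, hua, -⟩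
        exact pickFor_ne_none (hT₂.complete u hu.1) hu.2 hua hy
      · simp [ha']
    | some y =>
      obtain ⟨hyY, hyC, hya⟩ := pickFor_some hy
      obtain ⟨htR, hty⟩ := hT₂.sound y hyY
      set t := G₂ y with ht
      have hta : t i = a := (congrArg Prod.snd hty).trans hya
      have htC : proj a₀ scope t ∈ v.C := by
        rw [← hty] at hyC
        exact hyC
      have ht₂ := trans_mapRow (N := N) (e := e) (x := .z) (y := .z)
        (F := fun v _ _ c => { c with t := (v.pick.map c.G).getD a₀ })
        (v := { v with
          a := a, base := some b₀, act := act₁, kv := kv₂, vd := vd₂, D := Y₂, pick := some y })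
        (D := { D with t := u₀, G := G₂, V := V₁ }) (D' := { D with t := t, G := G₂, V := V₁ })
        (by decide) (by decide) hz fun M hM => by
          rw [hz]
          refine hM.mapT (fun i j => ((some y).map (M i j).G).getD a₀) _ fun k => ?_
          rw [hM.G]
          rfl
      -- A single mark at `i`, with `act` off at the start, selects the coordinates `≤ i`, that is,
      -- the fiber with `m = i`.
      have hmark' : Function.update D.mark i true = fun j => decide (j = i) := by
        funext j
        simp [hmark, Function.update_apply]
      obtain ⟨act₃, kv₃, vd₃, Y₃, G₃, V₃, hgen₃, hinv₃⟩ := trans_gen (a₀ := a₀) hf hR (e := e) hz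
        (v := { v with
          a := a, base := some b₀, act := false, kv := kv₂, vd := vd₂, D := Y₂, pick := some y })
        (D := { D with
          t := t, G := G₂, V := V₁, mark := Function.update D.mark i true }) hsc hW htR
        (m := i) fun j => by
          rw [hmark']
          simp only [Bool.false_eq_true, false_or, decide_eq_true_eq, exists_eq_right]
          rfl
      obtain ⟨kv₄, vd₄, Y₄, G₄, htab₄, hT₄⟩ := trans_tab (a₀ := a₀) hf (x := .i) hz hi (by decide)
        (v := { v with
          a := a, base := some b₀, act := act₃, kv := kv₃, vd := vd₃, D := Y₃, pick := some y })
        (D := { D with t := t, G := G₃, V := V₃ }) hsc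
      have hfib : {u | Gen (lift f) (tuples t V₃) u} = fiber R t i := by
        ext u
        exact hinv₃.gen_iff f hf hR u
      simp only [hfib] at hT₄
      have hunmark : Trans (mark .i false) e
          ({ v with
            a := a, base := some b₀, act := act₃, kv := kv₃, vd := vd₃, D := Y₃, pick := some y },
            { D with t := t, G := G₃, V := V₃, mark := Function.update D.mark i true })
          ({ v with
            a := a, base := some b₀, act := act₃, kv := kv₃, vd := vd₃, D := Y₃, pick := some y },
            { D with t := t, G := G₃, V := V₃ }) := by
        have := trans_mark hi (b := false)
          (v := { v with
            a := a, base := some b₀, act := act₃, kv := kv₃, vd := vd₃, D := Y₃, pick := some y })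
          (D := { D with t := t, G := G₃, V := V₃, mark := Function.update D.mark i true })
        simpa only [Function.update_idem, show Function.update D.mark i false = D.mark by
          funext j; simp [hmark]] using this
      refine ⟨_, _, _, _, _, hread.seq (.iteTrue (b := fun v => v.base.isSome) rfl
        (ht₁.seq <| (trans_set _ _ _).seq <|
        hgen₁.seq <| htab₂.seq <| (trans_set _ _ { D with t := u₀, G := G₂, V := V₁ }).seq <|
        .iteTrue (b := fun v => v.pick.isSome) (by simp only [hy]; rfl) <|
        Trans.seq (by simpa only [hy] using ht₂) <| (trans_mark hi).seq <| (trans_set _ _ _).seq <|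
        hgen₃.seq <| hunmark.seq <| htab₄.seq <| trans_storeRow hz hi
          (p := fun b => (pickFor v.C Y₄ b).map fun y => (t, G₄ y)) fun M hM k b => ?_)),
        ?_, fun b => ?_, fun a' ha' => ?_⟩
      · simp only [hM.t, hM.G, Option.map_map]
        rfl
      · exact ⟨rfl, rfl, rfl, rfl, rfl⟩
      · simp only [if_true]
        cases hy' : pickFor v.C Y₄ b with
        | none =>
          -- From a witness `(u, u')`, the tuple `f(t, u, u')` satisfies the constraint, agrees with
          -- `t` above `i` and has the value `f a a b = b` at `i`, so its key would have been found.
          rintro ⟨u, hu, u', hu', huu, hua, hub⟩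
          have := (hR.restrict f hf (a₀ := a₀) (scope := scope) hC) t ⟨htR, htC⟩ u hu u' hu'
          refine pickFor_ne_none (hT₄.complete _ ⟨this.1, fun k hk => ?_⟩) this.2 ?_ hy'
          · simp only [lift, huu k hk, hf]
          · simp only [key, lift, hta, hua, hub, hf]
        | some y' =>
          obtain ⟨hyY', hyC', hyb'⟩ := pickFor_some hy'
          obtain ⟨h1, h2⟩ := hT₄.sound y' hyY'
          refine ⟨⟨htR, htC⟩, ⟨h1.1, ?_⟩, fun k hk => (h1.2 k hk).symm, hta,
            (congrArg Prod.snd h2).trans hyb'⟩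
          rw [← h2] at hyC'
          exact hyC'
      · simp [ha']

end Maltsev

/-! ### Imposing one constraint on the whole table. -/

namespace Maltsev

open ArrayProg

variable {Γ Q : Type} {N K : ℕ} (f : Q → Q → Q → Q) (a₀ : Q)

/-- Compute row `i` of the table for the restricted relation. -/
noncomputable def stepRow : List Q → Pr Γ Q K
  | [] => set id
  | a :: as => .seq (stepAt f a₀ a) (stepRow as)

/-- Replace the table of witnesses by the one for the restricted relation; `as` lists all values. -/
noncomputable def step (as : List Q) : Pr Γ Q K :=
  .seq (.loop .i (stepRow f a₀ as)) (.loop .i (mapRow .z .i fun _ _ _ c => { c with W := c.W' }))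

variable {f a₀}

theorem trans_stepRow [NeZero N] (hf : ∀ x y, f y x x = y ∧ f x x y = y) {R : Set (Fin N → Q)}
    (hR : Closed f R) {e : Var → ℕ} (hz : e .z = 0) {i : Fin N} (hi : e .i = i)
    {scope : Fin K → Option (Fin N)} (as : List Q) {v : Core Γ Q K}
    (hC : ∀ x ∈ v.C, ∀ y ∈ v.C, ∀ z ∈ v.C, lift f x y z ∈ v.C) {D : Data Γ Q N K}
    (hsc : Scoped D.sc scope) (hW : Rep R D.W) (hmark : D.mark = fun _ => false) :
    ∃ v' t G V r, Trans (stepRow f a₀ as) e (v, D)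
      (v', { D with t := t, G := G, V := V, W' := Function.update D.W' i r }) ∧ v.Same v' ∧
      (∀ a ∈ as, ∀ b, IsWit (restrict a₀ scope v.C R) i a b (r a b)) ∧
      ∀ a' ∉ as, r a' = D.W' i a' := by
  classical
  induction as generalizing v D with
  | nil =>
    refine ⟨v, D.t, D.G, D.V, D.W' i, ?_, ⟨rfl, rfl, rfl, rfl, rfl⟩, by simp, fun _ _ => rfl⟩
    rw [Function.update_eq_self]
    exact trans_set _ _ _
  | cons a as ih =>
    obtain ⟨v₁, t₁, G₁, V₁, r₁, h1, hs₁, hr₁, hr₁'⟩ := trans_stepAt hf hR hz hi hC hsc hW hmark a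
    obtain ⟨v₂, t₂, G₂, V₂, r₂, h2, hs₂, hr₂, hr₂'⟩ := ih (v := v₁)
      (D := { D with t := t₁, G := G₁, V := V₁, W' := Function.update D.W' i r₁ })
      (by rwa [hs₁.C]) hsc hW hmark
    simp only [Function.update_idem, Function.update_self] at h2 hr₂'
    rw [hs₁.C] at hr₂
    refine ⟨v₂, t₂, G₂, V₂, r₂, h1.seq h2, hs₁.trans hs₂, fun a' ha' b => ?_, fun a' ha' => ?_⟩
    · by_cases ha : a' ∈ as
      · exact hr₂ a' ha b
      · obtain rfl := (List.mem_cons.1 ha').resolve_right ha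
        rw [hr₂' a' ha]
        exact hr₁ b
    · rw [hr₂' a' fun h => ha' (List.mem_cons_of_mem _ h)]
      exact hr₁' a' fun h => ha' (h ▸ List.mem_cons_self)

/-- Every new row is computed from the complete old table `W`, so the new rows are gathered in `W'`
and copied only at the end. -/
theorem trans_step [NeZero N] (hf : ∀ x y, f y x x = y ∧ f x x y = y) {R : Set (Fin N → Q)}
    (hR : Closed f R) {e : Var → ℕ} (hz : e .z = 0) {scope : Fin K → Option (Fin N)} {as : List Q}
    (has : ∀ a, a ∈ as) {v : Core Γ Q K}
    (hC : ∀ x ∈ v.C, ∀ y ∈ v.C, ∀ z ∈ v.C, lift f x y z ∈ v.C) {D : Data Γ Q N K}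
    (hsc : Scoped D.sc scope) (hW : Rep R D.W) (hmark : D.mark = fun _ => false) :
    ∃ v' t G V W, Trans (step f a₀ as) e (v, D)
      (v', { D with t := t, G := G, V := V, W' := W, W := W }) ∧ v.Same v' ∧
      Rep (restrict a₀ scope v.C R) W := by
  obtain ⟨_, h1, v₁, t, G, V, W, rfl, hs, hr⟩ := Trans.loop (P := stepRow f a₀ as) (x := .i)
    (e := e) (s := (v, D)) (fun m s => ∃ v' t G V W,
      s = (v', { D with t := t, G := G, V := V, W' := W }) ∧ v.Same v' ∧
      ∀ i : Fin N, m ≤ i → ∀ a b, IsWit (restrict a₀ scope v.C R) i a b (W i a b)) (by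
    rintro m hm _ ⟨v', t, G, V, W, rfl, hs, hr⟩
    obtain ⟨v₁, t₁, G₁, V₁, r, h1, hs₁, hr₁, -⟩ := trans_stepRow (a₀ := a₀) hf hR
      (e := Function.update e .i m) (by simpa using hz) (i := ⟨m, hm⟩) (by simp) as (v := v')
      (by rwa [hs.C]) (D := { D with t := t, G := G, V := V, W' := W }) hsc hW hmark
    refine ⟨_, h1, v₁, t₁, G₁, V₁, _, rfl, hs.trans hs₁, fun i hi a b => ?_⟩
    by_cases h : i = ⟨m, hm⟩
    · rw [h, Function.update_self, ← hs.C]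
      exact hr₁ a (has a) b
    · rw [Function.update_of_ne h]
      refine hr i ?_ a b
      have : (i : ℕ) ≠ m := fun h' => h (Fin.ext h')
      omega) ⟨v, D.t, D.G, D.V, D.W', rfl, ⟨rfl, rfl, rfl, rfl, rfl⟩,
        fun i hi => absurd i.2 (by omega)⟩
  obtain ⟨_, h2, W₁, rfl, hW₁⟩ := Trans.loop (x := .i) (e := e)
    (P := mapRow .z .i fun _ _ _ c => { c with W := c.W' })
    (s := (v₁, { D with t := t, G := G, V := V, W' := W }))
    (fun m s => ∃ W₁, s = (v₁, { D with t := t, G := G, V := V, W' := W, W := W₁ }) ∧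
      ∀ i : Fin N, m ≤ i → W₁ i = W i) (by
    rintro m hm _ ⟨W₁, rfl, hW₁⟩
    refine ⟨_, trans_mapRow (v := v₁) (D' := { D with
      t := t, G := G, V := V, W' := W, W := Function.update W₁ ⟨m, hm⟩ (W ⟨m, hm⟩) })
      (by decide) (by decide) (by simpa using hz) fun M hM => ?_, _, rfl, fun i hi => ?_⟩
    · rw [Function.update_self]
      exact hM.mapW ⟨m, hm⟩ (fun i j => (M i j).W') _ fun k => hM.W' ⟨m, hm⟩ k
    · by_cases h : i = ⟨m, hm⟩
      · rw [h, Function.update_self]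
      · rw [Function.update_of_ne h]
        refine hW₁ i ?_
        have : (i : ℕ) ≠ m := fun h' => h (Fin.ext h')
        omega) ⟨D.W, rfl, fun i hi => absurd i.2 (by omega)⟩
  obtain rfl : W₁ = W := funext fun i => hW₁ i (Nat.zero_le _)
  exact ⟨v₁, t, G, V, _, h1.seq h2, hs, fun i a b => hr i (Nat.zero_le _) a b⟩

end Maltsev

/-! ### Names of variables in a word and their canonical positions. -/

namespace Maltsev

open ArrayProg

variable {Γ Q : Type} {N K : ℕ} (bitOf : Γ → Option Bool) (isVar : Γ → Bool)

/-- The word of bits at the beginning of a word. -/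
def run : List Γ → List Bool
  | [] => []
  | c :: u => match bitOf c with
    | some b => b :: run u
    | none => []

/-- The names of the variables that occur in a word. -/
def names : List Γ → List (List Bool)
  | [] => []
  | c :: u => if isVar c then run bitOf u :: names u else names u

theorem run_drop (w : List Γ) (r : ℕ) : run bitOf (w.drop r) =
    match w[r]?.bind bitOf with
    | some b => b :: run bitOf (w.drop (r + 1))
    | none => [] := by
  by_cases h : r < w.length
  · rw [List.drop_eq_getElem_cons h, List.getElem?_eq_getElem h, run]
    rfl
  · rw [List.drop_of_length_le (by omega), List.getElem?_eq_none (by omega)]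
    rfl

theorem names_drop (w : List Γ) (r : ℕ) : names bitOf isVar (w.drop r) =
    if w[r]?.any isVar then run bitOf (w.drop (r + 1)) :: names bitOf isVar (w.drop (r + 1))
    else names bitOf isVar (w.drop (r + 1)) := by
  by_cases h : r < w.length
  · rw [List.drop_eq_getElem_cons h, List.getElem?_eq_getElem h, names]
    rfl
  · rw [List.drop_of_length_le (by omega), List.getElem?_eq_none (by omega),
      List.drop_of_length_le (by omega)]
    rfl

/-- A variable with name `x` occurs at position `k`. -/
def IsName (w : List Γ) (x : List Bool) (k : ℕ) : Prop :=
  w[k]?.any isVar = true ∧ run bitOf (w.drop (k + 1)) = x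

/-- The last occurrence of the variable with name `x` is at position `k`. -/
def IsCanon (w : List Γ) (x : List Bool) (k : ℕ) : Prop :=
  IsName bitOf isVar w x k ∧ ∀ k' > k, ¬IsName bitOf isVar w x k'

open Classical in
/-- The last occurrence of the variable with name `x`. -/
noncomputable def canon (w : List Γ) (x : List Bool) : Option (Fin (w.length + 1)) :=
  if h : ∃ k : Fin (w.length + 1), IsCanon bitOf isVar w x k then some h.choose else none

variable {bitOf isVar}

theorem IsName.lt {w : List Γ} {x : List Bool} {k : ℕ} (h : IsName bitOf isVar w x k) :
    k < w.length := by
  by_contra hk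
  have := h.1
  rw [List.getElem?_eq_none (by omega)] at this
  cases this

theorem IsCanon.unique {w : List Γ} {x : List Bool} {k k' : ℕ} (h : IsCanon bitOf isVar w x k)
    (h' : IsCanon bitOf isVar w x k') : k = k' := by
  rcases lt_trichotomy k k' with hk | hk | hk
  · exact absurd h'.1 (h.2 k' hk)
  · exact hk
  · exact absurd h.1 (h'.2 k hk)

theorem canon_eq_some_iff {w : List Γ} {x : List Bool} {k : Fin (w.length + 1)} :
    canon bitOf isVar w x = some k ↔ IsCanon bitOf isVar w x k := by
  unfold canon
  split_ifs with h
  · rw [Option.some_inj]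
    exact ⟨fun hk => hk ▸ h.choose_spec, fun hk => Fin.ext (h.choose_spec.unique hk)⟩
  · simpa using fun hk => h ⟨k, hk⟩

/-- The greatest position with the given name is canonical; it exists because all such positions lie
within the word. -/
theorem IsName.exists_canon {w : List Γ} {x : List Bool} {k : ℕ} (h : IsName bitOf isVar w x k) :
    ∃ k', canon bitOf isVar w x = some k' ∧ IsName bitOf isVar w x k' := by
  classical
  have h1 := Nat.findGreatest_spec h.lt.le h
  have h2 : IsCanon bitOf isVar w x (Nat.findGreatest (IsName bitOf isVar w x) w.length) :=
    ⟨h1, fun k' hk' hk => Nat.findGreatest_is_greatest hk' hk.lt.le hk⟩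
  exact ⟨⟨_, Nat.lt_succ_of_lt h1.lt⟩, canon_eq_some_iff.2 h2, h1⟩

theorem exists_isName {w : List Γ} {x : List Bool} {r : ℕ}
    (h : x ∈ names bitOf isVar (w.drop r)) : ∃ k, IsName bitOf isVar w x k := by
  by_cases hr : w.length ≤ r
  · rw [List.drop_of_length_le hr] at h
    cases h
  · rw [names_drop] at h
    split_ifs at h with hv
    · rcases List.mem_cons.1 h with rfl | h
      · exact ⟨r, hv, rfl⟩
      · exact exists_isName h
    · exact exists_isName h
termination_by w.length - r

variable (bitOf isVar)

/-- The positions of the variables that occur in `u`. -/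
noncomputable def scopeOf (w u : List Γ) (κ : Fin K) : Option (Fin (w.length + 1)) :=
  (names bitOf isVar u)[κ.val]?.bind (canon bitOf isVar w)

/-- Compare the words of bits at two positions, given the result for the next positions. -/
def eqBit : Option Bool → Option Bool → Bool → Bool
  | some b, some b', d => b == b' && d
  | none, none, _ => true
  | _, _, _ => false

/-- Insert a mark in front. -/
def shift (b : Bool) (s : Fin K → Bool) (κ : Fin K) : Bool :=
  if κ.val = 0 then b else s ⟨κ - 1, by omega⟩

/-- The position in the registers is the last occurrence of the variable at hand. -/
def isHit (v : Core Γ Q K) (o : Option Γ) : Bool :=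
  v.cur.any isVar && o.any isVar && v.diag && !v.found

/-- Update the information on the comparison with the current position, in one column. -/
def scanCell (v : Reg Γ Q K) (c : Cell Γ Q K) : Reg Γ Q K × Cell Γ Q K :=
  (({ v.1 with diag := c.row, found := v.1.found || isHit isVar v.1 c.inp }, v.2),
    { c with
      row := eqBit (v.1.cur.bind bitOf) (c.inp.bind bitOf) v.1.diag
      sc := if v.1.cur.any isVar then shift (isHit isVar v.1 c.inp) c.sc else c.sc })

variable {bitOf isVar}

theorem Rel.setScan {M : ℕ → ℕ → Cell Γ Q K} {D : Data Γ Q N K} (hM : Rel M D) (k : Fin N)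
    (b : Bool) (s : Fin K → Bool) :
    Rel (fun i j => if i = 0 ∧ j = k then { M 0 k with row := b, sc := s } else M i j)
      { D with row := Function.update D.row k b, sc := Function.update D.sc k s } := by
  have h : (fun i j => if i = 0 ∧ j = (k : ℕ) then { M 0 k with row := b, sc := s } else M i j) =
      fun i j => { M i j with
        row := if i = 0 ∧ j = k then b else (M i j).row
        sc := if i = 0 ∧ j = k then s else (M i j).sc } := by
    funext i j
    split_ifs with h
    · rw [h.1, h.2]
    · rfl
  rw [h]
  constructor
  case row =>
    intro k'
    by_cases hk : k' = k <;> simp [hk, Fin.val_inj, hM.row]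
  case sc =>
    intro k'
    by_cases hk : k' = k <;> simp [hk, Fin.val_inj, hM.sc]
  all_goals
    intros
    first
      | exact hM.inp _
      | exact hM.mark _
      | exact hM.t _
      | exact hM.G _
      | exact hM.W _ _
      | exact hM.W' _ _
      | exact hM.V _ _

theorem trans_scanCell {e : Var → ℕ} (hz : e .z = 0) {k : Fin N} (hk : e .k = k)
    {v : Core Γ Q K} {D : Data Γ Q N K} :
    Trans (.upd .z .k (scanCell bitOf isVar)) e (v, D)
      ({ v with diag := D.row k, found := v.found || isHit isVar v (D.inp k) }, { D with
        row := Function.update D.row k (eqBit (v.cur.bind bitOf) ((D.inp k).bind bitOf) v.diag)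
        sc := Function.update D.sc k
          (if v.cur.any isVar then shift (isHit isVar v (D.inp k)) (D.sc k) else D.sc k) }) := by
  intro c M hM
  have h : scanCell bitOf isVar (v, c) (M 0 k) =
      (({ v with diag := D.row k, found := v.found || isHit isVar v (D.inp k) }, c),
        { M 0 k with
          row := eqBit (v.cur.bind bitOf) ((D.inp k).bind bitOf) v.diag
          sc := if v.cur.any isVar then shift (isHit isVar v (D.inp k)) (D.sc k) else D.sc k }) := by
    simp only [scanCell, hM.inp k, hM.row k, hM.sc k]
  refine ⟨c, _, ?_, hM.setScan k _ _⟩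
  simp only [Prog.eval, hz, hk, h]

end Maltsev

/-! ### Comparing names by dynamic programming. -/

namespace Maltsev

open ArrayProg

variable {Γ Q : Type} {N K : ℕ} (bitOf : Γ → Option Bool) (isVar : Γ → Bool)

/-- Compare the words of bits at the current position with those at all other positions, and find
the variable at the current position. -/
def scan : Pr Γ Q K := .loop .k (.upd .z .k (scanCell bitOf isVar))

variable {bitOf isVar}

/-- Two words of bits agree if both are empty, or if their first bits and their tails agree; `d` is
the comparison of the tails. At the end of the word there is no bit, so nothing is required of `d`
there. -/
theorem eqBit_eq {w : List Γ} {r m : ℕ} {d : Bool}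
    (hd : m < w.length → (d = true ↔ run bitOf (w.drop (r + 1)) = run bitOf (w.drop (m + 1)))) :
    eqBit (w[r]?.bind bitOf) (w[m]?.bind bitOf) d = true ↔
      run bitOf (w.drop r) = run bitOf (w.drop m) := by
  rw [run_drop bitOf w r, run_drop bitOf w m]
  have hm : ∀ b, w[m]?.bind bitOf = some b → m < w.length := by
    intro b hb
    by_contra h
    rw [List.getElem?_eq_none (by omega)] at hb
    cases hb
  rcases w[r]?.bind bitOf with _ | b <;> rcases h : w[m]?.bind bitOf with _ | b'
  · simp [eqBit]
  · simp [eqBit]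
  · simp [eqBit]
  · simp [eqBit, hd (hm _ h)]

/-- Positions are scanned from the right and `found` records earlier matches, so the first match is
the last occurrence. -/
theorem isHit_eq {w : List Γ} {r m : ℕ} {v : Core Γ Q K} (hcur : v.cur = w[r]?)
    (hd : m < w.length →
      (v.diag = true ↔ run bitOf (w.drop (r + 1)) = run bitOf (w.drop (m + 1))))
    (hfound : v.found = true ↔ w[r]?.any isVar = true ∧
      ∃ k, m < k ∧ IsName bitOf isVar w (run bitOf (w.drop (r + 1))) k) :
    isHit isVar v w[m]? = true ↔
      w[r]?.any isVar = true ∧ IsCanon bitOf isVar w (run bitOf (w.drop (r + 1))) m := by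
  have hm : w[m]?.any isVar = true → m < w.length := by
    intro h
    by_contra h'
    rw [List.getElem?_eq_none (by omega)] at h
    cases h
  simp only [isHit, hcur, Bool.and_eq_true, Bool.not_eq_true', ← Bool.not_eq_true, hfound]
  constructor
  · rintro ⟨⟨⟨h1, h2⟩, h3⟩, h4⟩
    exact ⟨h1, ⟨h2, ((hd (hm h2)).1 h3).symm⟩, fun k' hk' h => h4 ⟨h1, k', hk', h⟩⟩
  · rintro ⟨h1, ⟨h2, h3⟩, h4⟩
    exact ⟨⟨⟨h1, h2⟩, (hd (hm h2)).2 h3.symm⟩, fun ⟨_, k', hk', h⟩ => h4 k' hk' h⟩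

/-- A variable letter puts its name in front of the list of names and shifts the indices of all
others by one; other letters leave the list unchanged. -/
theorem scoped_drop {w : List Γ} {r : ℕ} {sc sc' : Fin (w.length + 1) → Fin K → Bool}
    (hsc : Scoped sc (scopeOf bitOf isVar w (w.drop (r + 1)))) (b : Fin (w.length + 1) → Bool)
    (hb : w[r]?.any isVar = true →
      ∀ k, b k = true ↔ IsCanon bitOf isVar w (run bitOf (w.drop (r + 1))) k)
    (hsc' : ∀ k, sc' k = if w[r]?.any isVar then shift (b k) (sc k) else sc k) :
    Scoped sc' (scopeOf bitOf isVar w (w.drop r)) := by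
  intro k κ
  rw [hsc', scopeOf, names_drop]
  split_ifs with hv
  · by_cases h0 : κ.val = 0
    · simp [shift, h0, hb hv, canon_eq_some_iff]
    · obtain ⟨n, hn⟩ := Nat.exists_eq_succ_of_ne_zero h0
      simp only [shift, hn, Nat.succ_eq_add_one, List.getElem?_cons_succ]
      exact hsc k ⟨n, by omega⟩
  · exact hsc k κ

/-- The comparisons of position `r` with all `k` follow from those of `r + 1` with `k + 1`. A single
row suffices: going down through `k`, the register `diag` saves the old entry before it is
overwritten, for use in the next column. -/
theorem trans_scan {e : Var → ℕ} (hz : e .z = 0) {w : List Γ} {r : ℕ} {v : Core Γ Q K}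
    {D : Data Γ Q (w.length + 1) K} (hcur : v.cur = w[r]?) (hfound : v.found = false)
    (hinp : ∀ k, D.inp k = w[k.val]?)
    (hrow : ∀ k, D.row k = true ↔ run bitOf (w.drop (r + 1)) = run bitOf (w.drop k))
    (hsc : Scoped D.sc (scopeOf bitOf isVar w (w.drop (r + 1)))) :
    ∃ found diag row sc, Trans (scan bitOf isVar) e (v, D)
      ({ v with found := found, diag := diag }, { D with row := row, sc := sc }) ∧
      (∀ k, row k = true ↔ run bitOf (w.drop r) = run bitOf (w.drop k)) ∧
      Scoped sc (scopeOf bitOf isVar w (w.drop r)) := by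
  set x := run bitOf (w.drop (r + 1)) with hx
  -- The function `b` is no part of the state; it records for each column whether it was the hit.
  -- The condition on `diag` is void at the start, where no column has been read.
  obtain ⟨_, h, found, diag, row, sc, b, rfl, hrow', -, hb, hsc', -⟩ := Trans.loop (x := .k)
    (P := .upd .z .k (scanCell bitOf isVar)) (e := e) (s := (v, D))
    (fun m s => ∃ found diag row sc, ∃ b : Fin (w.length + 1) → Bool,
      s = ({ v with found := found, diag := diag }, { D with row := row, sc := sc }) ∧
      (∀ k : Fin (w.length + 1), m ≤ k →
        (row k = true ↔ run bitOf (w.drop r) = run bitOf (w.drop k))) ∧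
      (∀ k : Fin (w.length + 1), k < m → row k = D.row k ∧ sc k = D.sc k) ∧
      (∀ k : Fin (w.length + 1), m ≤ k → w[r]?.any isVar = true →
        (b k = true ↔ IsCanon bitOf isVar w x k)) ∧
      (∀ k : Fin (w.length + 1), m ≤ k →
        sc k = if w[r]?.any isVar then shift (b k) (D.sc k) else D.sc k) ∧
      (m < w.length + 1 → (diag = true ↔ x = run bitOf (w.drop m))) ∧
      (found = true ↔ w[r]?.any isVar = true ∧ ∃ k, m ≤ k ∧ IsName bitOf isVar w x k)) (by
    rintro m hm _ ⟨found, diag, row, sc, b, rfl, h1, h2, h3, h4, h5, h6⟩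
    have hd := fun h : m < w.length => h5 (Nat.add_lt_add_right h 1)
    have hhit := isHit_eq (v := { v with found := found, diag := diag }) hcur hd h6
    have hrowm := hrow ⟨m, hm⟩
    obtain ⟨h7, h8⟩ := h2 ⟨m, hm⟩ (Nat.lt_succ_self m)
    refine ⟨_, trans_scanCell (by simpa using hz) (k := ⟨m, hm⟩) (by simp), _, _, _, _,
      Function.update b ⟨m, hm⟩ (isHit isVar { v with found := found, diag := diag } w[m]?),
      rfl, ?_, ?_, ?_, ?_, ?_, ?_⟩
    · intro k hk
      by_cases hkm : k = ⟨m, hm⟩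
      · subst hkm
        simp only [Function.update_self, hinp, hcur]
        exact eqBit_eq hd
      · rw [Function.update_of_ne hkm]
        have : (k : ℕ) ≠ m := fun h' => hkm (Fin.ext h')
        exact h1 k (by omega)
    · intro k hk
      have hkm : k ≠ ⟨m, hm⟩ := fun h => by
        subst h
        exact lt_irrefl _ hk
      rw [Function.update_of_ne hkm, Function.update_of_ne hkm]
      exact h2 k (by omega)
    · intro k hk hv
      by_cases hkm : k = ⟨m, hm⟩
      · subst hkm
        rw [Function.update_self, hhit, and_iff_right hv]
      · rw [Function.update_of_ne hkm]
        have : (k : ℕ) ≠ m := fun h' => hkm (Fin.ext h')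
        exact h3 k (by omega) hv
    · intro k hk
      by_cases hkm : k = ⟨m, hm⟩
      · subst hkm
        simp only [Function.update_self, hinp, hcur, h8]
      · rw [Function.update_of_ne hkm, Function.update_of_ne hkm]
        have : (k : ℕ) ≠ m := fun h' => hkm (Fin.ext h')
        exact h4 k (by omega)
    · intro _
      simp only [h7]
      exact hrowm
    · rw [Bool.or_eq_true, hinp]
      simp only [hhit, h6, ← and_or_left]
      refine and_congr_right fun hv => ⟨?_, ?_⟩
      · rintro (⟨k, hk, h⟩ | h)
        · exact ⟨k, by omega, h⟩
        · exact ⟨m, le_rfl, h.1⟩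
      · rintro ⟨k, hk, h⟩
        by_cases hex : ∃ k, m + 1 ≤ k ∧ IsName bitOf isVar w x k
        · exact .inl hex
        · rcases eq_or_lt_of_le hk with rfl | hk
          · exact .inr ⟨h, fun k' hk' h' => hex ⟨k', hk', h'⟩⟩
          · exact .inl ⟨k, hk, h⟩) ⟨v.found, v.diag, D.row, D.sc, fun _ => false, rfl,
      fun k hk => absurd k.2 (by omega), fun _ _ => ⟨rfl, rfl⟩,
      fun k hk => absurd k.2 (by omega), fun k hk => absurd k.2 (by omega),
      fun h => absurd h (lt_irrefl _), by
        rw [hfound]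
        simp only [Bool.false_eq_true, false_iff]
        rintro ⟨-, k, hk, h⟩
        have := h.lt
        omega⟩
  exact ⟨found, diag, row, sc, h, fun k => hrow' k (Nat.zero_le _),
    scoped_drop hsc b (fun hv k => hb k (Nat.zero_le _) hv) fun k => hsc' k (Nat.zero_le _)⟩

end Maltsev

/-! ### Processing the input word from right to left. -/

namespace Maltsev

open ArrayProg

variable {Γ Q : Type} {N K : ℕ} (f : Q → Q → Q → Q) (a₀ : Q) (bitOf : Γ → Option Bool)
  (isVar : Γ → Bool) (cons : Γ → Option (Set (Fin K → Q)))

/-- The assignments that satisfy all constraints in the word `u`, a suffix of `w`. -/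
def solutions (w : List Γ) : List Γ → Set (Fin (w.length + 1) → Q)
  | [] => .univ
  | c :: u => match cons c with
    | some C => restrict a₀ (scopeOf bitOf isVar w u) C (solutions w u)
    | none => solutions w u

theorem solutions_drop (w : List Γ) (r : ℕ) :
    solutions a₀ bitOf isVar cons w (w.drop r) = match w[r]?.bind cons with
      | some C => restrict a₀ (scopeOf bitOf isVar w (w.drop (r + 1))) C
          (solutions a₀ bitOf isVar cons w (w.drop (r + 1)))
      | none => solutions a₀ bitOf isVar cons w (w.drop (r + 1)) := by
  by_cases h : r < w.length
  · rw [List.drop_eq_getElem_cons h, List.getElem?_eq_getElem h, solutions]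
    rfl
  · rw [List.drop_of_length_le (by omega), List.getElem?_eq_none (by omega),
      List.drop_of_length_le (by omega)]
    rfl

/-- Set all entries of the table of witnesses such that it represents the full relation. -/
noncomputable def initTable : Pr Γ Q K :=
  .loop .i <| .seq (mapRow .z .i fun _ _ _ c => { c with W := fun _ _ => some (a₀, a₀) })
    (.upd .i .i fun v c => (v, { c with W := fun a b => some (a, b) }))

/-- Process the letter at position `r`. -/
noncomputable def processAt (as : List Q) : Pr Γ Q K :=
  .seq (readAt .z .r fun v c _ => { v with cur := c.inp, found := false }) <|
  .seq (scan bitOf isVar) <|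
  .ite (fun v => (v.1.cur.bind cons).isSome)
    (.seq (set fun v => { v with C := (v.cur.bind cons).getD ∅ }) (step f a₀ as)) (set id)

/-- Decide whether the constraints in the input word are satisfiable. -/
noncomputable def solve (as : List Q) : Pr Γ Q K :=
  .seq (initTable a₀) <|
  .seq (mapRow .z .z fun _ _ _ c => { c with row := (c.inp.bind bitOf).isNone }) <|
  .seq (.loop .r (processAt f a₀ bitOf isVar cons as)) <|
  readAt .z .z fun v c _ => { v with ans := (baseOf c.W).isSome }

variable {f a₀ bitOf isVar cons}

theorem rep_univ [NeZero N] : Rep (N := N) (Set.univ : Set (Fin N → Q)) fun i a b =>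
    some (Function.update (fun _ => a₀) i a, Function.update (fun _ => a₀) i b) := by
  intro i a b
  refine ⟨trivial, trivial, fun k hk => ?_, by simp, by simp⟩
  rw [Function.update_of_ne hk.ne', Function.update_of_ne hk.ne']

theorem Rel.setW {M : ℕ → ℕ → Cell Γ Q K} {D : Data Γ Q N K} (hM : Rel M D) (i j : Fin N)
    (w : Q → Q → Option (Q × Q)) (W : Table Q N)
    (hW : ∀ i' k, W.slice i' k = if i' = i ∧ k = j then w else D.W.slice i' k) :
    Rel (fun i' j' => if i' = i ∧ j' = j then { M i j with W := w } else M i' j')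
      { D with W := W } := by
  have h : (fun i' j' => if i' = (i : ℕ) ∧ j' = (j : ℕ) then { M i j with W := w } else M i' j') =
      fun i' j' => { M i' j' with W := if i' = i ∧ j' = j then w else (M i' j').W } := by
    funext i' j'
    split_ifs with h
    · rw [h.1, h.2]
    · rfl
  rw [h]
  constructor
  case W =>
    intro i' k
    simp only [Fin.val_inj, hM.W, hW]
  all_goals
    intros
    first
      | exact hM.inp _
      | exact hM.row _
      | exact hM.sc _
      | exact hM.mark _
      | exact hM.t _
      | exact hM.G _
      | exact hM.W' _ _
      | exact hM.V _ _

theorem Rel.mapRowField {M : ℕ → ℕ → Cell Γ Q K} {D : Data Γ Q N K} (hM : Rel M D)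
    (F : ℕ → ℕ → Bool) (b : Fin N → Bool) (h : ∀ k : Fin N, F 0 k = b k) :
    Rel (fun i j => if i = 0 ∧ j < N then { M i j with row := F i j } else M i j)
      { D with row := b } := by
  constructor
  case row => exact fun k => by simpa using h k
  all_goals
    intros
    simp only [apply_ite Cell.inp, apply_ite Cell.sc, apply_ite Cell.mark, apply_ite Cell.t,
      apply_ite Cell.G, apply_ite Cell.W, apply_ite Cell.W', apply_ite Cell.V, ite_self]
    first
      | exact hM.inp _
      | exact hM.sc _
      | exact hM.mark _
      | exact hM.t _
      | exact hM.G _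
      | exact hM.W _ _
      | exact hM.W' _ _
      | exact hM.V _ _

theorem trans_initTable [NeZero N] {e : Var → ℕ} (hz : e .z = 0) {v : Core Γ Q K}
    {D : Data Γ Q N K} : ∃ W, Trans (initTable a₀) e (v, D) (v, { D with W := W }) ∧
      Rep .univ W := by
  obtain ⟨_, h, W, rfl, hW⟩ := Trans.loop (x := .i) (e := e) (s := (v, D))
    (P := .seq (mapRow .z .i fun _ _ _ c => { c with W := fun _ _ => some (a₀, a₀) })
      (.upd .i .i fun v c => (v, { c with W := fun a b => some (a, b) })))
    (fun m s => ∃ W, s = (v, { D with W := W }) ∧ ∀ i : Fin N, m ≤ i →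
      W i = fun a b => some (Function.update (fun _ => a₀) i a, Function.update (fun _ => a₀) i b))
    (by
      rintro m hm _ ⟨W, rfl, hW⟩
      set i : Fin N := ⟨m, hm⟩ with hi
      set W₁ := Function.update W i fun _ _ => some (fun _ => a₀, fun _ => a₀) with hW₁
      set W₂ := Function.update W i fun a b =>
        some (Function.update (fun _ => a₀) i a, Function.update (fun _ => a₀) i b) with hW₂
      have h1 := trans_mapRow (N := N) (x := .z) (y := .i) (e := Function.update e .i m)
        (F := fun _ _ _ c => { c with W := fun _ _ => some (a₀, a₀) }) (v := v)
        (D := { D with W := W }) (D' := { D with W := W₁ })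
        (by decide) (by decide) (by simpa using hz) fun M hM => by
          rw [Function.update_self]
          exact hM.mapW i (fun _ _ _ _ => some (a₀, a₀)) _ fun k => rfl
      have h2 : Trans (.upd .i .i fun v c => (v, { c with W := fun a b => some (a, b) }))
          (Function.update e .i m) (v, { D with W := W₁ }) (v, { D with W := W₂ }) := by
        intro c M hM
        refine ⟨c, _, ?_, hM.setW i i (fun a b => some (a, b)) W₂ fun i' k => ?_⟩
        · rw [Prog.eval, Function.update_self]
        · funext a b
          by_cases hi' : i' = i
          · subst hi'
            by_cases hk : k = i
            · subst hk
              simp [hW₂, Table.slice]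
            · simp [hW₁, hW₂, Table.slice, hk]
          · simp [hW₁, hW₂, Table.slice, hi']
      refine ⟨_, h1.seq h2, W₂, rfl, fun i' hi' => ?_⟩
      by_cases h : i' = i
      · rw [h, hW₂, Function.update_self]
      · rw [hW₂, Function.update_of_ne h]
        refine hW i' ?_
        have : (i' : ℕ) ≠ m := fun h' => h (Fin.ext h')
        omega) ⟨D.W, rfl, fun i hi => absurd i.2 (by omega)⟩
  refine ⟨W, h, ?_⟩
  rw [show W = _ from funext fun i => hW i (Nat.zero_le _)]
  exact rep_univ

/-- The operation preserves all constraints. -/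
def Preserves (f : Q → Q → Q → Q) (cons : Γ → Option (Set (Fin K → Q))) : Prop :=
  ∀ c C, cons c = some C → ∀ x ∈ C, ∀ y ∈ C, ∀ z ∈ C, lift f x y z ∈ C

/-- Closure under `f` persists when constraints preserved by `f` are imposed; this is what makes the
compact representation usable at every stage. -/
theorem closed_solutions (hf : ∀ x y, f y x x = y ∧ f x x y = y) (hcons : Preserves f cons)
    (w u : List Γ) : Closed f (solutions a₀ bitOf isVar cons w u) := by
  induction u with
  | nil => exact fun _ _ _ _ _ _ => trivial
  | cons c u ih =>
    rw [solutions]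
    cases h : cons c with
    | none => exact ih
    | some C => exact ih.restrict f hf (hcons c C h)

/-- The state of the program when the suffix of `w` from position `r` has been processed. -/
structure Inv (a₀ : Q) (bitOf : Γ → Option Bool) (isVar : Γ → Bool)
    (cons : Γ → Option (Set (Fin K → Q))) (w : List Γ) (r : ℕ)
    (D : Data Γ Q (w.length + 1) K) : Prop where
  inp : ∀ k, D.inp k = w[k.val]?
  row : ∀ k, D.row k = true ↔ run bitOf (w.drop r) = run bitOf (w.drop k)
  scope : Scoped D.sc (scopeOf bitOf isVar w (w.drop r))
  mark : D.mark = fun _ => false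
  rep : Rep (solutions a₀ bitOf isVar cons w (w.drop r)) D.W

theorem trans_processAt (hf : ∀ x y, f y x x = y ∧ f x x y = y) (hcons : Preserves f cons)
    (hvar : ∀ c C, cons c = some C → isVar c = false) {as : List Q} (has : ∀ a, a ∈ as)
    {e : Var → ℕ} (hz : e .z = 0) {w : List Γ} {r : Fin (w.length + 1)} (hr : e .r = r)
    {v : Core Γ Q K} {D : Data Γ Q (w.length + 1) K}
    (hD : Inv a₀ bitOf isVar cons w (r + 1) D) :
    ∃ v' D', Trans (processAt f a₀ bitOf isVar cons as) e (v, D) (v', D') ∧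
      Inv a₀ bitOf isVar cons w r D' := by
  have h1 := trans_readAt (N := w.length + 1) (e := e) .z .r
    (F := fun v c _ => { v with cur := c.inp, found := false }) (v := v) (D := D)
    (v' := { v with cur := w[r.val]?, found := false }) hz fun M hM => by
      rw [hr, hM.inp, hD.inp]
  obtain ⟨found, diag, row, sc, h2, hrow, hsc⟩ := trans_scan (v := { v with
    cur := w[r.val]?, found := false }) hz rfl rfl hD.inp hD.row hD.scope
  have hsol := solutions_drop a₀ bitOf isVar cons w r
  cases hC : w[r.val]?.bind cons with
  | none =>
    refine ⟨_, _, h1.seq <| h2.seq <| .iteFalse (b := fun v => (v.cur.bind cons).isSome)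
      (by simp only [hC]; rfl) (trans_set _ _ _), hD.inp, hrow, hsc, hD.mark, ?_⟩
    simp only [hsol, hC]
    exact hD.rep
  | some C =>
    obtain ⟨c, hc, hcC⟩ := Option.bind_eq_some_iff.1 hC
    -- The scan has already moved the marks to position `r`; a letter that carries a constraint is
    -- no variable letter, so the names after it are the same.
    have hsc' : Scoped sc (scopeOf bitOf isVar w (w.drop (r + 1))) := by
      intro k κ
      rw [hsc k κ, scopeOf, scopeOf, names_drop, hc, Option.any_some, hvar c C hcC]
      rfl
    obtain ⟨v', t, G, V, W, h3, -, hW⟩ := trans_step (a₀ := a₀) hf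
      (closed_solutions hf hcons w _) hz has
      (v := { v with cur := w[r.val]?, found := found, diag := diag, C := C })
      (hcons c C hcC) (D := { D with row := row, sc := sc }) hsc' hD.rep hD.mark
    have hset := trans_set (e := e) (fun v => { v with C := (v.cur.bind cons).getD ∅ })
      { v with cur := w[r.val]?, found := found, diag := diag } { D with row := row, sc := sc }
    simp only [hC, Option.getD_some] at hset
    refine ⟨_, _, h1.seq <| h2.seq <| .iteTrue (b := fun v => (v.cur.bind cons).isSome)
      (by simp only [hC]; rfl) (hset.seq h3),
      hD.inp, hrow, hsc, hD.mark, ?_⟩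
    simp only [hsol, hC]
    exact hW

theorem trans_solve (hf : ∀ x y, f y x x = y ∧ f x x y = y) (hcons : Preserves f cons)
    (hvar : ∀ c C, cons c = some C → isVar c = false) {as : List Q} (has : ∀ a, a ∈ as)
    {e : Var → ℕ} (hz : e .z = 0) {w : List Γ} {v : Core Γ Q K}
    {D : Data Γ Q (w.length + 1) K} (hinp : ∀ k, D.inp k = w[k.val]?)
    (hsc : D.sc = fun _ _ => false) (hmark : D.mark = fun _ => false) :
    ∃ v' D', Trans (solve f a₀ bitOf isVar cons as) e (v, D) (v', D') ∧
      (v'.ans = true ↔ (solutions a₀ bitOf isVar cons w w).Nonempty) := by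
  obtain ⟨W, h1, hW⟩ := trans_initTable (a₀ := a₀) hz (v := v) (D := D)
  have h2 := trans_mapRow (N := w.length + 1) (e := e) (x := .z) (y := .z)
    (F := fun _ _ _ c => { c with row := (c.inp.bind bitOf).isNone }) (v := v)
    (D := { D with W := W }) (D' := { D with
      W := W, row := fun k => (w[k.val]?.bind bitOf).isNone })
    (by decide) (by decide) hz fun M hM => by
      rw [hz]
      refine hM.mapRowField (fun i j => ((M i j).inp.bind bitOf).isNone) _ fun k => ?_
      rw [hM.inp, hinp]
  obtain ⟨⟨v', D'⟩, h3, hD'⟩ := Trans.loop (N := w.length + 1) (x := .r) (e := e)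
    (P := processAt f a₀ bitOf isVar cons as)
    (s := (v, { D with W := W, row := fun k => (w[k.val]?.bind bitOf).isNone }))
    (fun m s => Inv a₀ bitOf isVar cons w m s.2) (by
      rintro m hm ⟨v', D'⟩ hD
      obtain ⟨v₁, D₁, h, hD₁⟩ := trans_processAt hf hcons hvar has
        (e := Function.update e .r m) (by simpa using hz) (r := ⟨m, hm⟩) (by simp) (v := v') hD
      exact ⟨_, h, hD₁⟩) (by
      -- At the start nothing of the word remains. Its word of bits is empty, so `row` marks the
      -- positions without a bit.
      have hdrop : w.drop (w.length + 1) = [] := List.drop_of_length_le (by omega)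
      refine ⟨hinp, fun k => ?_, ?_, hmark, ?_⟩
      · rw [hdrop, run_drop]
        simp only
        rcases w[k.val]?.bind bitOf with _ | b <;> simp [run]
      · intro k κ
        simp [hsc, hdrop, scopeOf, names]
      · rw [hdrop]
        exact hW)
  have h4 := trans_readAt (N := w.length + 1) (e := e) .z .z
    (F := fun v c _ => { v with ans := (baseOf c.W).isSome }) (v := v') (D := D')
    (v' := { v' with ans := (baseOf (D'.W.slice 0 0)).isSome }) hz fun M hM => by
      rw [hz]
      exact congrArg (fun W => { v' with ans := (baseOf W).isSome }) (hM.W 0 0)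
  refine ⟨_, _, h1.seq <| h2.seq <| h3.seq h4, ?_⟩
  have hrep := hD'.rep
  rw [List.drop_zero] at hrep
  constructor
  · intro h
    obtain ⟨b, hb⟩ := Option.isSome_iff_exists.1 h
    have := baseOf_some hb
    simp only [Table.slice, Option.isSome_map] at this
    obtain ⟨⟨p, p'⟩, hp⟩ := Option.isSome_iff_exists.1 this
    exact ⟨p, (hrep.of_some hp).1⟩
  · rintro ⟨s, hs⟩
    by_contra h
    simp only [Bool.not_eq_true, Option.isSome_eq_false_iff, Option.isNone_iff_eq_none] at h
    exact hrep.empty_of_baseOf h s hs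

end Maltsev

/-! ### Polynomial time for constraint words, and assignments of names. -/

namespace Maltsev

open ArrayProg

variable {Γ Q : Type} {N K : ℕ} {f : Q → Q → Q → Q} {a₀ : Q} {bitOf : Γ → Option Bool}
  {isVar : Γ → Bool} {cons : Γ → Option (Set (Fin K → Q))}

theorem wf_stepRow (as : List Q) {A : Finset Var} (hj : .j ∈ A) (hl : .l ∈ A) (hk : .k ∈ A) :
    (stepRow f a₀ as : Pr Γ Q K).WF A := by
  induction as with
  | nil => trivial
  | cons a as ih =>
    simp [stepRow, ih, stepAt, storeRow, gen, clear, tab, insertRow, extend, mark, mapRow, foldRow,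
      readAt, set, Prog.WF, hj, hl, hk]

theorem wf_solve (as : List Q) :
    (solve f a₀ bitOf isVar cons as).WF ({.r, .i, .j, .l, .k} : Finset Var) := by
  have h : (stepRow f a₀ as : Pr Γ Q K).WF {.j, .l, .k} :=
    wf_stepRow as (by decide) (by decide) (by decide)
  simp [solve, initTable, processAt, scan, step, h, mapRow, readAt, set, Prog.WF]

/-- The cell with a given letter and without further information. -/
def blank (a₀ : Q) (o : Option Γ) : Cell Γ Q K where
  inp := o
  row := false
  sc _ := false
  mark := false
  t := a₀
  G _ := a₀
  W _ _ := none
  W' _ _ := none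
  V _ _ := none

theorem nonempty_polyTime [Finite Γ] [Finite Q] {α : Type} (enc : α → List Γ) (F : α → Bool)
    (hf : ∀ x y, f y x x = y ∧ f x x y = y) (hcons : Preserves f cons)
    (hvar : ∀ c C, cons c = some C → isVar c = false)
    (h : ∀ x, F x = true ↔ (solutions a₀ bitOf isVar cons (enc x) (enc x)).Nonempty) :
    Nonempty (Turing.TM2ComputableInPolyTime enc Computability.encodeBool F) := by
  have := Fintype.ofFinite Q
  refine ArrayProg.nonempty_polyTime enc F (fun c => blank a₀ (some c)) (blank a₀ none)
    (⟨none, false, false, false, false, ∅, ∅, a₀, none, none, fun _ => (fun _ => a₀, a₀), ∅⟩,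
      blank a₀ none, blank a₀ none) (fun v => v.1.ans)
    (solve f a₀ bitOf isVar cons Finset.univ.toList) (wf_solve _) fun x => ?_
  obtain ⟨v', D', hT, hans⟩ := trans_solve (a₀ := a₀) (bitOf := bitOf) hf hcons hvar
    (as := Finset.univ.toList) (by simp) (e := fun _ => 0) rfl (w := enc x)
    (v := ⟨none, false, false, false, false, ∅, ∅, a₀, none, none, fun _ => (fun _ => a₀, a₀), ∅⟩)
    (D := {
      inp := fun k => (enc x)[k.val]?
      row := fun _ => false
      sc := fun _ _ => false
      mark := fun _ => false
      t := fun _ => a₀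
      G := fun _ _ => a₀
      W := fun _ _ _ => none
      W' := fun _ _ _ => none
      V := fun _ _ _ => none }) (fun _ => rfl) rfl rfl
  obtain ⟨c', M', heq, -⟩ := hT (blank a₀ none, blank a₀ none)
    (initArr (fun c => blank a₀ (some c)) (blank a₀ none) (enc x)) (by
      have hM : initArr (fun c => blank a₀ (some c)) (blank a₀ none) (enc x) = fun i j =>
          (blank a₀ (if i = 0 then (enc x)[j]? else none) : Cell Γ Q K) := by
        funext i j
        simp only [initArr]
        split_ifs
        · cases (enc x)[j]? <;> rfl
        · rfl
      rw [hM]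
      constructor <;> intros <;> rfl)
  rw [heq, Bool.eq_iff_iff, hans, h]

variable (a₀ bitOf isVar cons)

/-- The assignment `g` of the variables satisfies all constraints in the word. -/
def Sat (g : List Bool → Q) : List Γ → Prop
  | [] => True
  | c :: u => (∀ C, cons c = some C →
      (fun κ : Fin K => (names bitOf isVar u)[κ.val]?.elim a₀ g) ∈ C) ∧ Sat g u

variable {a₀ bitOf isVar cons}

/-- A constraint reads a tuple only at the canonical positions of the names that follow it, so a
tuple and an assignment of names that match there satisfy the same constraints. -/
theorem mem_solutions_iff {w u : List Γ} {s : Fin (w.length + 1) → Q} {g : List Bool → Q}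
    (h : ∀ x ∈ names bitOf isVar u, ∃ k, canon bitOf isVar w x = some k ∧ s k = g x) :
    s ∈ solutions a₀ bitOf isVar cons w u ↔ Sat a₀ bitOf isVar cons g u := by
  induction u with
  | nil => exact Iff.rfl
  | cons c u ih =>
    have hu : ∀ x ∈ names bitOf isVar u, ∃ k, canon bitOf isVar w x = some k ∧ s k = g x := by
      intro x hx
      refine h x ?_
      rw [names]
      split_ifs
      · exact List.mem_cons_of_mem _ hx
      · exact hx
    have hproj : proj a₀ (scopeOf bitOf isVar w u) s =
        fun κ : Fin K => (names bitOf isVar u)[κ.val]?.elim a₀ g := by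
      funext κ
      simp only [proj, scopeOf]
      cases hx : (names bitOf isVar u)[κ.val]? with
      | none => rfl
      | some x =>
        obtain ⟨k, hk, hs⟩ := hu x (List.mem_of_getElem? hx)
        simp [hk, hs]
    rw [solutions, Sat]
    cases hc : cons c with
    | none => simpa using ih hu
    | some C =>
      rw [← ih hu, ← hproj]
      simp only [restrict, Set.mem_ofPred_eq, Option.some.injEq, forall_eq', and_comm]

/-- A tuple gives each name its value at the canonical position. Conversely, an assignment of names
gives each position the value of the word of bits that follows it. -/
theorem solutions_nonempty_iff (w : List Γ) : (solutions a₀ bitOf isVar cons w w).Nonempty ↔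
    ∃ g, Sat a₀ bitOf isVar cons g w := by
  have hc : ∀ x ∈ names bitOf isVar w, ∃ k, canon bitOf isVar w x = some k ∧
      IsName bitOf isVar w x k := by
    intro x hx
    obtain ⟨k, hk⟩ := exists_isName (r := 0) hx
    exact hk.exists_canon
  constructor
  · rintro ⟨s, hs⟩
    refine ⟨fun x => (canon bitOf isVar w x).elim a₀ s, (mem_solutions_iff fun x hx => ?_).1 hs⟩
    obtain ⟨k, hk, -⟩ := hc x hx
    exact ⟨k, hk, by rw [hk, Option.elim_some]⟩
  · rintro ⟨g, hg⟩
    refine ⟨fun k => g (run bitOf (w.drop (k + 1))), (mem_solutions_iff fun x hx => ?_).2 hg⟩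
    obtain ⟨k, hk, h⟩ := hc x hx
    exact ⟨k, hk, by rw [h.2]⟩

end Maltsev

/-! ### Checking all letters of a word. -/

namespace ArrayProg

open Turing

/-- One loop along row `0` forms the conjunction. The variable `false` is never bound and supplies
the row index `0`; the default cell `true` makes the padding neutral. -/
theorem nonempty_polyTime_all {α Γ : Type} [Finite Γ] (enc : α → List Γ) (good : Γ → Bool) :
    Nonempty (TM2ComputableInPolyTime enc Computability.encodeBool fun x => (enc x).all good) := by
  refine nonempty_polyTime enc _ good true true id
    (.loop true (.upd false true fun v c => (v && c, c)) : Prog Bool Bool Bool)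
    (A := {true}) (by simp [Prog.WF]) fun x => ?_
  set M := initArr good true (enc x) with hM
  have H := descend_induction (n := (enc x).length + 1) (s := (true, M))
    (F := fun m s => Prog.eval ((enc x).length + 1) (.upd false true fun v c => (v && c, c))
      (Function.update (fun _ => 0) true m) s)
    (fun m s => s.2 = M ∧ (s.1 = true ↔ ∀ k, m ≤ k → M 0 k = true)) ⟨rfl, by
      simp only [true_iff]
      intro k hk
      simp [hM, initArr, List.getElem?_eq_none (show (enc x).length ≤ k by omega)]⟩ (by
      rintro m hm ⟨v, _⟩ ⟨rfl, h⟩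
      refine ⟨?_, ?_⟩
      · funext i j
        simp only [Prog.eval]
        split_ifs with hij
        · rw [hij.1, hij.2]
        · rfl
      · simp only [Prog.eval, Bool.and_eq_true]
        rw [h]
        constructor
        · rintro ⟨h1, h2⟩ k hk
          rcases eq_or_lt_of_le hk with rfl | hk
          · simpa using h2
          · exact h1 k hk
        · exact fun h => ⟨fun k hk => h k (by omega), by simpa using h m le_rfl⟩)
  rw [Bool.eq_iff_iff]
  refine H.2.trans ?_
  rw [List.all_eq_true]
  constructor
  · intro h c hc
    obtain ⟨k, hk, rfl⟩ := List.mem_iff_getElem.1 hc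
    simpa [hM, initArr, hk] using h k (Nat.zero_le _)
  · intro h k _
    rw [hM, initArr, if_pos rfl]
    cases hc : (enc x)[k]? with
    | none => rfl
    | some c => exact h c (List.mem_of_getElem? hc)

end ArrayProg

/-! ### From sentences to constraint words. -/

namespace FiniteCSP

open FirstOrder.Language Maltsev

variable {L : FirstOrder.Language.{u, 0}}

instance [Finite (Σ n, L.Relations n)] : Finite (Letter L) := by
  refine Finite.of_injective (β := Option (Option (Option (Option (Option
      (Bool ⊕ (Σ n, L.Relations n)))))))
    (fun
      | .ex => none
      | .var => some none
      | .eq => some (some none)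
      | .top => some (some (some none))
      | .bot => some (some (some (some none)))
      | .bit b => some (some (some (some (some (.inl b)))))
      | .rel R => some (some (some (some (some (.inr ⟨_, R⟩)))))) ?_
  intro a b h
  cases a <;> cases b <;> simp at h <;> first | rfl | skip
  · rw [h]
  · obtain ⟨rfl, h⟩ := h
    rw [eq_of_heq h]

/-- The bit that is denoted by a letter. -/
def Letter.toBit : Letter L → Option Bool
  | .bit b => some b
  | _ => none

/-- The letter marks the beginning of a variable. -/
def Letter.isVar : Letter L → Bool
  | .var => true
  | _ => false

variable {A : Type w} [L.Structure A] {Q : Type} {K : ℕ}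

/-- The relation on `Q` that belongs to the head symbol of an atomic formula. -/
def Letter.constraint (ε : A ≃ Q) (hK : 2 ≤ K) (hR : ∀ {n}, L.Relations n → n ≤ K) :
    Letter L → Option (Set (Fin K → Q))
  | .rel R => some {c | Structure.RelMap R fun i => ε.symm (c (Fin.castLE (hR R) i))}
  | .eq => some {c | c ⟨0, by omega⟩ = c ⟨1, by omega⟩}
  | .bot => some ∅
  | _ => none

theorem run_map_bit (l : List Bool) (u : List (Letter L)) :
    run Letter.toBit (l.map .bit ++ u) = l ++ run Letter.toBit u := by
  induction l with
  | nil => rfl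
  | cons b l ih => simp [run, Letter.toBit, ← ih]

theorem names_map_bit (l : List Bool) (u : List (Letter L)) :
    names Letter.toBit Letter.isVar (l.map .bit ++ u) = names Letter.toBit Letter.isVar u := by
  induction l with
  | nil => rfl
  | cons b l ih => simp [names, Letter.isVar, ih]

/-- The condition on `u` ensures that the name ends where the digits of `i` end. -/
theorem names_encodeVar (i : ℕ) {u : List (Letter L)} (hu : run Letter.toBit u = []) :
    names Letter.toBit Letter.isVar (encodeVar L i ++ u) =
      Computability.encodeNat i :: names Letter.toBit Letter.isVar u := by
  simp [encodeVar, names, Letter.isVar, names_map_bit, run_map_bit, hu]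

theorem run_encodeVars {α : Type} (x : α → ℕ) (l : List α) {u : List (Letter L)}
    (hu : run Letter.toBit u = []) :
    run Letter.toBit (l.flatMap (fun i => encodeVar L (x i)) ++ u) = [] := by
  cases l with
  | nil => exact hu
  | cons i l => rfl

theorem names_encodeVars {α : Type} (x : α → ℕ) (l : List α) {u : List (Letter L)}
    (hu : run Letter.toBit u = []) :
    names Letter.toBit Letter.isVar (l.flatMap (fun i => encodeVar L (x i)) ++ u) =
      l.map (fun i => Computability.encodeNat (x i)) ++ names Letter.toBit Letter.isVar u := by
  induction l with
  | nil => rfl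
  | cons i l ih =>
    rw [List.flatMap_cons, List.append_assoc, names_encodeVar _ (run_encodeVars x l hu), ih]
    rfl

variable {ε : A ≃ Q} {hK : 2 ≤ K} {hR : ∀ {n}, L.Relations n → n ≤ K} {a₀ : Q}
  {g : List Bool → Q}

theorem sat_encodeVar (i : ℕ) (u : List (Letter L)) :
    Sat a₀ Letter.toBit Letter.isVar (Letter.constraint ε hK hR) g (encodeVar L i ++ u) ↔
      Sat a₀ Letter.toBit Letter.isVar (Letter.constraint ε hK hR) g u := by
  rw [encodeVar, List.cons_append, Sat, and_iff_right (by simp [Letter.constraint])]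
  induction Computability.encodeNat i with
  | nil => rfl
  | cons b l ih =>
    rw [List.map_cons, List.cons_append, Sat, and_iff_right (by simp [Letter.constraint]), ih]

theorem sat_encodeVars {α : Type} (x : α → ℕ) (l : List α) (u : List (Letter L)) :
    Sat a₀ Letter.toBit Letter.isVar (Letter.constraint ε hK hR) g
      (l.flatMap (fun i => encodeVar L (x i)) ++ u) ↔
      Sat a₀ Letter.toBit Letter.isVar (Letter.constraint ε hK hR) g u := by
  induction l with
  | nil => rfl
  | cons i l ih => rw [List.flatMap_cons, List.append_assoc, sat_encodeVar, ih]

theorem run_encode_atom {n : ℕ} (ψ : Atom L (Fin n)) (u : List (Letter L)) :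
    run Letter.toBit (ψ.encode ++ u) = [] := by
  cases ψ <;> rfl

/-- The names after a head symbol begin with the arguments of the atom, and its constraint looks at
no more of them than its arity. -/
theorem sat_encode_atom {n : ℕ} (ψ : Atom L (Fin n)) {u : List (Letter L)}
    (hu : run Letter.toBit u = []) :
    Sat a₀ Letter.toBit Letter.isVar (Letter.constraint ε hK hR) g (ψ.encode ++ u) ↔
      ψ.Holds A (fun i : Fin n => ε.symm (g (Computability.encodeNat i))) ∧
        Sat a₀ Letter.toBit Letter.isVar (Letter.constraint ε hK hR) g u := by
  cases ψ with
  | rel R v =>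
    rw [Atom.encode, List.cons_append, Sat, sat_encodeVars (fun i : Fin n => i.val),
      names_encodeVars (fun i : Fin n => i.val) _ hu]
    refine and_congr_left' ?_
    simp only [Letter.constraint, Option.some.injEq, forall_eq', Set.mem_ofPred_eq, Atom.Holds]
    refine iff_of_eq (congrArg _ (funext fun i => ?_))
    rw [List.getElem?_append_left (by simp)]
    simp
  | eq x y =>
    rw [Atom.encode, List.cons_append, Sat, List.append_assoc, sat_encodeVar, sat_encodeVar,
      names_encodeVar _ (by rfl), names_encodeVar _ hu]
    simp [Letter.constraint, Atom.Holds]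
  | top =>
    rw [Atom.encode, List.singleton_append, Sat]
    simp [Letter.constraint, Atom.Holds]
  | bot =>
    rw [Atom.encode, List.singleton_append, Sat]
    simp [Letter.constraint, Atom.Holds]

theorem sat_encode_atoms {n : ℕ} (l : List (Atom L (Fin n))) :
    run Letter.toBit (l.flatMap Atom.encode) = [] ∧
    (Sat a₀ Letter.toBit Letter.isVar (Letter.constraint ε hK hR) g (l.flatMap Atom.encode) ↔
      ∀ ψ ∈ l, ψ.Holds A (fun i : Fin n => ε.symm (g (Computability.encodeNat i)))) := by
  induction l with
  | nil => simp [Sat, run]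
  | cons ψ l ih =>
    rw [List.flatMap_cons, sat_encode_atom _ ih.1, ih.2, List.forall_mem_cons]
    exact ⟨run_encode_atom _ _, Iff.rfl⟩

/-- The letters of the quantifier prefix carry no constraint, and names before a constraint letter
do not affect it. -/
theorem sat_encode (φ : PPSentence L) :
    Sat a₀ Letter.toBit Letter.isVar (Letter.constraint ε hK hR) g φ.encode ↔
      ∀ ψ ∈ φ.atoms, ψ.Holds A (fun i : Fin φ.numVars => ε.symm (g (Computability.encodeNat i))) := by
  rw [PPSentence.encode]
  induction List.range φ.numVars with
  | nil => exact (sat_encode_atoms φ.atoms).2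
  | cons i l ih =>
    rw [List.flatMap_cons, List.append_assoc, List.cons_append, Sat, sat_encodeVar, ih,
      and_iff_right (by simp [Letter.constraint])]

theorem holds_iff_exists_sat (φ : PPSentence L) : φ.Holds A ↔
    ∃ g, Sat a₀ Letter.toBit Letter.isVar (Letter.constraint ε hK hR) g φ.encode := by
  simp only [sat_encode]
  constructor
  · rintro ⟨s, hs⟩
    -- Binary encoding is injective, so an assignment of variables is an assignment of their names;
    -- words that name no variable get `a₀`.
    refine ⟨fun x => if h : Computability.decodeNat x < φ.numVars then ε (s ⟨_, h⟩) else a₀, ?_⟩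
    simpa [Computability.decode_encodeNat] using hs
  · rintro ⟨g, hg⟩
    exact ⟨_, hg⟩

/-- Relations are preserved by the polymorphism; equality and the empty constraint are preserved by
any operation. -/
theorem preserves_constraint {f : (Fin 3 → A) → A} (hf : IsPolymorphism L f) :
    Preserves (fun x y z => ε (f ![ε.symm x, ε.symm y, ε.symm z]))
      (Letter.constraint (L := L) ε hK hR) := by
  intro c C hC x hx y hy z hz
  cases c with
  | rel R =>
    cases hC
    have := hf _ R ![_, _, _] (Fin.forall_fin_succ.2 ⟨hx, Fin.forall_fin_succ.2 ⟨hy,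
      Fin.forall_fin_succ.2 ⟨hz, fun i => i.elim0⟩⟩⟩)
    refine (congrArg (Structure.RelMap R) (funext fun i => ?_)).mp this
    simp only [lift, Equiv.symm_apply_apply]
    congr 1
    funext j
    fin_cases j <;> rfl
  | eq =>
    cases hC
    simp only [Set.mem_ofPred_eq, lift] at *
    rw [hx, hy, hz]
  | bot =>
    cases hC
    cases hx
  | ex => cases hC
  | var => cases hC
  | bit b => cases hC
  | top => cases hC

open Classical in
/-- The letters that occur in true sentences over the empty structure. -/
noncomputable def Letter.isGood (A : Type w) [L.Structure A] : Letter L → Bool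
  | .ex => false
  | .bot => false
  | .rel R => decide (∃ c : Fin _ → A, Structure.RelMap R c)
  | _ => true

theorem good_encodeVar (i : ℕ) : (encodeVar L i).all (Letter.isGood A) = true := by
  simp [encodeVar, Letter.isGood]

/-- Over the empty domain any quantifier makes the sentence false. Without quantifiers there are no
variables, so relational atoms are nullary and their truth depends on the head symbol alone. -/
theorem holds_iff_good [IsEmpty A] (φ : PPSentence L) :
    φ.Holds A ↔ φ.encode.all (Letter.isGood A) = true := by
  obtain ⟨n, l⟩ := φ
  rw [PPSentence.encode, List.all_append, Bool.and_eq_true]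
  cases n with
  | succ n =>
    refine iff_of_false ?_ ?_
    · rintro ⟨s, -⟩
      exact isEmptyElim (s 0)
    · simp [List.range_succ_eq_map, Letter.isGood]
  | zero =>
    simp only [List.range_zero, List.flatMap_nil, List.all_nil, true_and, List.all_flatMap,
      List.all_eq_true (l := l)]
    have hs : ∀ s : Fin 0 → A, ∀ ψ : Atom L (Fin 0),
        ψ.Holds A s ↔ ψ.encode.all (Letter.isGood A) = true := by
      intro s ψ
      cases ψ with
      | @rel k R v =>
        have hk : IsEmpty (Fin k) := ⟨fun i => (v i).elim0⟩
        simp only [Atom.Holds, Atom.encode, List.all_cons, List.all_flatMap, good_encodeVar,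
          Letter.isGood, Bool.and_eq_true, decide_eq_true_eq]
        refine ⟨fun h => ⟨⟨_, h⟩, by simp⟩, ?_⟩
        rintro ⟨⟨c, hc⟩, -⟩
        rwa [Subsingleton.elim (fun i => s (v i)) c]
      | eq x => exact x.elim0
      | top => simp [Atom.Holds, Atom.encode, Letter.isGood]
      | bot => simp [Atom.Holds, Atom.encode, Letter.isGood]
    constructor
    · rintro ⟨s, h⟩ ψ hψ
      exact (hs s ψ).1 (h ψ hψ)
    · exact fun h => ⟨fun i => i.elim0, fun ψ hψ => (hs _ ψ).2 (h ψ hψ)⟩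

end FiniteCSP

/-! ### The main theorem. -/

theorem mainTheorem9 (L : FirstOrder.Language.{u, 0}) [L.IsRelational]
    [Finite (Σ n, L.Relations n)] (A : Type w) [Finite A] [L.Structure A]
    (hA : ∃ f : (Fin 3 → A) → A, FiniteCSP.IsPolymorphism L f ∧ FiniteCSP.IsMaltsev f) :
    FiniteCSP.CSPInPolyTime L A := by
  classical
  obtain ⟨f, hf, hm⟩ := hA
  rcases isEmpty_or_nonempty A with hA | ⟨⟨a⟩⟩
  -- The general algorithm needs a default value `a₀`, so the empty domain is treated separately.
  · have h : (fun φ : FiniteCSP.PPSentence L => decide (φ.Holds A)) =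
        fun φ => φ.encode.all (FiniteCSP.Letter.isGood A) := by
      funext φ
      rw [Bool.eq_iff_iff, decide_eq_true_eq, FiniteCSP.holds_iff_good]
    have := ArrayProg.nonempty_polyTime_all (FiniteCSP.PPSentence.encode (L := L))
      (FiniteCSP.Letter.isGood A)
    rw [← h] at this
    unfold FiniteCSP.CSPInPolyTime
    convert this
  -- The domain is moved to `Fin n`, since the alphabets and memory of the machine live in `Type`.
  -- Constraints get the common arity `max 2 K₀`, with `K₀` bounding the arities in the signature
  -- and `2` for equality.
  · obtain ⟨n, ⟨ε⟩⟩ := Finite.exists_equiv_fin A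
    obtain ⟨K₀, hK₀⟩ := (Set.finite_range fun R : Σ n, L.Relations n => R.1).bddAbove
    have hR : ∀ {n}, L.Relations n → n ≤ max 2 K₀ := fun {n} R =>
      (hK₀ ⟨⟨n, R⟩, rfl⟩).trans (le_max_right _ _)
    have := Maltsev.nonempty_polyTime (a₀ := ε a) (bitOf := FiniteCSP.Letter.toBit)
      (isVar := FiniteCSP.Letter.isVar)
      (cons := FiniteCSP.Letter.constraint (L := L) ε (le_max_left 2 K₀) hR)
      (FiniteCSP.PPSentence.encode (L := L)) (fun φ => decide (φ.Holds A))
      (f := fun x y z => ε (f ![ε.symm x, ε.symm y, ε.symm z]))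
      (fun x y => ⟨by rw [(hm _ _).1, ε.apply_symm_apply], by rw [(hm _ _).2, ε.apply_symm_apply]⟩)
      (FiniteCSP.preserves_constraint hf)
      (fun c C hC => by cases c <;> first | rfl | cases hC)
      (fun φ => by
        rw [decide_eq_true_eq, Maltsev.solutions_nonempty_iff]
        exact FiniteCSP.holds_iff_exists_sat φ)
    unfold FiniteCSP.CSPInPolyTime
    convert this
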